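/- Let $k$ be an algebraically closed field, $n>1$ an integer not divisible by the characteristic of $k$, $\theta\in k$ a primitive $n$th root of unity and $w$ a positive integer. Put $b=\gcd(n,w)$, $n=n'b$, $w=w'b$, and let $0\le i_0\le b-1$ be such that $\gcd(n,w'+n'i_0)=1$. Let $B$ be the $k$-algebra with generators $h^{\pm1},f,y$ and relations $$hh^{-1}=h^{-1}h=1,\quad f^b=1,\quad hf=fh,\quad yh=\theta hy,\quad yf=\theta^{n'}fy,\quad y^n=1-h^{nw'}.$$ Put $x=h^{n'}f^{-1}$, $g=h^{w'}f^{i_0}$, $\xi=\theta^{w'+n'i_0}$. Then $B=B(n,w,\xi)$ is a Hopf algebra (a generalised Liu algebra) with $\Delta(h)=h\otimes h$, $\Delta(f)=f\otimes f$, $\Delta(y)=y\otimes g+1\otimes y$, $\varepsilon(h)=\varepsilon(f)=1$, $\varepsilon(y)=0$, $S(h)=h^{-1}$, $S(f)=f^{-1}$, $S(y)=-yg^{-1}$. For an Artin–Schelter Gorenstein Hopf algebra $A$ of injective dimension $d$, let $\pi:A\to k$ be the algebra map giving the right structure of the one-dimensional bimodule $\int^l_A=\mathrm{Ext}^d_A({}_Ak,{}_AA)$,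 let $\Xi^l_\pi(a)=\sum\pi(a_1)a_2$ and $\Xi^r_\pi(a)=\sum a_1\pi(a_2)$ be its winding automorphisms, and $G^l_\pi=\langle\Xi^l_\pi\rangle$, $G^r_\pi=\langle\Xi^r_\pi\rangle$. The integral order $io(A)$ is the order of $\pi$ in the group of algebra maps $A\to k$ under convolution, and the integral minor is $im(A)=|G^l_\pi/(G^l_\pi\cap G^r_\pi)|$. The PI-degree of a ring $R$ is the least $m$ such that $R$ embeds in $M_m(C)$ for some commutative ring $C$. The following hold. (a) $B$ is also generated by $x^{\pm1},g,y$ with defining relations $yg=\xi gy$, $y^n=1-x^w=1-g^n$, $xy=yx$, $xg=gx$, $xx^{-1}=x^{-1}x=1$. (b) $B$ is an affine (left and right) noetherian Hopf algebra of Gel'fand–Kirillov dimension $1$, and its centre is the Laurent polynomial algebra $k[x^{\pm1}]$. (c) $B$ is prime. (d) The PI-degree of $B$ is $n$. (e) $B$ has finite global dimension if and only if $w$ is a unit in $k$; in this case its global dimension is $1$. (f) $B$ is Artin–Schelter Gorenstein and $io(B)=im(B)=n$. (g) With $\pi$ given by $\int^l_B$, the fixed subrings are $B^{\Xi^l_\pi}=k\langle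 y,x^{\pm1}\rangle$ and $B^{\Xi^r_\pi}=k\langle yg^{-1},x^{\pm1}\rangle$, and $B^{\Xi^l_\pi}\cap B^{\Xi^r_\pi}=k[x^{\pm1}]=Z(B)$. (h) The group of group-like elements of $B$ is $\langle h,f\rangle\cong C_\infty\times C_b$, with $h$ and $f$ generating the two factors. (i) If $a\ne1$ is group-like and $z\in B$ is a nontrivial $(a,1)$-primitive element, that is, $\Delta(z)=z\otimes a+1\otimes z$ and $z\notin k(1-a)$, then $a=g$ and $z\in ky+k(1-g)$. (j) Let $\bar B=B(\bar n,\bar w,\bar\xi)$ be another Hopf algebra of the same kind over $k$, with corresponding elements $\bar x,\bar g,\bar y$. If $\phi:\bar B\to B$ is a Hopf algebra isomorphism, then $\bar n=n$, $\bar w=w$, $\bar\xi=\xi$, $\phi(\bar x)=x$, $\phi(\bar g)=g$, and $\phi(\bar y)=\eta y$ for some $\eta\in k$ with $\eta^n=1$. -/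

import Mathlib

open scoped TensorProduct LaurentPolynomial

universe u

/-! ### Generalised Liu algebras: the first presentation -/

/-- The data entering the construction of a generalised Liu algebra over `k`:
integers `n > 1` (nonzero in `k`) and `w > 0`, a primitive `n`-th root of unity `θ`, and, writing
`b = gcd (n, w)`, `n = n' b`, `w = w' b`, an exponent `0 ≤ i₀ ≤ b - 1` with
`gcd (n, w' + n' i₀) = 1`. -/
structure LiuDatum (k : Type u) [Field k] where
  n : ℕ
  w : ℕ
  θ : k
  i₀ : ℕ
  one_lt_n : 1 < n
  n_ne_zero : (n : k) ≠ 0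
  w_pos : 0 < w
  primitive : IsPrimitiveRoot θ n
  i₀_lt : i₀ < n.gcd w
  gcd_eq_one : n.gcd (w / n.gcd w + n / n.gcd w * i₀) = 1

/-- Names of the generators `h, h⁻¹, f, y`. -/
inductive LiuGen : Type
  | h | hInv | f | y

namespace LiuDatum

variable {k : Type u} [Field k] (D : LiuDatum k)

/-- `b = gcd (n, w)`. -/
def b : ℕ := D.n.gcd D.w

/-- `n' = n / b`. -/
def n' : ℕ := D.n / D.b

/-- `w' = w / b`. -/
def w' : ℕ := D.w / D.b

/-- `ξ = θ ^ (w' + n' i₀)`. -/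
def ξ : k := D.θ ^ (D.w' + D.n' * D.i₀)

open LiuGen in
/-- The defining relations in the generators `h, h⁻¹, f, y`. -/
inductive Rel : FreeAlgebra k LiuGen → FreeAlgebra k LiuGen → Prop
  | h_hInv : Rel (.ι k h * .ι k hInv) 1
  | hInv_h : Rel (.ι k hInv * .ι k h) 1
  | f_pow : Rel (.ι k f ^ D.b) 1
  | h_f : Rel (.ι k h * .ι k f) (.ι k f * .ι k h)
  | y_h : Rel (.ι k y * .ι k h) (D.θ • (.ι k h * .ι k y))
  | y_f : Rel (.ι k y * .ι k f) (D.θ ^ D.n' • (.ι k f * .ι k y))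
  | y_pow : Rel (.ι k y ^ D.n) (1 - .ι k h ^ (D.n * D.w'))

/-- The algebra underlying the generalised Liu algebra: generators `h, h⁻¹, f, y`, with
relations `Rel`. -/
def Alg : Type u := RingQuot D.Rel

noncomputable instance : Ring D.Alg := inferInstanceAs (Ring (RingQuot D.Rel))

noncomputable instance : Algebra k D.Alg := inferInstanceAs (Algebra k (RingQuot D.Rel))

/-- The quotient map from the free algebra. -/
noncomputable def ofFree : FreeAlgebra k LiuGen →ₐ[k] D.Alg := RingQuot.mkAlgHom k D.Rel

theorem ofFree_rel {a c : FreeAlgebra k LiuGen} (hac : D.Rel a c) : D.ofFree a = D.ofFree c :=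
  RingQuot.mkAlgHom_rel k hac

theorem ofFree_surjective : Function.Surjective D.ofFree := RingQuot.mkAlgHom_surjective k D.Rel

/-- The generator `y`. -/
noncomputable def y : D.Alg := D.ofFree (.ι k .y)

/-- The generator `h`, as a unit. -/
noncomputable def h : D.Algˣ where
  val := D.ofFree (.ι k .h)
  inv := D.ofFree (.ι k .hInv)
  val_inv := by rw [← map_mul, D.ofFree_rel .h_hInv, map_one]
  inv_val := by rw [← map_mul, D.ofFree_rel .hInv_h, map_one]

theorem b_pos : 0 < D.b := Nat.gcd_pos_of_pos_right _ D.w_pos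

/-- The generator `f`, as a unit. -/
noncomputable def f : D.Algˣ :=
  Units.ofPowEqOne (D.ofFree (.ι k .f)) D.b (by rw [← map_pow, D.ofFree_rel .f_pow, map_one]) D.b_pos.ne'

/-- `x = h ^ n' f⁻¹`. -/
noncomputable def x : D.Algˣ := D.h ^ D.n' * D.f⁻¹

/-- `g = h ^ w' f ^ i₀`. -/
noncomputable def g : D.Algˣ := D.h ^ D.w' * D.f ^ D.i₀

/-! ### The Hopf algebra structure -/

theorem n'_mul_b : D.n' * D.b = D.n := Nat.div_mul_cancel (Nat.gcd_dvd_left _ _)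

theorem w'_mul_b : D.w' * D.b = D.w := Nat.div_mul_cancel (Nat.gcd_dvd_right _ _)

theorem ξ_primitive : IsPrimitiveRoot D.ξ D.n :=
  D.primitive.pow_of_coprime _ (Nat.Coprime.symm D.gcd_eq_one)

theorem val_h : (D.h : D.Alg) = D.ofFree (.ι k .h) := rfl

theorem val_h_inv : ((D.h⁻¹ : D.Algˣ) : D.Alg) = D.ofFree (.ι k .hInv) := rfl

theorem val_f : (D.f : D.Alg) = D.ofFree (.ι k .f) := rfl

theorem f_pow_b : D.f ^ D.b = 1 :=
  Units.ext (by rw [Units.val_pow_eq_pow_val, val_f, ← map_pow, D.ofFree_rel .f_pow, map_one]; rfl)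

theorem h_comm_f : Commute D.h D.f :=
  Units.ext (by
    rw [Units.val_mul, Units.val_mul, val_f, val_h, ← map_mul, D.ofFree_rel .h_f, map_mul])

theorem y_mul_h : D.y * D.h = D.θ • ((D.h : D.Alg) * D.y) := by
  rw [val_h, y, ← map_mul, D.ofFree_rel .y_h, map_smul, map_mul]

theorem y_mul_f : D.y * D.f = D.θ ^ D.n' • ((D.f : D.Alg) * D.y) := by
  rw [val_f, y, ← map_mul, D.ofFree_rel .y_f, map_smul, map_mul]

theorem y_pow_n : D.y ^ D.n = 1 - (D.h : D.Alg) ^ (D.n * D.w') := by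
  rw [val_h, y, ← map_pow, D.ofFree_rel .y_pow, map_sub, map_one, map_pow]

/-- If `c a = q a c`, then `c aᵐ = qᵐ aᵐ c`. -/
theorem skew_pow {R : Type*} [Ring R] [Algebra k R] {a c : R} {q : k} (hca : c * a = q • (a * c))
    (m : ℕ) : c * a ^ m = q ^ m • (a ^ m * c) := by
  induction m with
  | zero => simp
  | succ m ih =>
    rw [pow_succ, ← mul_assoc, ih, smul_mul_assoc, mul_assoc, hca, mul_smul_comm, smul_smul,
      ← pow_succ, mul_assoc]

theorem y_mul_g : D.y * D.g = D.ξ • ((D.g : D.Alg) * D.y) := by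
  rw [g, Units.val_mul, Units.val_pow_eq_pow_val, Units.val_pow_eq_pow_val, ← mul_assoc,
    skew_pow D.y_mul_h, smul_mul_assoc, mul_assoc, skew_pow D.y_mul_f, mul_smul_comm, smul_smul,
    ξ, pow_add, pow_mul, mul_assoc]

theorem g_pow_n : (D.g : D.Alg) ^ D.n = (D.h : D.Alg) ^ (D.n * D.w') := by
  rw [← Units.val_pow_eq_pow_val, ← Units.val_pow_eq_pow_val, g,
    ((D.h_comm_f.pow_pow _ _)).mul_pow, ← pow_mul, ← pow_mul]
  have : D.f ^ (D.i₀ * D.n) = 1 := by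
    rw [← D.n'_mul_b, ← mul_assoc, mul_comm, pow_mul, f_pow_b, one_pow]
  rw [this, mul_one, mul_comm]

/-- Gaussian binomial coefficients. -/
def gauss (q : k) : ℕ → ℕ → k
  | _, 0 => 1
  | 0, _ + 1 => 0
  | m + 1, j + 1 => gauss q m j + q ^ (j + 1) * gauss q m (j + 1)

theorem gauss_eq_zero (q : k) : ∀ m j : ℕ, m < j → gauss q m j = 0
  | 0, j + 1, _ => by simp [gauss]
  | m + 1, j + 1, h => by
    rw [gauss, gauss_eq_zero q m j (by omega), gauss_eq_zero q m (j + 1) (by omega)]; simp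

theorem gauss_self (q : k) (m : ℕ) : gauss q m m = 1 := by
  induction m with
  | zero => simp [gauss]
  | succ m ih => rw [gauss, ih, gauss_eq_zero q m (m + 1) (by omega)]; simp

theorem gauss_step (q : k) (m j : ℕ) :
    q ^ j * (1 - q ^ (j + 1)) * gauss q m (j + 1) = (q ^ j - q ^ m) * gauss q m j := by
  induction m generalizing j with
  | zero => cases j <;> simp [gauss]
  | succ m ih =>
    cases j with
    | zero =>
      have := ih 0
      simp only [gauss, pow_zero, zero_add, one_mul, mul_one] at this ⊢
      linear_combination q * this
    | succ j =>
      have h1 := ih j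
      have h2 := ih (j + 1)
      simp only [gauss] at h1 h2 ⊢
      linear_combination q ^ (j + 2) * h2 + q * h1

theorem gauss_eq_zero_of_primitive {q : k} {n : ℕ} (hq : IsPrimitiveRoot q n) (j : ℕ)
    (hj : j + 1 < n) : gauss q n (j + 1) = 0 := by
  have key := gauss_step q n j
  have hq0 : q ≠ 0 := hq.ne_zero (by omega)
  have h1 : (1 : k) - q ^ (j + 1) ≠ 0 :=
    sub_ne_zero.2 (hq.pow_ne_one_of_pos_of_lt (by omega) hj).symm
  have h2 : (q ^ j - q ^ n) * gauss q n j = 0 := by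
    cases j with
    | zero => rw [hq.pow_eq_one]; simp
    | succ j => rw [gauss_eq_zero_of_primitive hq j (by omega), mul_zero]
  rw [h2] at key
  exact (mul_eq_zero.1 key).resolve_left (mul_ne_zero (pow_ne_zero _ hq0) h1)

theorem add_pow_gauss {R : Type*} [Ring R] [Algebra k R] {a c : R} {q : k}
    (hca : c * a = q • (a * c)) (m : ℕ) :
    (a + c) ^ m = ∑ j ∈ Finset.range (m + 1), gauss q m j • (a ^ j * c ^ (m - j)) := by
  induction m with
  | zero => simp [gauss]
  | succ m ih =>
    have e1 : a * ∑ j ∈ Finset.range (m + 1), gauss q m j • (a ^ j * c ^ (m - j)) =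
        ∑ j ∈ Finset.range (m + 1), gauss q m j • (a ^ (j + 1) * c ^ (m - j)) := by
      rw [Finset.mul_sum]
      refine Finset.sum_congr rfl fun j _ => ?_
      rw [mul_smul_comm, ← mul_assoc, ← pow_succ']
    have e2 : c * ∑ j ∈ Finset.range (m + 1), gauss q m j • (a ^ j * c ^ (m - j)) =
        ∑ j ∈ Finset.range (m + 2), (q ^ j * gauss q m j) • (a ^ j * c ^ (m + 1 - j)) := by
      rw [Finset.sum_range_succ _ (m + 1), gauss_eq_zero q m (m + 1) (by omega), mul_zero,
        zero_smul, add_zero, Finset.mul_sum]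
      refine Finset.sum_congr rfl fun j hj => ?_
      have hj' : m + 1 - j = (m - j) + 1 := by
        have := Finset.mem_range.1 hj; omega
      rw [mul_smul_comm, ← mul_assoc, skew_pow hca, smul_mul_assoc, smul_smul, mul_assoc,
        ← pow_succ', hj', mul_comm]
    rw [pow_succ', ih, add_mul, e1, e2, Finset.sum_range_succ' _ (m + 1),
      Finset.sum_range_succ' _ (m + 1), ← add_assoc, ← Finset.sum_add_distrib]
    congr 1
    · refine Finset.sum_congr rfl fun j _ => ?_
      rw [Nat.add_sub_add_right, ← add_smul, gauss]
    · simp [gauss]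

theorem add_pow_primitive {R : Type*} [Ring R] [Algebra k R] {a c : R} {q : k} {n : ℕ}
    (hn : 0 < n) (hq : IsPrimitiveRoot q n) (hca : c * a = q • (a * c)) :
    (a + c) ^ n = a ^ n + c ^ n := by
  obtain ⟨m, rfl⟩ : ∃ m, n = m + 1 := ⟨n - 1, by omega⟩
  rw [add_pow_gauss hca, Finset.sum_range_succ, Finset.sum_range_succ', Finset.sum_eq_zero]
  · rw [gauss_self]
    simp [gauss, add_comm]
  · intro j hj
    rw [gauss_eq_zero_of_primitive hq j (by have := Finset.mem_range.1 hj; omega), zero_smul]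

section lift

variable {R : Type*} [Ring R] [Algebra k R]

/-- The universal property of the presentation. -/
noncomputable def lift (H : Rˣ) (F Y : R) (hF : F ^ D.b = 1) (hHF : H * F = F * H)
    (hYH : Y * H = D.θ • (H * Y)) (hYF : Y * F = D.θ ^ D.n' • (F * Y))
    (hY : Y ^ D.n = 1 - (H : R) ^ (D.n * D.w')) : D.Alg →ₐ[k] R :=
  RingQuot.liftAlgHom k ⟨FreeAlgebra.lift k fun
    | .h => (H : R)
    | .hInv => ((H⁻¹ : Rˣ) : R)
    | .f => F
    | .y => Y, by
    intro a c hac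
    cases hac <;> simp [*]⟩

variable (H : Rˣ) (F Y : R) (hF : F ^ D.b = 1) (hHF : H * F = F * H)
    (hYH : Y * H = D.θ • (H * Y)) (hYF : Y * F = D.θ ^ D.n' • (F * Y))
    (hY : Y ^ D.n = 1 - (H : R) ^ (D.n * D.w'))

theorem lift_ofFree (a : FreeAlgebra k LiuGen) :
    D.lift H F Y hF hHF hYH hYF hY (D.ofFree a) = FreeAlgebra.lift k (fun
    | .h => (H : R)
    | .hInv => ((H⁻¹ : Rˣ) : R)
    | .f => F
    | .y => Y) a := by
  exact RingQuot.liftAlgHom_mkAlgHom_apply _ _ _ _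

@[simp] theorem lift_h : D.lift H F Y hF hHF hYH hYF hY D.h = H := by
  rw [val_h, lift_ofFree, FreeAlgebra.lift_ι_apply]

@[simp] theorem lift_f : D.lift H F Y hF hHF hYH hYF hY D.f = F := by
  rw [val_f, lift_ofFree, FreeAlgebra.lift_ι_apply]

@[simp] theorem lift_y : D.lift H F Y hF hHF hYH hYF hY D.y = Y := by
  rw [y, lift_ofFree, FreeAlgebra.lift_ι_apply]

end lift

/-- Induction over the generators. -/
theorem induction {P : D.Alg → Prop} (hc : ∀ c : k, P (algebraMap k D.Alg c)) (hh : P D.h)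
    (hh' : P ((D.h⁻¹ : D.Algˣ) : D.Alg)) (hf : P D.f) (hy : P D.y)
    (hadd : ∀ a c, P a → P c → P (a + c)) (hmul : ∀ a c, P a → P c → P (a * c)) (a : D.Alg) :
    P a := by
  obtain ⟨a, rfl⟩ := D.ofFree_surjective a
  induction a using FreeAlgebra.induction with
  | grade0 c => rw [AlgHom.commutes]; exact hc c
  | grade1 s => cases s; exacts [hh, hh', hf, hy]
  | mul a c ha hc => rw [map_mul]; exact hmul _ _ ha hc
  | add a c ha hc => rw [map_add]; exact hadd _ _ ha hc

theorem algHom_ext {R : Type*} [Ring R] [Algebra k R] {φ ψ : D.Alg →ₐ[k] R} (hh : φ D.h = ψ D.h)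
    (hf : φ D.f = ψ D.f) (hy : φ D.y = ψ D.y) : φ = ψ := by
  ext a
  refine D.induction (P := fun a => φ a = ψ a) (fun c => by simp) hh ?_ hf hy
    (fun a c ha hc => by rw [map_add, map_add, ha, hc])
    (fun a c ha hc => by rw [map_mul, map_mul, ha, hc]) a
  have : Units.map (φ : D.Alg →* R) D.h = Units.map (ψ : D.Alg →* R) D.h := Units.ext hh
  have := congrArg (fun u : Rˣ => ((u⁻¹ : Rˣ) : R)) this
  simpa [← map_inv] using this

/-- The counit: `ε(h) = ε(f) = 1`, `ε(y) = 0`. -/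
noncomputable def counitHom : D.Alg →ₐ[k] k :=
  D.lift 1 1 0 (by simp) (by simp) (by simp) (by simp)
    (by simp [show D.n ≠ 0 by have := D.one_lt_n; omega])

/-- The unit `h ⊗ h`. -/
noncomputable def comulUnit : (D.Alg ⊗[k] D.Alg)ˣ where
  val := (D.h : D.Alg) ⊗ₜ (D.h : D.Alg)
  inv := ((D.h⁻¹ : D.Algˣ) : D.Alg) ⊗ₜ ((D.h⁻¹ : D.Algˣ) : D.Alg)
  val_inv := by simp [Algebra.TensorProduct.one_def]
  inv_val := by simp [Algebra.TensorProduct.one_def]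

theorem val_comulUnit : (D.comulUnit : D.Alg ⊗[k] D.Alg) = (D.h : D.Alg) ⊗ₜ (D.h : D.Alg) := rfl

theorem g_comm_h : Commute D.g D.h :=
  ((Commute.refl D.h).pow_left _).mul_left (D.h_comm_f.symm.pow_left _)

theorem g_comm_f : Commute D.g D.f :=
  (D.h_comm_f.pow_left _).mul_left ((Commute.refl D.f).pow_left _)

theorem comulUnit_mul : (D.comulUnit : D.Alg ⊗[k] D.Alg) * ((D.f : D.Alg) ⊗ₜ (D.f : D.Alg)) =
    ((D.f : D.Alg) ⊗ₜ (D.f : D.Alg)) * (D.comulUnit : D.Alg ⊗[k] D.Alg) := by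
  have := congrArg (Units.val) D.h_comm_f.eq
  simp only [Units.val_mul] at this
  simp [val_comulUnit, this]

/-- The coproduct: `Δ(h) = h ⊗ h`, `Δ(f) = f ⊗ f`, `Δ(y) = y ⊗ g + 1 ⊗ y`. -/
noncomputable def comulHom : D.Alg →ₐ[k] D.Alg ⊗[k] D.Alg :=
  D.lift D.comulUnit ((D.f : D.Alg) ⊗ₜ (D.f : D.Alg)) (D.y ⊗ₜ (D.g : D.Alg) + 1 ⊗ₜ D.y)
    (by rw [Algebra.TensorProduct.tmul_pow, ← Units.val_pow_eq_pow_val, f_pow_b]; rfl)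
    D.comulUnit_mul
    (by
      have hg := congrArg (Units.val) D.g_comm_h.eq
      simp only [Units.val_mul] at hg
      simp only [val_comulUnit, add_mul, mul_add, Algebra.TensorProduct.tmul_mul_tmul, y_mul_h,
        one_mul, mul_one, hg, TensorProduct.smul_tmul', TensorProduct.tmul_smul, smul_add])
    (by
      have hg := congrArg (Units.val) D.g_comm_f.eq
      simp only [Units.val_mul] at hg
      simp only [add_mul, mul_add, Algebra.TensorProduct.tmul_mul_tmul, y_mul_f, one_mul, mul_one,
        hg, TensorProduct.smul_tmul', TensorProduct.tmul_smul, smul_add])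
    (by
      rw [add_pow_primitive (by have := D.one_lt_n; omega) D.ξ_primitive]
      · simp only [val_comulUnit, Algebra.TensorProduct.tmul_pow, one_pow, y_pow_n, g_pow_n,
          TensorProduct.sub_tmul, TensorProduct.tmul_sub, Algebra.TensorProduct.one_def]
        abel
      · simp only [Algebra.TensorProduct.tmul_mul_tmul, one_mul, mul_one, y_mul_g,
          TensorProduct.tmul_smul])

@[simp] theorem counitHom_h : D.counitHom D.h = 1 := by simp [counitHom]

@[simp] theorem counitHom_f : D.counitHom D.f = 1 := by simp [counitHom]

@[simp] theorem counitHom_y : D.counitHom D.y = 0 := by simp [counitHom]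

@[simp] theorem comulHom_h : D.comulHom D.h = (D.h : D.Alg) ⊗ₜ (D.h : D.Alg) := by
  rw [comulHom, lift_h]; rfl

@[simp] theorem comulHom_f : D.comulHom D.f = (D.f : D.Alg) ⊗ₜ (D.f : D.Alg) := by
  rw [comulHom, lift_f]

@[simp] theorem comulHom_y : D.comulHom D.y = D.y ⊗ₜ (D.g : D.Alg) + 1 ⊗ₜ D.y := by
  rw [comulHom, lift_y]

theorem counitHom_g : D.counitHom D.g = 1 := by
  simp [g]

theorem comulHom_g : D.comulHom D.g = (D.g : D.Alg) ⊗ₜ (D.g : D.Alg) := by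
  simp [g, Algebra.TensorProduct.tmul_pow]

noncomputable instance : Bialgebra k D.Alg :=
  Bialgebra.ofAlgHom D.comulHom D.counitHom
    (by
      apply D.algHom_ext
      · simp
      · simp
      · simp [TensorProduct.add_tmul, TensorProduct.tmul_add, comulHom_g, add_assoc,
          Algebra.TensorProduct.one_def])
    (by
      apply D.algHom_ext
      · simp
      · simp
      · simp)
    (by
      apply D.algHom_ext
      · simp
      · simp
      · simp [counitHom_g])

theorem comul_eq (a : D.Alg) : Coalgebra.comul (R := k) a = D.comulHom a := rfl

theorem counit_eq (a : D.Alg) : Coalgebra.counit (R := k) a = D.counitHom a := rfl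

theorem inv_skew {R : Type*} [Ring R] [Algebra k R] {u : Rˣ} {c : R} {q : k}
    (hcu : c * u = q • ((u : R) * c)) :
    ((u⁻¹ : Rˣ) : R) * c = q • (c * ((u⁻¹ : Rˣ) : R)) := by
  have := congrArg (fun t => ((u⁻¹ : Rˣ) : R) * t * ((u⁻¹ : Rˣ) : R)) hcu
  simpa [mul_assoc] using this

theorem mul_pow_skew {R : Type*} [Ring R] [Algebra k R] {a c : R} {q : k}
    (hca : c * a = q • (a * c)) (m : ℕ) : (a * c) ^ m = q ^ (m.choose 2) • (a ^ m * c ^ m) := by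
  induction m with
  | zero => simp
  | succ m ih =>
    rw [pow_succ', ih, mul_smul_comm, show a * c * (a ^ m * c ^ m) = a * (c * a ^ m) * c ^ m by
      simp only [mul_assoc], skew_pow hca, mul_smul_comm, smul_mul_assoc, smul_smul, ← pow_add,
      Nat.choose_succ_succ' m 1, Nat.choose_one_right, add_comm m, pow_succ' a, pow_succ' c]
    simp only [mul_assoc]

theorem sign_primitive {q : k} {n : ℕ} (hn : 0 < n) (hq : IsPrimitiveRoot q n) :
    (-1) ^ n * q ^ (n.choose 2) = -1 := by
  rcases Nat.even_or_odd' n with ⟨m, rfl | rfl⟩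
  · have h1 : q ^ m = -1 := by
      have h2 : (q ^ m - 1) * (q ^ m + 1) = 0 := by
        have := hq.pow_eq_one
        rw [mul_comm, pow_mul] at this
        linear_combination this
      rcases mul_eq_zero.1 h2 with h3 | h3
      · exact absurd (sub_eq_zero.1 h3) (hq.pow_ne_one_of_pos_of_lt (by omega) (by omega))
      · exact eq_neg_of_add_eq_zero_left h3
    have h4 : (2 * m).choose 2 = m * (2 * m - 1) := by
      rw [Nat.choose_two_right, mul_assoc, Nat.mul_div_cancel_left _ (by norm_num)]
    rw [h4, pow_mul q, h1, (even_two_mul m).neg_one_pow, one_mul, Odd.neg_one_pow]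
    exact ⟨m - 1, by omega⟩
  · have h4 : (2 * m + 1).choose 2 = (2 * m + 1) * m := by
      rw [Nat.choose_two_right, Nat.add_sub_cancel, mul_left_comm,
        Nat.mul_div_cancel_left _ (by norm_num)]
    rw [h4, pow_mul, hq.pow_eq_one, one_pow, mul_one, Odd.neg_one_pow ⟨m, rfl⟩]

open MulOpposite in
/-- The antipode, as an algebra map to the opposite algebra: `S(h) = h⁻¹`, `S(f) = f⁻¹`,
`S(y) = - y g⁻¹`. -/
noncomputable def antipodeHom : D.Alg →ₐ[k] D.Algᵐᵒᵖ :=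
  D.lift
    { val := op ((D.h⁻¹ : D.Algˣ) : D.Alg)
      inv := op (D.h : D.Alg)
      val_inv := by rw [← op_mul, Units.mul_inv, op_one]
      inv_val := by rw [← op_mul, Units.inv_mul, op_one] }
    (op ((D.f⁻¹ : D.Algˣ) : D.Alg))
    (op (-(D.y * ((D.g⁻¹ : D.Algˣ) : D.Alg))))
    (by rw [← op_pow, ← Units.val_pow_eq_pow_val, inv_pow, f_pow_b]; simp)
    (by
      change op _ * op _ = op _ * op _
      rw [← op_mul, ← op_mul, ← Units.val_mul, ← Units.val_mul,
        (D.h_comm_f.inv_inv).eq])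
    (by
      change op _ * op _ = D.θ • (op _ * op _)
      rw [← op_mul, ← op_mul, ← op_smul, mul_neg, neg_mul, smul_neg, ← mul_assoc,
        inv_skew D.y_mul_h, smul_mul_assoc, mul_assoc, mul_assoc, ← Units.val_mul,
        ← Units.val_mul, D.g_comm_h.inv_inv.eq])
    (by
      rw [← op_mul, ← op_mul, ← op_smul, mul_neg, neg_mul, smul_neg, ← mul_assoc,
        inv_skew D.y_mul_f, smul_mul_assoc, mul_assoc, mul_assoc, ← Units.val_mul,
        ← Units.val_mul, D.g_comm_f.inv_inv.eq])
    (by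
      change op _ ^ _ = 1 - op _ ^ _
      have hs := sign_primitive (by have := D.one_lt_n; omega) D.ξ_primitive
      have h1 : ((-1 : D.Alg)) ^ D.n = algebraMap k D.Alg ((-1) ^ D.n) := by simp
      have h2 : ((D.g⁻¹ : D.Algˣ) : D.Alg) ^ D.n = ((D.h⁻¹ : D.Algˣ) : D.Alg) ^ (D.n * D.w') := by
        rw [← Units.val_pow_eq_pow_val, ← Units.val_pow_eq_pow_val, inv_pow, inv_pow]
        congr 2
        exact Units.ext (by simpa using D.g_pow_n)
      have h3 : (D.h : D.Alg) ^ (D.n * D.w') * ((D.h⁻¹ : D.Algˣ) : D.Alg) ^ (D.n * D.w') = 1 := by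
        rw [← Units.val_pow_eq_pow_val, ← Units.val_pow_eq_pow_val, inv_pow, Units.mul_inv]
      rw [← op_pow, ← op_pow, ← op_one, ← op_sub, neg_pow, h1, ← Algebra.smul_def,
        mul_pow_skew (inv_skew D.y_mul_g), smul_smul, hs, y_pow_n, h2, sub_mul, h3, neg_smul,
        one_smul, one_mul, neg_sub])

open MulOpposite

theorem antipodeHom_h : D.antipodeHom D.h = op ((D.h⁻¹ : D.Algˣ) : D.Alg) :=
  D.lift_h _ _ _ _ _ _ _ _

theorem antipodeHom_f : D.antipodeHom D.f = op ((D.f⁻¹ : D.Algˣ) : D.Alg) :=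
  D.lift_f _ _ _ _ _ _ _ _

theorem antipodeHom_y : D.antipodeHom D.y = op (-(D.y * ((D.g⁻¹ : D.Algˣ) : D.Alg))) :=
  D.lift_y _ _ _ _ _ _ _ _

/-- The antipode as a linear map. -/
noncomputable def antipodeLin : D.Alg →ₗ[k] D.Alg :=
  (opLinearEquiv k).symm.toLinearMap ∘ₗ D.antipodeHom.toLinearMap

theorem antipodeLin_apply (a : D.Alg) : D.antipodeLin a = unop (D.antipodeHom a) := rfl

theorem antipodeLin_mul (a c : D.Alg) :
    D.antipodeLin (a * c) = D.antipodeLin c * D.antipodeLin a := by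
  simp [antipodeLin_apply]

theorem antipodeLin_inv (u : D.Algˣ) {v : D.Alg} (huv : D.antipodeLin u = v) :
    v * D.antipodeLin ((u⁻¹ : D.Algˣ) : D.Alg) = 1 ∧
      D.antipodeLin ((u⁻¹ : D.Algˣ) : D.Alg) * v = 1 := by
  subst huv
  rw [← antipodeLin_mul, ← antipodeLin_mul]
  simp [antipodeLin_apply]

theorem antipodeLin_unit (u : D.Algˣ)
    (hu : D.antipodeLin u = ((u⁻¹ : D.Algˣ) : D.Alg)) :
    D.antipodeLin ((u⁻¹ : D.Algˣ) : D.Alg) = u :=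
  (left_inv_eq_right_inv (Units.mul_inv u) (D.antipodeLin_inv u hu).1).symm

theorem antipodeLin_g : D.antipodeLin D.g = ((D.g⁻¹ : D.Algˣ) : D.Alg) := by
  have hgc : ((D.g⁻¹ : D.Algˣ)) = (D.f⁻¹) ^ D.i₀ * (D.h⁻¹) ^ D.w' := by
    rw [g, mul_inv_rev, inv_pow, inv_pow]
  rw [hgc, g, Units.val_mul, antipodeLin_mul]
  simp only [antipodeLin_apply, Units.val_pow_eq_pow_val, map_pow, antipodeHom_h, antipodeHom_f,
    unop_pow, unop_op, Units.val_mul]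

theorem antipode_left_mul (t s : D.Alg ⊗[k] D.Alg) {c : k}
    (ht : LinearMap.mul' k D.Alg (D.antipodeLin.rTensor D.Alg t) = algebraMap k D.Alg c) :
    LinearMap.mul' k D.Alg (D.antipodeLin.rTensor D.Alg (t * s)) =
      c • LinearMap.mul' k D.Alg (D.antipodeLin.rTensor D.Alg s) := by
  induction s using TensorProduct.induction_on with
  | zero => simp
  | add s₁ s₂ h₁ h₂ => simp only [mul_add, map_add, h₁, h₂, smul_add]
  | tmul c₁ c₂ =>
    have : ∀ t : D.Alg ⊗[k] D.Alg,
        LinearMap.mul' k D.Alg (D.antipodeLin.rTensor D.Alg (t * c₁ ⊗ₜ c₂)) =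
          D.antipodeLin c₁ * LinearMap.mul' k D.Alg (D.antipodeLin.rTensor D.Alg t) * c₂ := by
      intro t
      induction t using TensorProduct.induction_on with
      | zero => simp
      | add s₁ s₂ h₁ h₂ => simp only [mul_add, add_mul, map_add, h₁, h₂]
      | tmul a₁ a₂ => simp [antipodeLin_mul, mul_assoc]
    rw [this, ht, ← Algebra.commutes, mul_assoc, ← Algebra.smul_def]
    simp

theorem antipode_right_mul (t s : D.Alg ⊗[k] D.Alg) {c : k}
    (hs : LinearMap.mul' k D.Alg (D.antipodeLin.lTensor D.Alg s) = algebraMap k D.Alg c) :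
    LinearMap.mul' k D.Alg (D.antipodeLin.lTensor D.Alg (t * s)) =
      c • LinearMap.mul' k D.Alg (D.antipodeLin.lTensor D.Alg t) := by
  induction t using TensorProduct.induction_on with
  | zero => simp
  | add s₁ s₂ h₁ h₂ => simp only [add_mul, map_add, h₁, h₂, smul_add]
  | tmul c₁ c₂ =>
    have : ∀ s : D.Alg ⊗[k] D.Alg,
        LinearMap.mul' k D.Alg (D.antipodeLin.lTensor D.Alg (c₁ ⊗ₜ c₂ * s)) =
          c₁ * LinearMap.mul' k D.Alg (D.antipodeLin.lTensor D.Alg s) * D.antipodeLin c₂ := by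
      intro s
      induction s using TensorProduct.induction_on with
      | zero => simp
      | add s₁ s₂ h₁ h₂ => simp only [mul_add, add_mul, map_add, h₁, h₂]
      | tmul a₁ a₂ => simp [antipodeLin_mul, mul_assoc]
    rw [this, hs, ← Algebra.commutes, mul_assoc, ← Algebra.smul_def]
    simp

theorem isGroupLike_h : IsGroupLikeElem k (D.h : D.Alg) := ⟨D.counitHom_h, D.comulHom_h⟩

theorem isGroupLike_f : IsGroupLikeElem k (D.f : D.Alg) := ⟨D.counitHom_f, D.comulHom_f⟩

theorem antipodeLin_h : D.antipodeLin D.h = ((D.h⁻¹ : D.Algˣ) : D.Alg) := by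
  rw [antipodeLin_apply, antipodeHom_h, unop_op]

theorem antipodeLin_f : D.antipodeLin D.f = ((D.f⁻¹ : D.Algˣ) : D.Alg) := by
  rw [antipodeLin_apply, antipodeHom_f, unop_op]

theorem antipodeLin_y : D.antipodeLin D.y = -(D.y * ((D.g⁻¹ : D.Algˣ) : D.Alg)) := by
  rw [antipodeLin_apply, antipodeHom_y, unop_op]

theorem antipodeLin_one : D.antipodeLin 1 = 1 := by
  simp [antipodeLin_apply]

theorem antipode_left (a : D.Alg) :
    LinearMap.mul' k D.Alg (D.antipodeLin.rTensor D.Alg (D.comulHom a)) =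
      algebraMap k D.Alg (D.counitHom a) := by
  have key : ∀ u v : D.Alg, IsGroupLikeElem k u → v * u = 1 → D.antipodeLin u = v →
      LinearMap.mul' k D.Alg (D.antipodeLin.rTensor D.Alg (D.comulHom u)) =
      algebraMap k D.Alg (D.counitHom u) := by
    intro u v h1 h2 h3
    rw [← comul_eq, ← counit_eq, h1.comul_eq_tmul_self, h1.counit_eq_one]
    simp [h2, h3]
  induction a using D.induction with
  | hc c => simp [Algebra.TensorProduct.algebraMap_apply, antipodeLin_apply]
  | hh => exact key _ _ D.isGroupLike_h (by simp) D.antipodeLin_h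
  | hh' =>
    exact key _ D.h (isGroupLikeElem_unitsInv.2 D.isGroupLike_h) (by simp)
      (D.antipodeLin_unit _ D.antipodeLin_h)
  | hf => exact key _ _ D.isGroupLike_f (by simp) D.antipodeLin_f
  | hy => simp [antipodeLin_y, antipodeLin_one]
  | hadd a c ha hc => simp only [map_add, ha, hc]
  | hmul a c ha hc =>
    rw [map_mul, D.antipode_left_mul _ _ ha, hc, map_mul, map_mul, Algebra.smul_def]

theorem antipode_right (a : D.Alg) :
    LinearMap.mul' k D.Alg (D.antipodeLin.lTensor D.Alg (D.comulHom a)) =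
      algebraMap k D.Alg (D.counitHom a) := by
  have key : ∀ u v : D.Alg, IsGroupLikeElem k u → u * v = 1 → D.antipodeLin u = v →
      LinearMap.mul' k D.Alg (D.antipodeLin.lTensor D.Alg (D.comulHom u)) =
      algebraMap k D.Alg (D.counitHom u) := by
    intro u v h1 h2 h3
    rw [← comul_eq, ← counit_eq, h1.comul_eq_tmul_self, h1.counit_eq_one]
    simp [h2, h3]
  induction a using D.induction with
  | hc c => simp [Algebra.TensorProduct.algebraMap_apply, antipodeLin_one]
  | hh => exact key _ _ D.isGroupLike_h (by simp) D.antipodeLin_h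
  | hh' =>
    exact key _ D.h (isGroupLikeElem_unitsInv.2 D.isGroupLike_h) (by simp)
      (D.antipodeLin_unit _ D.antipodeLin_h)
  | hf => exact key _ _ D.isGroupLike_f (by simp) D.antipodeLin_f
  | hy => simp [antipodeLin_y, antipodeLin_g]
  | hadd a c ha hc => simp only [map_add, ha, hc]
  | hmul a c ha hc =>
    rw [map_mul, D.antipode_right_mul _ _ hc, ha, map_mul, map_mul, Algebra.smul_def,
      Algebra.commutes]

noncomputable instance : HopfAlgebra k D.Alg where
  antipode := D.antipodeLin
  mul_antipode_rTensor_comul := LinearMap.ext D.antipode_left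
  mul_antipode_lTensor_comul := LinearMap.ext D.antipode_right

end LiuDatum

/-! ### The second presentation -/

/-- Names of the generators `x, x⁻¹, g, y`. -/
inductive LiuGen' : Type
  | x | xInv | g | y

open LiuGen' in
/-- The relations `y g = ξ g y`, `yⁿ = 1 - x ^ w = 1 - gⁿ`, `x y = y x`, `x g = g x`,
`x x⁻¹ = x⁻¹ x = 1`. -/
inductive LiuRel' {k : Type u} [Field k] (n w : ℕ) (ξ : k) :
    FreeAlgebra k LiuGen' → FreeAlgebra k LiuGen' → Prop
  | y_g : LiuRel' n w ξ (.ι k y * .ι k g) (ξ • (.ι k g * .ι k y))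
  | y_pow : LiuRel' n w ξ (.ι k y ^ n) (1 - .ι k x ^ w)
  | x_pow : LiuRel' n w ξ (1 - .ι k x ^ w) (1 - .ι k g ^ n)
  | x_y : LiuRel' n w ξ (.ι k x * .ι k y) (.ι k y * .ι k x)
  | x_g : LiuRel' n w ξ (.ι k x * .ι k g) (.ι k g * .ι k x)
  | x_xInv : LiuRel' n w ξ (.ι k x * .ι k xInv) 1
  | xInv_x : LiuRel' n w ξ (.ι k xInv * .ι k x) 1

/-- The algebra with generators `x, x⁻¹, g, y` and relations `LiuRel'`. -/
abbrev LiuAlg' {k : Type u} [Field k] (n w : ℕ) (ξ : k) : Type u := RingQuot (LiuRel' n w ξ)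

/-- The image of a generator in `LiuAlg'`. -/
noncomputable def LiuAlg'.gen {k : Type u} [Field k] (n w : ℕ) (ξ : k) (s : LiuGen') :
    LiuAlg' n w ξ :=
  RingQuot.mkAlgHom k (LiuRel' n w ξ) (.ι k s)

/-! ### Ring-theoretic invariants -/

/-- A ring is prime if it is nonzero and `a R c = 0` implies `a = 0` or `c = 0`; equivalently, a
product of two nonzero two-sided ideals is nonzero. -/
def IsPrimeRing (R : Type*) [Ring R] : Prop :=
  Nontrivial R ∧ ∀ a c : R, (∀ r : R, a * r * c = 0) → a = 0 ∨ c = 0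

/-- The Gel'fand-Kirillov dimension: the supremum, over the finite-dimensional subspaces `V`, of
`limsup (log dim (k + V)ᵐ / log m)`. -/
noncomputable def gkDim (k A : Type*) [Field k] [Ring A] [Algebra k A] : EReal :=
  ⨆ V : {V : Submodule k A // V.FG},
    Filter.limsup (fun m : ℕ =>
      ((Real.log (Module.finrank k ↥((1 ⊔ V.1) ^ m)) / Real.log m : ℝ) : EReal)) Filter.atTop

/-- `m` is the PI-degree of `R`: the least `m` such that `R` embeds in the ring of `m × m` matrices
over some commutative ring. -/
def IsPIDegree (R : Type u) [Ring R] (m : ℕ) : Prop :=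
  IsLeast {m : ℕ | ∃ (C : Type u) (_ : CommRing C) (φ : R →+* Matrix (Fin m) (Fin m) C),
    Function.Injective φ} m

open CategoryTheory in
/-- The (left) global dimension. -/
noncomputable def globalDim (R : Type u) [Ring R] : WithBot ℕ∞ :=
  ⨆ M : ModuleCat.{u} R, projectiveDimension M

/-! ### Homological integrals -/

section Integral

open CategoryTheory Abelian MulOpposite

variable (k : Type u) [Field k] (A : Type u) [Ring A] [Algebra k A] (ε : A →ₐ[k] k)

/-- The trivial left module `k` of an augmented algebra `(A, ε)`. -/
noncomputable abbrev trivialModule : ModuleCat.{u} A :=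
  (ModuleCat.restrictScalars (ε : A →+* k)).obj (ModuleCat.of k k)

/-- `Extⁱ(k, A)`, the extensions being taken in the category of left `A`-modules. -/
abbrev extTrivial (i : ℕ) : Type u := Ext.{u} (trivialModule k A ε) (ModuleCat.of A A) i

/-- The left-module half of the Artin-Schelter Gorenstein condition. -/
structure IsLeftASGorenstein (d : ℕ) : Prop where
  injectiveDimension_eq : injectiveDimension (ModuleCat.of A A) = d
  finrank_ext : Module.finrank k (extTrivial k A ε d) = 1
  subsingleton_ext : ∀ i : ℕ, i ≠ d → Subsingleton (extTrivial k A ε i)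

/-- The augmented algebra `(A, ε)` is Artin-Schelter Gorenstein of injective dimension `d`.
Right `A`-modules are left modules over the opposite algebra. -/
structure IsASGorenstein (d : ℕ) : Prop where
  left : IsLeftASGorenstein k A ε d
  right : IsLeftASGorenstein k Aᵐᵒᵖ (ε.fromOpposite fun _ _ => Commute.all _ _) d

variable {k A}

/-- The right action of `A` on `Extⁱ(k, A)`, induced by right multiplication on the second
argument. -/
noncomputable def extRightAct {i : ℕ} (e : extTrivial k A ε i) (a : A) : extTrivial k A ε i :=
  e.comp (Ext.mk₀ (ModuleCat.ofHom (LinearMap.toSpanSingleton A A a))) (add_zero i)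

/-- `π : A → k` is the algebra map given by the right structure of the left homological integral
`∫ˡ = Extᵈ(k, A)` of the Artin-Schelter Gorenstein algebra `(A, ε)`. There is at most one such
`π`. -/
def IsIntegralCharacter (π : A →ₐ[k] k) : Prop :=
  ∃ d : ℕ, IsASGorenstein k A ε d ∧
    ∀ (e : extTrivial k A ε d) (a : A), extRightAct ε e a = π a • e

theorem IsIntegralCharacter.unique {π π' : A →ₐ[k] k} (h : IsIntegralCharacter ε π)
    (h' : IsIntegralCharacter ε π') : π = π' := by
  obtain ⟨d, hd, hπ⟩ := h
  obtain ⟨d', hd', hπ'⟩ := h'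
  have hdd : d = d' := by
    have := hd.left.injectiveDimension_eq.symm.trans hd'.left.injectiveDimension_eq
    exact_mod_cast this
  subst hdd
  have : Nontrivial (extTrivial k A ε d) :=
    Module.nontrivial_of_finrank_pos (R := k) (by rw [hd.left.finrank_ext]; exact one_pos)
  obtain ⟨e, he⟩ := exists_ne (0 : extTrivial k A ε d)
  ext a
  exact smul_left_injective k he ((hπ e a).symm.trans (hπ' e a))

end Integral

/-! ### Winding automorphisms -/

section Winding

variable {k : Type*} [Field k] {A : Type*} [Ring A] [HopfAlgebra k A]

open TensorProduct Coalgebra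

/-- `a ↦ ∑ π(a₁) a₂`. -/
noncomputable def windingLeftHom (π : A →ₐ[k] k) : A →ₐ[k] A :=
  (Algebra.TensorProduct.lid k A : k ⊗[k] A →ₐ[k] A).comp
    ((Algebra.TensorProduct.map π (AlgHom.id k A)).comp (Bialgebra.comulAlgHom k A))

/-- `a ↦ ∑ a₁ π(a₂)`. -/
noncomputable def windingRightHom (π : A →ₐ[k] k) : A →ₐ[k] A :=
  (Algebra.TensorProduct.rid k k A : A ⊗[k] k →ₐ[k] A).comp
    ((Algebra.TensorProduct.map (AlgHom.id k A) π).comp (Bialgebra.comulAlgHom k A))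

/-- `a ↦ ∑ φ(a₁) a₂` for a linear form `φ`. -/
noncomputable def hitLeft (φ : A →ₗ[k] k) : A →ₗ[k] A :=
  (TensorProduct.lid k A).toLinearMap ∘ₗ φ.rTensor A ∘ₗ comul

/-- `a ↦ ∑ a₁ φ(a₂)` for a linear form `φ`. -/
noncomputable def hitRight (φ : A →ₗ[k] k) : A →ₗ[k] A :=
  (TensorProduct.rid k A).toLinearMap ∘ₗ φ.lTensor A ∘ₗ comul

theorem windingLeftHom_apply (π : A →ₐ[k] k) (a : A) :
    windingLeftHom π a = hitLeft π.toLinearMap a := rfl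

theorem windingRightHom_apply (π : A →ₐ[k] k) (a : A) :
    windingRightHom π a = hitRight π.toLinearMap a := rfl

/-- The convolution of two linear forms. -/
noncomputable def convForm (ψ φ : A →ₗ[k] k) : A →ₗ[k] k :=
  LinearMap.mul' k k ∘ₗ TensorProduct.map ψ φ ∘ₗ comul

theorem hitLeft_hitLeft (ψ φ : A →ₗ[k] k) (a : A) :
    hitLeft φ (hitLeft ψ a) = hitLeft (convForm ψ φ) a := by
  let T : A ⊗[k] (A ⊗[k] A) →ₗ[k] A :=
    (TensorProduct.lid k A).toLinearMap ∘ₗ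
      TensorProduct.map ψ ((TensorProduct.lid k A).toLinearMap ∘ₗ φ.rTensor A)
  have h1 : ∀ t : A ⊗[k] A, T (comul.lTensor A t) =
      hitLeft φ (TensorProduct.lid k A (ψ.rTensor A t)) := by
    intro t
    induction t using TensorProduct.induction_on with
    | zero => simp
    | add s t hs ht => simp only [map_add, hs, ht]
    | tmul x z => simp [T, hitLeft]
  have h2 : ∀ t : A ⊗[k] A, T (TensorProduct.assoc k A A A (comul.rTensor A t)) =
      TensorProduct.lid k A ((convForm ψ φ).rTensor A t) := by
    intro t
    induction t using TensorProduct.induction_on with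
    | zero => simp
    | add s t hs ht => simp only [map_add, hs, ht]
    | tmul x z =>
      have h3 : ∀ s : A ⊗[k] A, T (TensorProduct.assoc k A A A (s ⊗ₜ z)) =
          (LinearMap.mul' k k (TensorProduct.map ψ φ s)) • z := by
        intro s
        induction s using TensorProduct.induction_on with
        | zero => simp
        | add s t hs ht => simp only [map_add, TensorProduct.add_tmul, hs, ht, add_smul]
        | tmul x y => simp [T, smul_smul, mul_comm]
      simpa [convForm] using h3 (comul x)
  have := h1 (comul a)
  rw [← coassoc_apply, h2] at this
  exact this.symm

theorem hitRight_hitRight (ψ φ : A →ₗ[k] k) (a : A) :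
    hitRight ψ (hitRight φ a) = hitRight (convForm ψ φ) a := by
  let T : A ⊗[k] (A ⊗[k] A) →ₗ[k] A :=
    (TensorProduct.rid k A).toLinearMap ∘ₗ
      (LinearMap.mul' k k ∘ₗ TensorProduct.map ψ φ).lTensor A
  have h1 : ∀ t : A ⊗[k] A, T (TensorProduct.assoc k A A A (comul.rTensor A t)) =
      hitRight ψ (TensorProduct.rid k A (φ.lTensor A t)) := by
    intro t
    induction t using TensorProduct.induction_on with
    | zero => simp
    | add s t hs ht => simp only [map_add, hs, ht]
    | tmul x z =>
      have h3 : ∀ s : A ⊗[k] A, T (TensorProduct.assoc k A A A (s ⊗ₜ z)) =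
          φ z • TensorProduct.rid k A (ψ.lTensor A s) := by
        intro s
        induction s using TensorProduct.induction_on with
        | zero => simp
        | add s t hs ht => simp only [map_add, TensorProduct.add_tmul, hs, ht, smul_add]
        | tmul x y => simp [T, smul_smul, mul_comm]
      simpa [hitRight] using h3 (comul x)
  have h2 : ∀ t : A ⊗[k] A, T (comul.lTensor A t) =
      TensorProduct.rid k A ((convForm ψ φ).lTensor A t) := by
    intro t
    induction t using TensorProduct.induction_on with
    | zero => simp
    | add s t hs ht => simp only [map_add, hs, ht]
    | tmul x z => simp [T, convForm]
  have := h1 (comul a)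
  rw [coassoc_apply, h2] at this
  exact this.symm

theorem hitLeft_counit (a : A) : hitLeft (counit (R := k)) a = a := by
  simp [hitLeft]

theorem hitRight_counit (a : A) : hitRight (counit (R := k)) a = a := by
  simp [hitRight]

theorem convForm_antipode_left (π : A →ₐ[k] k) :
    convForm (π.toLinearMap ∘ₗ HopfAlgebra.antipode k) π.toLinearMap = counit := by
  ext a
  have h : ∀ t : A ⊗[k] A,
      LinearMap.mul' k k (TensorProduct.map (π.toLinearMap ∘ₗ HopfAlgebra.antipode k)
        π.toLinearMap t) =
        π (LinearMap.mul' k A ((HopfAlgebra.antipode k).rTensor A t)) := by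
    intro t
    induction t using TensorProduct.induction_on with
    | zero => simp
    | add s t hs ht => simp only [map_add, hs, ht]
    | tmul x y => simp
  have := h (comul a)
  rw [HopfAlgebra.mul_antipode_rTensor_comul_apply] at this
  simpa [convForm] using this

theorem convForm_antipode_right (π : A →ₐ[k] k) :
    convForm π.toLinearMap (π.toLinearMap ∘ₗ HopfAlgebra.antipode k) = counit := by
  ext a
  have h : ∀ t : A ⊗[k] A,
      LinearMap.mul' k k (TensorProduct.map π.toLinearMap
        (π.toLinearMap ∘ₗ HopfAlgebra.antipode k) t) =
        π (LinearMap.mul' k A ((HopfAlgebra.antipode k).lTensor A t)) := by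
    intro t
    induction t using TensorProduct.induction_on with
    | zero => simp
    | add s t hs ht => simp only [map_add, hs, ht]
    | tmul x y => simp
  have := h (comul a)
  rw [HopfAlgebra.mul_antipode_lTensor_comul_apply] at this
  simpa [convForm] using this

/-- The left winding automorphism `a ↦ ∑ π(a₁) a₂`. -/
noncomputable def windingLeft (π : A →ₐ[k] k) : A ≃ₐ[k] A :=
  AlgEquiv.ofBijective (windingLeftHom π) (by
    refine Function.bijective_iff_has_inverse.2
      ⟨hitLeft (π.toLinearMap ∘ₗ HopfAlgebra.antipode k), fun a => ?_, fun a => ?_⟩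
    · rw [windingLeftHom_apply, hitLeft_hitLeft, convForm_antipode_right, hitLeft_counit]
    · rw [windingLeftHom_apply, hitLeft_hitLeft, convForm_antipode_left, hitLeft_counit])

/-- The right winding automorphism `a ↦ ∑ a₁ π(a₂)`. -/
noncomputable def windingRight (π : A →ₐ[k] k) : A ≃ₐ[k] A :=
  AlgEquiv.ofBijective (windingRightHom π) (by
    refine Function.bijective_iff_has_inverse.2
      ⟨hitRight (π.toLinearMap ∘ₗ HopfAlgebra.antipode k), fun a => ?_, fun a => ?_⟩
    · rw [windingRightHom_apply, hitRight_hitRight, convForm_antipode_left, hitRight_counit]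
    · rw [windingRightHom_apply, hitRight_hitRight, convForm_antipode_right, hitRight_counit])

/-- The order of `π` in the group of algebra maps `A → k` under convolution. -/
noncomputable def characterOrder (π : A →ₐ[k] k) : ℕ := orderOf (WithConv.toConv π)

/-- `|Gˡ / (Gˡ ∩ Gʳ)|`, where `Gˡ` and `Gʳ` are the groups of automorphisms generated by the left
and the right winding automorphism of `π`. -/
noncomputable def windingIndex (π : A →ₐ[k] k) : ℕ :=
  (Subgroup.zpowers (windingRight π)).relIndex (Subgroup.zpowers (windingLeft π))

/-- The subalgebra of elements fixed by an automorphism. -/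
def fixedSubalgebra (φ : A ≃ₐ[k] A) : Subalgebra k A :=
  AlgHom.equalizer (φ : A →ₐ[k] A) (AlgHom.id k A)

end Winding

namespace LiuDatum

variable {k : Type u} [Field k] (D : LiuDatum k)

/-! ### The group of group-like elements and its character -/

/-! The algebra `B` is the quotient R[y; σ]/(yⁿ - c), where R is the group algebra of C_∞ × C_b on h
and f, σ scales a group element v by a character χ, and c = 1 - xʷ. The arithmetic of the datum
enters mainly through χ: its kernel is ⟨x⟩, and χ(g) = ξ is a primitive n-th root of unity. So R is
free over P = k[x, x⁻¹] on the gⁱ, and `B` should have P-basis gⁱ yˡ and k-basis v yˡ (`basisP`,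
`basisK`).

Independence comes from representations on R. If u ∈ R has twisted norm u σ(u) ⋯ σⁿ⁻¹(u) = c, then y
may act as r ↦ u σ(r), and a Vandermonde argument shows that this action is faithful
(`rep_buildHom_injective`). The element u = 1 - g qualifies, since ∏ (1 - ξʲ g) = 1 - gⁿ = c. This
representation embeds `B` into n × n matrices over P with image containing c times all matrices
(`exists_toMat_eq`), which gives primeness and the PI-degree.

Conjugation by g and the winding automorphisms are diagonal in the basis v yˡ, so the fixed rings,
and the first half of the computation of the centre, amount to selecting basis elements of
eigenvalue 1. By the q-binomial theorem the coproduct is explicit in this basis (`coord₂_comul`);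
comparing coefficients yields the group-like and skew-primitive elements and the rigidity of
isomorphisms.

For the homological part, P is a principal ideal domain and `B` has a P-linear Frobenius form, the
coefficient of g⁰ yⁿ⁻¹ (`isFrobeniusForm`). Hence Hom_B(M, B) is Hom_P(M, P), and `B` has injective
dimension at most 1. Moreover Ext¹(k, B) is Hom(ker ε, B) modulo right multiplications, and f ↦ f(x
- 1) identifies it with the part of the Frobenius algebra B/(x - 1) on which `B` acts from the left
by ε. That part is the line spanned by (∑ gⁱ) yⁿ⁻¹, on which v acts from the right by χ(v)ⁿ⁻¹ =
χ(v)⁻¹; this is π (`exists_integral_mul`).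

If w ≠ 0 in k, a P-projective module is `B`-projective: a P-linear splitting is averaged over g and
then corrected along y by an operator φ with ∑ yⁱ φ yⁿ⁻¹⁻ⁱ = 1, obtained from a connection for x
d/dx (`exists_homotopy`). Submodules of free modules being P-projective, the global dimension is at
most 1. If w = 0 in k, then g has a p-th root in the group, and another u of norm c can be chosen
(`exists_twist`). The element y - u and its cofactor generate each other's left annihilators, so the
ideal generated by the cofactor has a periodic resolution, while it is not projective
(`not_projective_range`). -/

instance : NeZero D.b := ⟨D.b_pos.ne'⟩

instance : NeZero D.n := ⟨by have := D.one_lt_n; omega⟩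

/-- The group `C_∞ × C_b`, with generators corresponding to `h` and `f`. -/
abbrev G : Type := Multiplicative ℤ × Multiplicative (ZMod D.b)

/-- The homomorphism from `C_∞ × C_b` given by commuting elements `a`, `c` with `c ^ b = 1`. -/
def groupHom {M : Type*} [Group M] (a c : M) (hac : Commute a c) (hc : c ^ D.b = 1) : D.G →* M where
  toFun v := a ^ v.1.toAdd * c ^ v.2.toAdd.val
  map_one' := by simp
  map_mul' v v' := by
    have h1 : c ^ (v.2.toAdd + v'.2.toAdd).val = c ^ v.2.toAdd.val * c ^ v'.2.toAdd.val := by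
      rw [ZMod.val_add, ← pow_add]
      exact (pow_eq_pow_mod _ hc).symm
    rw [Prod.fst_mul, Prod.snd_mul, toAdd_mul, toAdd_mul, zpow_add, h1, mul_assoc, mul_assoc]
    congr 1
    rw [← mul_assoc, ← mul_assoc, ((hac.zpow_left _).pow_right _).eq]

theorem groupHom_apply {M : Type*} [Group M] {a c : M} (hac : Commute a c) (hc : c ^ D.b = 1)
    (i : ℤ) (j : ℕ) : D.groupHom a c hac hc (.ofAdd i, .ofAdd (j : ZMod D.b)) = a ^ i * c ^ j := by
  change a ^ i * c ^ (j : ZMod D.b).val = _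
  rw [ZMod.val_natCast, ← pow_eq_pow_mod _ hc]

theorem n_pos : 0 < D.n := by have := D.one_lt_n; omega

theorem n'_pos : 0 < D.n' := Nat.pos_of_ne_zero fun h => by
  have := D.n'_mul_b; rw [h, zero_mul] at this; exact D.n_pos.ne this

/-- The group element `h`. -/
def hG : D.G := (.ofAdd 1, 1)

/-- The group element `f`. -/
def fG : D.G := (1, .ofAdd 1)

/-- The group element `x`. -/
def xG : D.G := D.hG ^ D.n' * D.fG⁻¹

/-- The group element `g`. -/
def gG : D.G := D.hG ^ D.w' * D.fG ^ D.i₀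

theorem eq_hG_fG (v : D.G) : v = D.hG ^ v.1.toAdd * D.fG ^ v.2.toAdd.val := by
  ext1
  · simp [hG, fG, ← ofAdd_zsmul]
  · simp [hG, fG, ← ofAdd_nsmul]

theorem fG_pow_b : D.fG ^ D.b = 1 := by
  ext1
  · simp [fG]
  · simp [fG, ← ofAdd_nsmul]

/-- `θ` as a unit. -/
noncomputable def θU : kˣ := Units.mk0 D.θ (D.primitive.ne_zero D.n_pos.ne')

@[simp] theorem val_θU : (D.θU : k) = D.θ := rfl

theorem θU_primitive : IsPrimitiveRoot D.θU D.n := IsPrimitiveRoot.coe_units_iff.1 D.primitive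

theorem θU_pow : (D.θU ^ D.n') ^ D.b = 1 := by
  rw [← pow_mul, D.n'_mul_b, D.θU_primitive.pow_eq_one]

/-- The character with `y v = χ(v) v y` for group-like `v`. -/
noncomputable def χ : D.G →* kˣ := D.groupHom D.θU (D.θU ^ D.n') (Commute.all _ _) D.θU_pow

theorem χ_hG : D.χ D.hG = D.θU := by
  have := D.groupHom_apply (Commute.all D.θU (D.θU ^ D.n')) D.θU_pow 1 0
  simpa [hG, χ] using this

theorem χ_fG : D.χ D.fG = D.θU ^ D.n' := by
  have := D.groupHom_apply (Commute.all D.θU (D.θU ^ D.n')) D.θU_pow 0 1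
  simpa [fG, χ] using this

theorem χ_xG : D.χ D.xG = 1 := by
  rw [xG, map_mul, map_pow, map_inv, χ_hG, χ_fG, mul_inv_cancel]

/-- `ξ` as a unit. -/
noncomputable def ξU : kˣ := D.θU ^ (D.w' + D.n' * D.i₀)

@[simp] theorem val_ξU : (D.ξU : k) = D.ξ := rfl

theorem ξU_primitive : IsPrimitiveRoot D.ξU D.n := IsPrimitiveRoot.coe_units_iff.1 D.ξ_primitive

theorem χ_gG : D.χ D.gG = D.ξU := by
  rw [gG, map_mul, map_pow, map_pow, χ_hG, χ_fG, ξU, pow_add, pow_mul]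

theorem χ_pow_n (v : D.G) : D.χ v ^ D.n = 1 := by
  have h1 : (D.θU ^ v.1.toAdd) ^ D.n = 1 := by
    rw [← zpow_natCast, zpow_comm, zpow_natCast, D.θU_primitive.pow_eq_one, one_zpow]
  have h2 : ((D.θU ^ D.n') ^ v.2.toAdd.val) ^ D.n = 1 := by
    rw [pow_right_comm, ← pow_mul D.θU, mul_comm D.n', pow_mul, D.θU_primitive.pow_eq_one, one_pow,
      one_pow]
  rw [D.eq_hG_fG v, map_mul, map_zpow, map_pow, χ_hG, χ_fG, mul_pow, h1, h2, one_mul]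

theorem xG_zpow (a : ℤ) : D.xG ^ a = (.ofAdd (a * D.n'), .ofAdd (-a : ZMod D.b)) := by
  have h : D.xG = (.ofAdd (D.n' : ℤ), .ofAdd (-1)) := by
    ext1
    · simp [xG, hG, fG, ← ofAdd_nsmul]
    · simp [xG, hG, fG]
  rw [h]
  ext1
  · rw [Prod.pow_fst, ← ofAdd_zsmul, smul_eq_mul]
  · rw [Prod.pow_snd, ← ofAdd_zsmul, zsmul_eq_mul, mul_neg_one]

theorem xG_zpow_injective : Function.Injective fun a : ℤ => D.xG ^ a := by
  intro a c h
  have h := congrArg Prod.fst h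
  simp only [xG_zpow] at h
  have h' : a * D.n' = c * D.n' := h
  have := D.n'_pos
  exact mul_right_cancel₀ (by positivity) h'

/-- For v = hⁱ fʲ the value χ(v) is θ^(i + n' j), so triviality means i + n' j = n t = n' b t for
some t. Then i = n' (b t - j), and b t - j is the required exponent, being -j modulo b. -/
theorem exists_xG_zpow {v : D.G} (hv : D.χ v = 1) : ∃ a : ℤ, v = D.xG ^ a := by
  have h1 : D.θU ^ (v.1.toAdd + D.n' * v.2.toAdd.val : ℤ) = 1 := by
    rw [D.eq_hG_fG v, map_mul, map_zpow, map_pow, χ_hG, χ_fG] at hv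
    rw [zpow_add, zpow_mul, zpow_natCast, zpow_natCast]
    exact hv
  obtain ⟨t, ht⟩ := (D.θU_primitive.zpow_eq_one_iff_dvd _).1 h1
  refine ⟨D.b * t - v.2.toAdd.val, ?_⟩
  rw [xG_zpow]
  ext1
  · apply Multiplicative.toAdd.injective
    have : (D.n : ℤ) = D.n' * D.b := by exact_mod_cast D.n'_mul_b.symm
    rw [this] at ht
    simp only [toAdd_ofAdd]
    linear_combination ht
  · apply Multiplicative.toAdd.injective
    simp

theorem gG_pow_n : D.gG ^ D.n = D.xG ^ D.w := by
  have h1 : D.fG ^ D.n = 1 := by rw [← D.n'_mul_b, mul_comm, pow_mul, fG_pow_b, one_pow]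
  have h2 : D.fG ^ D.w = 1 := by rw [← D.w'_mul_b, mul_comm, pow_mul, fG_pow_b, one_pow]
  have h3 : D.w' * D.n = D.n' * D.w := by
    rw [← D.n'_mul_b, ← D.w'_mul_b]
    ring
  rw [gG, xG, mul_pow, mul_pow, inv_pow, h2, ← pow_mul D.fG, mul_comm D.i₀, pow_mul D.fG, h1,
    one_pow, inv_one, ← pow_mul, ← pow_mul, h3]

/-- All values of χ are n-th roots of unity, hence powers of ξ = χ(g); dividing by a power of g
brings v into the kernel ⟨x⟩. -/
theorem exists_eq_xG_gG (v : D.G) : ∃ (a : ℤ) (i : ℕ), i < D.n ∧ v = D.xG ^ a * D.gG ^ i := by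
  obtain ⟨i, hi, h⟩ := D.ξ_primitive.eq_pow_of_pow_eq_one
    (by rw [← Units.val_pow_eq_pow_val, D.χ_pow_n v, Units.val_one] : (D.χ v : k) ^ D.n = 1)
  replace h : D.ξU ^ i = D.χ v := Units.ext (by rw [← h]; simp)
  obtain ⟨a, ha⟩ := D.exists_xG_zpow (v := v * (D.gG ^ i)⁻¹) (by
    rw [map_mul, map_inv, map_pow, χ_gG, h, mul_inv_cancel])
  exact ⟨a, i, hi, by rw [← ha, inv_mul_cancel_right]⟩

theorem xG_gG_injective : Function.Injective fun p : ℤ × Fin D.n => D.xG ^ p.1 * D.gG ^ (p.2 : ℕ) := by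
  rintro ⟨a, i⟩ ⟨c, j⟩ h
  have h1 := congrArg D.χ h
  simp only [map_mul, map_zpow, map_pow, χ_xG, χ_gG, one_zpow, one_mul] at h1
  have h2 := D.ξU_primitive.pow_inj i.2 j.2 h1
  have h3 : i = j := Fin.ext h2
  subst h3
  have := D.xG_zpow_injective (mul_right_cancel h)
  simp only at this
  rw [this]

/-- Every group element is uniquely `x ^ a g ^ i` with `0 ≤ i < n`. -/
noncomputable def groupEquiv : ℤ × Fin D.n ≃ D.G :=
  Equiv.ofBijective _ ⟨D.xG_gG_injective, fun v => by
    obtain ⟨a, i, hi, h⟩ := D.exists_eq_xG_gG v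
    exact ⟨(a, ⟨i, hi⟩), h.symm⟩⟩

theorem groupEquiv_apply (a : ℤ) (i : Fin D.n) : D.groupEquiv (a, i) = D.xG ^ a * D.gG ^ (i : ℕ) :=
  rfl

/-- Group elements as units of the algebra. -/
noncomputable def U : D.G →* D.Algˣ := D.groupHom D.h D.f D.h_comm_f D.f_pow_b

theorem U_hG : D.U D.hG = D.h := by
  have := D.groupHom_apply D.h_comm_f D.f_pow_b 1 0
  simpa [hG, U] using this

theorem U_fG : D.U D.fG = D.f := by
  have := D.groupHom_apply D.h_comm_f D.f_pow_b 0 1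
  simpa [fG, U] using this

theorem U_xG : D.U D.xG = D.x := by
  rw [xG, x, map_mul, map_inv, map_pow, U_hG, U_fG]

theorem U_gG : D.U D.gG = D.g := by
  rw [gG, g, map_mul, map_pow, map_pow, U_hG, U_fG]

theorem y_mul_U (v : D.G) : D.y * D.U v = (D.χ v : k) • ((D.U v : D.Alg) * D.y) := by
  let S : Subgroup D.Algˣ := D.U.range
  have hmul : ∀ v v' : D.G, D.y * D.U v = (D.χ v : k) • ((D.U v : D.Alg) * D.y) →
      D.y * D.U v' = (D.χ v' : k) • ((D.U v' : D.Alg) * D.y) →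
      D.y * D.U (v * v') = (D.χ (v * v') : k) • ((D.U (v * v') : D.Alg) * D.y) := by
    intro v v' hv hv'
    rw [map_mul, map_mul, Units.val_mul, Units.val_mul, ← mul_assoc, hv, smul_mul_assoc, mul_assoc,
      hv', mul_smul_comm, smul_smul, mul_assoc]
  have hinv : ∀ v : D.G, D.y * D.U v = (D.χ v : k) • ((D.U v : D.Alg) * D.y) →
      D.y * D.U v⁻¹ = (D.χ v⁻¹ : k) • ((D.U v⁻¹ : D.Alg) * D.y) := by
    intro v hv
    have := inv_skew hv
    rw [map_inv, map_inv, this, smul_smul]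
    simp
  have hpow : ∀ v : D.G, D.y * D.U v = (D.χ v : k) • ((D.U v : D.Alg) * D.y) → ∀ m : ℕ,
      D.y * D.U (v ^ m) = (D.χ (v ^ m) : k) • ((D.U (v ^ m) : D.Alg) * D.y) := by
    intro v hv m
    induction m with
    | zero => simp
    | succ m ih => rw [pow_succ]; exact hmul _ _ ih hv
  rw [D.eq_hG_fG v]
  have hh : D.y * D.U D.hG = (D.χ D.hG : k) • ((D.U D.hG : D.Alg) * D.y) := by
    rw [U_hG, χ_hG]; exact D.y_mul_h
  have hf : D.y * D.U D.fG = (D.χ D.fG : k) • ((D.U D.fG : D.Alg) * D.y) := by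
    rw [U_fG, χ_fG]; simpa using D.y_mul_f
  refine hmul _ _ ?_ (hpow _ hf _)
  obtain ⟨m, hm | hm⟩ := Int.eq_nat_or_neg v.1.toAdd
  · rw [hm, zpow_natCast]; exact hpow _ hh _
  · rw [hm, zpow_neg, zpow_natCast]; exact hinv _ (hpow _ hh _)

theorem pow_y_mul_U (v : D.G) (l : ℕ) :
    D.y ^ l * D.U v = (D.χ v : k) ^ l • ((D.U v : D.Alg) * D.y ^ l) := by
  induction l with
  | zero => simp
  | succ l ih =>
    rw [pow_succ', mul_assoc, ih, mul_smul_comm, ← mul_assoc, y_mul_U, smul_mul_assoc, smul_smul,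
      mul_assoc, ← pow_succ]

/-! ### The group algebra -/

/-- The group algebra of `C_∞ × C_b`. -/
abbrev R : Type u := MonoidAlgebra k D.G

/-- A group element in the group algebra. -/
noncomputable def s (v : D.G) : D.R := MonoidAlgebra.of k D.G v

theorem s_mul (v v' : D.G) : D.s (v * v') = D.s v * D.s v' := map_mul _ _ _

theorem s_one : D.s 1 = 1 := map_one _

theorem s_pow (v : D.G) (m : ℕ) : D.s (v ^ m) = D.s v ^ m := map_pow _ _ _

theorem R_linearMap_ext {A : Type*} [AddCommMonoid A] [Module k A] {φ ψ : D.R →ₗ[k] A}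
    (h : ∀ v, φ (D.s v) = ψ (D.s v)) : φ = ψ := by
  apply MonoidAlgebra.lhom_ext'
  intro v
  ext
  simpa [s] using h v

theorem R_algHom_ext {A : Type*} [Semiring A] [Algebra k A] {φ ψ : D.R →ₐ[k] A}
    (h : ∀ v, φ (D.s v) = ψ (D.s v)) : φ = ψ := by
  have : φ.toLinearMap = ψ.toLinearMap := D.R_linearMap_ext h
  exact AlgHom.toLinearMap_injective this

/-- The inclusion of the group algebra. -/
noncomputable def incl : D.R →ₐ[k] D.Alg :=
  MonoidAlgebra.lift k D.Alg D.G ((Units.coeHom D.Alg).comp D.U)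

theorem incl_s (v : D.G) : D.incl (D.s v) = D.U v := by simp [incl, s]

/-- The automorphism `v ↦ χ(v) v` of the group algebra. -/
noncomputable def σ : D.R →ₐ[k] D.R :=
  MonoidAlgebra.lift k D.R D.G
    { toFun := fun v => (D.χ v : k) • D.s v
      map_one' := by simp [s_one]
      map_mul' := fun v v' => by simp [s_mul, smul_smul, mul_comm] }

theorem σ_s (v : D.G) : D.σ (D.s v) = (D.χ v : k) • D.s v := by
  simp [σ, s]

theorem σ_pow_s (l : ℕ) (v : D.G) : (D.σ ^ l) (D.s v) = (D.χ v : k) ^ l • D.s v := by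
  induction l with
  | zero => simp
  | succ l ih => rw [pow_succ', AlgHom.mul_apply, ih, map_smul, σ_s, smul_smul, pow_succ]

theorem σ_pow_n : D.σ ^ D.n = 1 := D.R_algHom_ext fun v => by
  rw [σ_pow_s, ← Units.val_pow_eq_pow_val, χ_pow_n]; simp

theorem y_mul_incl (r : D.R) : D.y * D.incl r = D.incl (D.σ r) * D.y := by
  have : (LinearMap.mulLeft k D.y) ∘ₗ D.incl.toLinearMap =
      (LinearMap.mulRight k D.y) ∘ₗ D.incl.toLinearMap ∘ₗ D.σ.toLinearMap := by
    apply D.R_linearMap_ext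
    intro v
    simp [incl_s, y_mul_U, σ_s]
  exact LinearMap.congr_fun this r

theorem pow_y_mul_incl (r : D.R) (l : ℕ) :
    D.y ^ l * D.incl r = D.incl ((D.σ ^ l) r) * D.y ^ l := by
  induction l generalizing r with
  | zero => simp
  | succ l ih =>
    rw [pow_succ, mul_assoc, y_mul_incl, ← mul_assoc, ih, mul_assoc]
    rfl

/-- `1 - xʷ` in the group algebra. -/
noncomputable def c : D.R := 1 - D.s (D.xG ^ D.w)

theorem s_gG_pow_n : D.s D.gG ^ D.n = D.s (D.xG ^ D.w) := by rw [← s_pow, gG_pow_n]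

theorem y_pow_n' : D.y ^ D.n = D.incl D.c := by
  rw [y_pow_n, c, map_sub, map_one, incl_s, ← gG_pow_n, map_pow, U_gG, Units.val_pow_eq_pow_val,
    g_pow_n]

theorem σ_c : D.σ D.c = D.c := by
  rw [c, map_sub, map_one, σ_s, map_pow, χ_xG]; simp

/-! ### Twisted norms and the representations on the group algebra -/

/-- The twisted norm `u σ(u) ⋯ σ^(l-1)(u)`. -/
noncomputable def N (u : D.R) (l : ℕ) : D.R := ∏ j ∈ Finset.range l, (D.σ ^ j) u

theorem N_succ (u : D.R) (l : ℕ) : D.N u (l + 1) = D.N u l * (D.σ ^ l) u :=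
  Finset.prod_range_succ _ _

theorem N_succ' (u : D.R) (l : ℕ) : D.N u (l + 1) = u * D.σ (D.N u l) := by
  rw [N, Finset.prod_range_succ', mul_comm, N, map_prod]
  congr 1
  refine Finset.prod_congr rfl fun j _ => ?_
  rw [pow_succ']; rfl

/-- The operator `r ↦ u σ(r)` on the group algebra. -/
noncomputable def yOp (u : D.R) : Module.End k D.R := LinearMap.mulLeft k u * D.σ.toLinearMap

theorem yOp_apply (u r : D.R) : D.yOp u r = u * D.σ r := rfl

theorem yOp_pow_apply (u r : D.R) (l : ℕ) : (D.yOp u ^ l) r = D.N u l * (D.σ ^ l) r := by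
  induction l with
  | zero => simp [N]
  | succ l ih =>
    rw [pow_succ', Module.End.mul_apply, ih, yOp_apply, map_mul, N_succ', mul_assoc, pow_succ']
    rfl

/-- Multiplication by the group element as a unit of the endomorphism ring. -/
noncomputable def mulU : D.G →* (Module.End k D.R)ˣ :=
  MonoidHom.toHomUnits ((Algebra.lmul k D.R : D.R →* Module.End k D.R).comp (MonoidAlgebra.of k D.G))

theorem mulU_apply (v : D.G) (r : D.R) : (D.mulU v : Module.End k D.R) r = D.s v * r := rfl

/-- The representation on the group algebra in which group elements act by multiplication and `y`
acts by `r ↦ u σ(r)`. -/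
noncomputable def rep (u : D.R) (hu : D.N u D.n = D.c) : D.Alg →ₐ[k] Module.End k D.R :=
  D.lift (D.mulU D.hG) (D.mulU D.fG) (D.yOp u)
    (by rw [← Units.val_pow_eq_pow_val, ← map_pow, fG_pow_b, map_one, Units.val_one])
    (by rw [← Units.val_mul, ← Units.val_mul, ← map_mul, ← map_mul, mul_comm])
    (by
      refine LinearMap.ext fun r => ?_
      simp only [Module.End.mul_apply, LinearMap.smul_apply, mulU_apply, yOp_apply, map_mul, σ_s,
        χ_hG, val_θU]
      rw [smul_mul_assoc, mul_smul_comm, mul_left_comm])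
    (by
      refine LinearMap.ext fun r => ?_
      simp only [Module.End.mul_apply, LinearMap.smul_apply, mulU_apply, yOp_apply, map_mul, σ_s,
        χ_fG, val_θU, Units.val_pow_eq_pow_val]
      rw [smul_mul_assoc, mul_smul_comm, mul_left_comm])
    (by
      refine LinearMap.ext fun r => ?_
      rw [yOp_pow_apply, hu, σ_pow_n, AlgHom.one_apply, ← Units.val_pow_eq_pow_val, ← map_pow,
        LinearMap.sub_apply, Module.End.one_apply, mulU_apply, c, sub_mul, one_mul]
      congr 3
      -- Since b divides n, the f-part of gⁿ is trivial, so xʷ = gⁿ = h^(n w').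
      rw [← gG_pow_n, gG, mul_pow, ← pow_mul, ← pow_mul, mul_comm D.i₀, ← D.n'_mul_b,
        mul_comm _ D.b, mul_assoc, pow_mul D.fG, fG_pow_b, one_pow, mul_one, mul_comm D.w'])

variable {D} in
theorem rep_y {u : D.R} (hu : D.N u D.n = D.c) : D.rep u hu D.y = D.yOp u := D.lift_y _ _ _ _ _ _ _ _

variable {D} in
theorem rep_U {u : D.R} (hu : D.N u D.n = D.c) (v : D.G) : D.rep u hu (D.U v) = D.mulU v := by
  have : (Units.map (D.rep u hu : D.Alg →* Module.End k D.R)).comp D.U = D.mulU := by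
    apply MonoidHom.ext
    intro v
    rw [D.eq_hG_fG v]
    simp only [map_mul, map_zpow, map_pow]
    congr 2
    · ext1
      simp only [MonoidHom.comp_apply, U_hG]
      exact D.lift_h _ _ _ _ _ _ _ _
    · ext1
      simp only [MonoidHom.comp_apply, U_fG]
      exact D.lift_f _ _ _ _ _ _ _ _
  exact congrArg Units.val (DFunLike.congr_fun this v)

variable {D} in
theorem rep_incl {u : D.R} (hu : D.N u D.n = D.c) (r t : D.R) : D.rep u hu (D.incl r) t = r * t := by
  have : (D.rep u hu).comp D.incl = Algebra.lmul k D.R := D.R_algHom_ext fun v => by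
    rw [AlgHom.comp_apply, incl_s, rep_U]; rfl
  exact LinearMap.congr_fun (DFunLike.congr_fun this r) t

variable {D} in
theorem rep_incl_mul_y_pow {u : D.R} (hu : D.N u D.n = D.c) (r t : D.R) (l : ℕ) :
    D.rep u hu (D.incl r * D.y ^ l) t = r * D.N u l * (D.σ ^ l) t := by
  rw [map_mul, Module.End.mul_apply, rep_incl, map_pow, rep_y, yOp_pow_apply, mul_assoc]

/-- The identity is a specialisation of Xⁿ - Yⁿ = ∏ (X - ζ Y). It is proved in k[T] first, because
`A` may have zero divisors and the factorisation over roots of unity needs a domain. -/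
theorem prod_one_sub {A : Type*} [CommRing A] [Algebra k A] {q : k} {n : ℕ} (hn : 0 < n)
    (hq : IsPrimitiveRoot q n) (a : A) : ∏ j ∈ Finset.range n, (1 - q ^ j • a) = 1 - a ^ n := by
  have hC : IsPrimitiveRoot (Polynomial.C q) n := hq.map_of_injective Polynomial.C_injective
  have h := hC.pow_sub_pow_eq_prod_sub_mul 1 Polynomial.X hn
  have h' : ∏ ζ ∈ Polynomial.nthRootsFinset n (1 : Polynomial k), (1 - ζ * Polynomial.X) =
      ∏ j ∈ Finset.range n, (1 - Polynomial.C q ^ j * Polynomial.X) := by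
    symm
    refine Finset.prod_bij (fun j _ => Polynomial.C q ^ j) ?_ ?_ ?_ fun _ _ => rfl
    · intro j _
      rw [Polynomial.mem_nthRootsFinset hn, ← pow_mul, mul_comm, pow_mul, hC.pow_eq_one, one_pow]
    · intro i hi j hj hij
      exact hC.pow_inj (Finset.mem_range.1 hi) (Finset.mem_range.1 hj) hij
    · intro ζ hζ
      have : NeZero n := ⟨hn.ne'⟩
      obtain ⟨j, hj, e⟩ := hC.eq_pow_of_pow_eq_one ((Polynomial.mem_nthRootsFinset hn _).1 hζ)
      exact ⟨j, Finset.mem_range.2 hj, e⟩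
  rw [h', one_pow] at h
  have := congrArg (Polynomial.aeval a) h
  simp only [map_prod, map_sub, map_mul, map_pow, map_one, Polynomial.aeval_X,
    Polynomial.aeval_C] at this
  simp only [Algebra.smul_def, map_pow]
  exact this.symm

/-- The σ-conjugates of g are ξʲ g, so the norm is ∏ (1 - ξʲ g) = 1 - gⁿ. This supplies the
representation by which independence of the yˡ is proved. -/
theorem N_one_sub_gG : D.N (1 - D.s D.gG) D.n = D.c := by
  rw [c, ← s_gG_pow_n, ← prod_one_sub D.n_pos D.ξ_primitive, N]
  refine Finset.prod_congr rfl fun j _ => ?_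
  rw [map_sub, map_one, σ_pow_s, χ_gG, val_ξU]

end LiuDatum

/-! ### Laurent polynomials -/

/-- An ideal of a localisation is extended from its contraction, which is principal in k[T]. -/
instance LaurentPolynomial.isPrincipalIdealRing {k : Type*} [Field k] :
    IsPrincipalIdealRing k[T;T⁻¹] where
  principal I := by
    obtain ⟨p, hp⟩ := IsPrincipalIdealRing.principal (I.under (Polynomial k))
    refine ⟨algebraMap _ _ p, ?_⟩
    rw [← IsLocalization.map_under (Submonoid.powers (Polynomial.X : Polynomial k)) k[T;T⁻¹] I, hp]
    change Ideal.map _ (Ideal.span {p}) = Ideal.span _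
    rw [Ideal.map_span, Set.image_singleton]

theorem LaurentPolynomial.linearMap_ext {k : Type*} [Field k] {M : Type*} [AddCommMonoid M]
    [Module k M] {φ ψ : k[T;T⁻¹] →ₗ[k] M}
    (h : ∀ a : ℤ, φ (LaurentPolynomial.T a) = ψ (LaurentPolynomial.T a)) : φ = ψ :=
  (AddMonoidAlgebra.basis ℤ k).ext fun a => by
    rw [AddMonoidAlgebra.basis_apply]; exact h a

open LaurentPolynomial in
/-- If the `T ^ a • v i` form a `k`-basis, then the `v i` form a basis over the Laurent
polynomials. -/
noncomputable def laurentBasis {k : Type*} [Field k] {M ι : Type*} [AddCommGroup M] [Module k M]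
    [Module k[T;T⁻¹] M] [IsScalarTower k k[T;T⁻¹] M] (B : Module.Basis (ℤ × ι) k M) (v : ι → M)
    (hv : ∀ a i, B (a, i) = (T a : k[T;T⁻¹]) • v i) : Module.Basis ι k[T;T⁻¹] M :=
  let b₀ : Module.Basis (ℤ × ι) k (ι →₀ k[T;T⁻¹]) :=
    (Finsupp.basis fun _ : ι => AddMonoidAlgebra.basis ℤ k).reindex
      ((Equiv.sigmaEquivProd ι ℤ).trans (Equiv.prodComm ι ℤ))
  .ofRepr (LinearEquiv.ofBijective (Finsupp.linearCombination k[T;T⁻¹] v) (by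
    have : (Finsupp.linearCombination k[T;T⁻¹] v).restrictScalars k =
        (b₀.equiv B (Equiv.refl _)).toLinearMap := by
      refine b₀.ext fun ⟨a, i⟩ => ?_
      rw [LinearEquiv.coe_coe, Module.Basis.equiv_apply, Equiv.refl_apply, hv]
      have h : b₀ (a, i) = Finsupp.single i (T a) := by
        simp only [b₀, Module.Basis.reindex_apply, Finsupp.coe_basis, AddMonoidAlgebra.basis_apply]
        rfl
      rw [h, LinearMap.restrictScalars_apply, Finsupp.linearCombination_single]
    have h2 : ⇑(Finsupp.linearCombination k[T;T⁻¹] v) = b₀.equiv B (Equiv.refl _) :=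
      funext fun t => LinearMap.congr_fun this t
    rw [h2]
    exact (b₀.equiv B (Equiv.refl _)).bijective)).symm

theorem laurentBasis_apply {k : Type*} [Field k] {M ι : Type*} [AddCommGroup M] [Module k M]
    [Module k[T;T⁻¹] M] [IsScalarTower k k[T;T⁻¹] M] (B : Module.Basis (ℤ × ι) k M) (v : ι → M)
    (hv : ∀ a i, B (a, i) = (LaurentPolynomial.T a : k[T;T⁻¹]) • v i) (i : ι) :
    laurentBasis B v hv i = v i := by
  simp [laurentBasis]

namespace LiuDatum

variable {k : Type u} [Field k] (D : LiuDatum k)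

open LaurentPolynomial

/-! ### The structures over `k[x, x⁻¹]` -/

/-- The algebra map `k[T;T⁻¹] → kG` sending `T` to `x`. -/
noncomputable def laurentHom : k[T;T⁻¹] →ₐ[k] D.R :=
  AddMonoidAlgebra.lift k D.R ℤ ((MonoidAlgebra.of k D.G).comp (zpowersHom D.G D.xG))

theorem laurentHom_T (a : ℤ) : D.laurentHom (T a) = D.s (D.xG ^ a) := by
  have := AddMonoidAlgebra.lift_single (R := k) ((MonoidAlgebra.of k D.G).comp (zpowersHom D.G D.xG)) a 1
  rw [one_smul] at this
  exact this

noncomputable instance : Algebra k[T;T⁻¹] D.R := D.laurentHom.toRingHom.toAlgebra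

theorem algebraMap_R (p : k[T;T⁻¹]) : algebraMap k[T;T⁻¹] D.R p = D.laurentHom p := rfl

theorem T_smul_R (a : ℤ) (r : D.R) : (T a : k[T;T⁻¹]) • r = D.s (D.xG ^ a) * r := by
  rw [Algebra.smul_def, algebraMap_R, laurentHom_T]

instance : IsScalarTower k k[T;T⁻¹] D.R :=
  .of_algebraMap_eq' D.laurentHom.comp_algebraMap.symm

theorem incl_x_comm (a : ℤ) (t : D.Alg) :
    D.incl (D.s (D.xG ^ a)) * t = t * D.incl (D.s (D.xG ^ a)) := by
  rw [incl_s]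
  have key : ∀ v : D.G, (D.U (D.xG ^ a) : D.Alg) * D.U v = D.U v * (D.U (D.xG ^ a) : D.Alg) := by
    intro v
    rw [← Units.val_mul, ← Units.val_mul, ← map_mul, ← map_mul, mul_comm]
  induction t using D.induction with
  | hc c => exact (Algebra.commutes c _).symm
  | hh => rw [← U_hG]; exact key _
  | hh' => rw [← U_hG, ← map_inv]; exact key _
  | hf => rw [← U_fG]; exact key _
  | hy => rw [y_mul_U, map_zpow D.χ, χ_xG]; simp
  | hadd t t' h h' => rw [mul_add, add_mul, h, h']
  | hmul t t' h h' => rw [← mul_assoc, h, mul_assoc, h', mul_assoc]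

theorem incl_laurentHom_comm (p : k[T;T⁻¹]) (t : D.Alg) :
    D.incl (D.laurentHom p) * t = t * D.incl (D.laurentHom p) := by
  have : (LinearMap.mulRight k t) ∘ₗ D.incl.toLinearMap ∘ₗ D.laurentHom.toLinearMap =
      (LinearMap.mulLeft k t) ∘ₗ D.incl.toLinearMap ∘ₗ D.laurentHom.toLinearMap :=
    linearMap_ext fun a => by simp [laurentHom_T, incl_x_comm]
  exact LinearMap.congr_fun this p

noncomputable instance : Algebra k[T;T⁻¹] D.Alg :=
  RingHom.toAlgebra' (D.incl.comp D.laurentHom).toRingHom D.incl_laurentHom_comm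

theorem algebraMap_Alg (p : k[T;T⁻¹]) :
    algebraMap k[T;T⁻¹] D.Alg p = D.incl (D.laurentHom p) := rfl

theorem incl_smul (p : k[T;T⁻¹]) (r : D.R) : D.incl (p • r) = p • D.incl r := by
  rw [Algebra.smul_def, Algebra.smul_def, map_mul]; rfl

instance : IsScalarTower k k[T;T⁻¹] D.Alg :=
  .of_algebraMap_eq' (D.incl.comp D.laurentHom).comp_algebraMap.symm

theorem T_smul_Alg (a : ℤ) (t : D.Alg) : (T a : k[T;T⁻¹]) • t = D.U (D.xG ^ a) * t := by
  rw [Algebra.smul_def, algebraMap_Alg, laurentHom_T, incl_s]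

/-- The `gⁱ` form a basis of the group algebra over `k[x, x⁻¹]`. -/
noncomputable def basisR : Module.Basis (Fin D.n) k[T;T⁻¹] D.R :=
  laurentBasis ((MonoidAlgebra.basis D.G k).reindex D.groupEquiv.symm)
    (fun i => D.s (D.gG ^ (i : ℕ))) fun a i => by
      rw [Module.Basis.reindex_apply, Equiv.symm_symm, groupEquiv_apply, T_smul_R, ← s_mul,
        MonoidAlgebra.basis_apply]
      rfl

theorem basisR_apply (i : Fin D.n) : D.basisR i = D.s (D.gG ^ (i : ℕ)) := laurentBasis_apply _ _ _ _

instance : Module.Free k[T;T⁻¹] D.R := .of_basis D.basisR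

/-- `1 - Tʷ`. -/
noncomputable def cP : k[T;T⁻¹] := 1 - T D.w

theorem cP_ne_zero : D.cP ≠ 0 := by
  intro h
  have h1 := congrArg (fun p : k[T;T⁻¹] => AddMonoidAlgebra.coeff p 0) h
  have := D.w_pos
  have h2 : ((1 : k[T;T⁻¹])).coeff 0 = 1 := by rw [← T_zero, T_apply]; simp
  have h3 : ((T D.w : k[T;T⁻¹])).coeff 0 = 0 := by
    rw [T_apply, if_neg (by exact_mod_cast this.ne')]
  simp [cP, h2, h3] at h1

theorem laurentHom_cP : D.laurentHom D.cP = D.c := by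
  rw [cP, map_sub, map_one, laurentHom_T, c, zpow_natCast]

theorem c_mul (r : D.R) : D.c * r = D.cP • r := by
  rw [Algebra.smul_def, algebraMap_R, laurentHom_cP]

/-- The element c comes from a nonzero element of the domain P, over which R is free. -/
theorem c_mul_cancel {r : D.R} (h : D.c * r = 0) : r = 0 := by
  rw [c_mul] at h
  exact (smul_eq_zero.1 h).resolve_left D.cP_ne_zero

/-! ### The basis of the algebra -/

/-- `(r_l) ↦ ∑ r_l y ^ l`. -/
noncomputable def buildHom : (Fin D.n → D.R) →ₗ[k[T;T⁻¹]] D.Alg where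
  toFun r := ∑ l, D.incl (r l) * D.y ^ (l : ℕ)
  map_add' r r' := by simp [add_mul, Finset.sum_add_distrib]
  map_smul' p r := by simp [incl_smul, Finset.smul_sum]

theorem buildHom_apply (r : Fin D.n → D.R) : D.buildHom r = ∑ l, D.incl (r l) * D.y ^ (l : ℕ) := rfl

/-- The partial norm divides the full norm c, which is not a zero divisor. -/
theorem N_mul_cancel {u : D.R} (hu : D.N u D.n = D.c) {l : ℕ} (hl : l ≤ D.n) {r : D.R}
    (h : r * D.N u l = 0) : r = 0 := by
  apply D.c_mul_cancel
  rw [← hu, N, ← Finset.prod_range_mul_prod_Ico _ hl, mul_right_comm, mul_comm _ r]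
  change r * D.N u l * _ = 0
  rw [h, zero_mul]

variable {D} in
theorem rep_buildHom {u : D.R} (hu : D.N u D.n = D.c) (r : Fin D.n → D.R) (t : D.R) :
    D.rep u hu (D.buildHom r) t = ∑ l, r l * D.N u l * (D.σ ^ (l : ℕ)) t := by
  simp only [buildHom_apply, map_sum, LinearMap.sum_apply, rep_incl_mul_y_pow]

/-- The operator is ∑ r_l N_l σˡ, where N_l is the l-th partial norm of u. Evaluating at gʲ and
dividing by gʲ gives ∑ ξ^(l j) r_l N_l = 0 for all j < n. The Vandermonde matrix of the distinct ξˡ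
is invertible, so r_l N_l = 0, and N_l can be cancelled. -/
theorem rep_buildHom_injective {u : D.R} (hu : D.N u D.n = D.c) {r : Fin D.n → D.R}
    (h : D.rep u hu (D.buildHom r) = 0) : r = 0 := by
  have h1 : ∀ j : Fin D.n, ∑ l : Fin D.n, (D.ξ ^ (l : ℕ)) ^ (j : ℕ) • (r l * D.N u l) = 0 := by
    intro j
    have h2 := LinearMap.congr_fun h (D.s (D.gG ^ (j : ℕ)))
    rw [rep_buildHom, LinearMap.zero_apply] at h2
    have h3 := congrArg (· * D.s ((D.gG ^ (j : ℕ))⁻¹)) h2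
    simp only [Finset.sum_mul, zero_mul] at h3
    rw [← h3]
    refine Finset.sum_congr rfl fun l _ => ?_
    rw [σ_pow_s, mul_smul_comm, smul_mul_assoc, mul_assoc, ← s_mul, mul_inv_cancel, s_one, mul_one,
      map_pow, χ_gG, Units.val_pow_eq_pow_val, val_ξU, pow_right_comm]
  funext l
  apply D.N_mul_cancel hu l.2.le
  ext v
  have h4 : (fun l : Fin D.n => (r l * D.N u l).coeff v) = 0 := by
    refine Matrix.eq_zero_of_forall_pow_sum_mul_pow_eq_zero (f := fun l : Fin D.n => D.ξ ^ (l : ℕ))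
      ?_ fun j => ?_
    · intro i j hij
      exact Fin.ext (D.ξ_primitive.pow_inj i.2 j.2 hij)
    · have := congrArg (fun t : D.R => MonoidAlgebra.coeff t v) (h1 j)
      simpa [mul_comm, Finsupp.finsetSum_apply] using this
  simpa using congrFun h4 l

theorem buildHom_injective : Function.Injective D.buildHom := by
  rw [← LinearMap.ker_eq_bot, LinearMap.ker_eq_bot']
  intro r hr
  exact D.rep_buildHom_injective D.N_one_sub_gG (by rw [hr, map_zero])

theorem incl_mul_mem (r : D.R) {t : D.Alg} (ht : t ∈ LinearMap.range D.buildHom) :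
    D.incl r * t ∈ LinearMap.range D.buildHom := by
  obtain ⟨a, rfl⟩ := ht
  refine ⟨fun l => r * a l, ?_⟩
  simp [buildHom_apply, Finset.mul_sum, mul_assoc]

theorem incl_mul_y_pow_mem (r : D.R) (l : ℕ) : D.incl r * D.y ^ l ∈ LinearMap.range D.buildHom := by
  induction l using Nat.strong_induction_on generalizing r with
  | _ l ih =>
    by_cases hl : l < D.n
    · refine ⟨Pi.single ⟨l, hl⟩ r, ?_⟩
      rw [buildHom_apply, Finset.sum_eq_single ⟨l, hl⟩] <;> simp +contextual
    · obtain ⟨m, rfl⟩ := Nat.exists_eq_add_of_le (not_lt.1 hl)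
      rw [pow_add, y_pow_n', ← mul_assoc, ← map_mul]
      exact ih m (by have := D.n_pos; omega) _

theorem buildHom_surjective : Function.Surjective D.buildHom := by
  rw [← LinearMap.range_eq_top, Submodule.eq_top_iff']
  have key : ∀ a t : D.Alg, t ∈ LinearMap.range D.buildHom → a * t ∈ LinearMap.range D.buildHom := by
    intro a
    induction a using D.induction with
    | hc c => intro t ht; rw [← D.incl.commutes]; exact D.incl_mul_mem _ ht
    | hh => intro t ht; rw [← U_hG, ← incl_s]; exact D.incl_mul_mem _ ht
    | hh' => intro t ht; rw [← U_hG, ← map_inv, ← incl_s]; exact D.incl_mul_mem _ ht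
    | hf => intro t ht; rw [← U_fG, ← incl_s]; exact D.incl_mul_mem _ ht
    | hy =>
      rintro _ ⟨a, rfl⟩
      rw [buildHom_apply, Finset.mul_sum]
      refine Submodule.sum_mem _ fun l _ => ?_
      rw [← mul_assoc, y_mul_incl, mul_assoc, ← pow_succ']
      exact D.incl_mul_y_pow_mem _ _
    | hadd a c ha hc => intro t ht; rw [add_mul]; exact add_mem (ha t ht) (hc t ht)
    | hmul a c ha hc => intro t ht; rw [mul_assoc]; exact ha _ (hc t ht)
  intro a
  rw [← mul_one a]
  refine key a 1 ?_
  simpa using D.incl_mul_y_pow_mem 1 0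

/-- `(r_l) ↦ ∑ r_l y ^ l` as an isomorphism. -/
noncomputable def build : (Fin D.n → D.R) ≃ₗ[k[T;T⁻¹]] D.Alg :=
  LinearEquiv.ofBijective D.buildHom ⟨D.buildHom_injective, D.buildHom_surjective⟩

theorem build_apply (r : Fin D.n → D.R) : D.build r = ∑ l, D.incl (r l) * D.y ^ (l : ℕ) := rfl

/-- The coefficient of `y ^ l`. -/
noncomputable def coef (l : Fin D.n) : D.Alg →ₗ[k[T;T⁻¹]] D.R :=
  LinearMap.proj l ∘ₗ D.build.symm.toLinearMap

theorem sum_coef (t : D.Alg) : ∑ l, D.incl (D.coef l t) * D.y ^ (l : ℕ) = t :=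
  D.build.apply_symm_apply t

theorem coef_build (r : Fin D.n → D.R) (l : Fin D.n) :
    D.coef l (∑ l, D.incl (r l) * D.y ^ (l : ℕ)) = r l :=
  congrFun (D.build.symm_apply_apply r) l

theorem coef_incl_mul_y_pow (r : D.R) (l m : Fin D.n) :
    D.coef l (D.incl r * D.y ^ (m : ℕ)) = if l = m then r else 0 := by
  have := D.coef_build (Pi.single m r) l
  rw [Finset.sum_eq_single m] at this
  · simp only [Pi.single_eq_same] at this
    rw [this, Pi.single_apply]
  · intro j _ hj; simp [hj]
  · simp

theorem coef_ext {t t' : D.Alg} (h : ∀ l, D.coef l t = D.coef l t') : t = t' := by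
  rw [← D.sum_coef t, ← D.sum_coef t']
  simp [h]

theorem coef_incl_mul (r : D.R) (l : Fin D.n) (t : D.Alg) : D.coef l (D.incl r * t) = r * D.coef l t := by
  conv_lhs => rw [← D.sum_coef t, Finset.mul_sum]
  simp only [← mul_assoc, ← map_mul]
  exact D.coef_build (fun m => r * D.coef m t) l

theorem rep_injective {u : D.R} (hu : D.N u D.n = D.c) : Function.Injective (D.rep u hu) := by
  rw [injective_iff_map_eq_zero]
  intro a ha
  obtain ⟨r, rfl⟩ := D.buildHom_surjective a
  rw [D.rep_buildHom_injective hu ha, map_zero]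

/-- The `gⁱ yˡ` form a basis of the algebra over `k[x, x⁻¹]`. -/
noncomputable def basisP : Module.Basis (Fin D.n × Fin D.n) k[T;T⁻¹] D.Alg :=
  (((Pi.basis fun _ : Fin D.n => D.basisR).map D.build).reindex
    ((Equiv.sigmaEquivProd _ _).trans (Equiv.prodComm _ _)))

theorem basisP_apply (i l : Fin D.n) :
    D.basisP (i, l) = (D.U (D.gG ^ (i : ℕ)) : D.Alg) * D.y ^ (l : ℕ) := by
  have : D.build (Pi.single l (D.s (D.gG ^ (i : ℕ)))) =
      (D.U (D.gG ^ (i : ℕ)) : D.Alg) * D.y ^ (l : ℕ) := by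
    rw [build_apply, Finset.sum_eq_single l]
    · simp [incl_s]
    · intro j _ hj; simp [hj]
    · simp
  rw [← this, basisP, Module.Basis.reindex_apply, Module.Basis.map_apply]
  simp [basisR_apply]

/-- The `v yˡ` form a `k`-basis of the algebra. -/
noncomputable def basisK : Module.Basis (D.G × Fin D.n) k D.Alg :=
  (((Pi.basis fun _ : Fin D.n => MonoidAlgebra.basis D.G k).map (D.build.restrictScalars k)).reindex
    ((Equiv.sigmaEquivProd _ _).trans (Equiv.prodComm _ _)))

theorem basisK_apply (v : D.G) (l : Fin D.n) : D.basisK (v, l) = (D.U v : D.Alg) * D.y ^ (l : ℕ) := by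
  have : D.build (Pi.single l (D.s v)) = (D.U v : D.Alg) * D.y ^ (l : ℕ) := by
    rw [build_apply, Finset.sum_eq_single l]
    · simp [incl_s]
    · intro j _ hj; simp [hj]
    · simp
  rw [← this, basisK, Module.Basis.reindex_apply, Module.Basis.map_apply]
  simp [s]

theorem basisK_repr (t : D.Alg) (v : D.G) (l : Fin D.n) :
    D.basisK.repr t (v, l) = (D.coef l t).coeff v := by
  rw [basisK, Module.Basis.repr_reindex_apply, Module.Basis.map_repr]
  change (Pi.basis fun _ : Fin D.n => MonoidAlgebra.basis D.G k).repr (D.build.symm t) ⟨l, v⟩ = _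
  rw [Pi.basis_repr]
  rfl

instance : Module.Free k[T;T⁻¹] D.Alg := .of_basis D.basisP

instance : Module.Finite k[T;T⁻¹] D.Alg := .of_basis D.basisP

instance : Nontrivial D.Alg :=
  have : Nonempty (Fin D.n × Fin D.n) := ⟨(0, 0)⟩
  D.basisP.repr.toEquiv.nontrivial

/-! ### The second presentation -/

section presentation

open LiuGen'

theorem x_comm (t : D.Alg) : (D.x : D.Alg) * t = t * D.x := by
  have := D.incl_x_comm 1 t
  rwa [zpow_one, incl_s, U_xG] at this

theorem x_pow_w : (D.x : D.Alg) ^ D.w = (D.g : D.Alg) ^ D.n := by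
  rw [← Units.val_pow_eq_pow_val, ← Units.val_pow_eq_pow_val, ← U_xG, ← U_gG, ← map_pow, ← map_pow,
    gG_pow_n]

theorem y_pow_n_x : D.y ^ D.n = 1 - (D.x : D.Alg) ^ D.w := by
  rw [y_pow_n, x_pow_w, g_pow_n]

/-- The algebra map from the second presentation. -/
noncomputable def ofAlg' : LiuAlg' D.n D.w D.ξ →ₐ[k] D.Alg :=
  RingQuot.liftAlgHom k ⟨FreeAlgebra.lift k fun
    | .x => (D.x : D.Alg)
    | .xInv => ((D.x⁻¹ : D.Algˣ) : D.Alg)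
    | .g => (D.g : D.Alg)
    | .y => D.y, by
    intro a c hac
    cases hac <;> simp [y_mul_g, y_pow_n_x, x_comm, x_pow_w]⟩

theorem ofAlg'_gen (s : LiuGen') : D.ofAlg' (LiuAlg'.gen _ _ _ s) = match s with
    | .x => (D.x : D.Alg)
    | .xInv => ((D.x⁻¹ : D.Algˣ) : D.Alg)
    | .g => (D.g : D.Alg)
    | .y => D.y := by
  rw [LiuAlg'.gen, ofAlg', RingQuot.liftAlgHom_mkAlgHom_apply, FreeAlgebra.lift_ι_apply]

/-- The generator `x` of the second presentation as a unit. -/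
noncomputable def x' : (LiuAlg' D.n D.w D.ξ)ˣ where
  val := LiuAlg'.gen _ _ _ .x
  inv := LiuAlg'.gen _ _ _ .xInv
  val_inv := by
    rw [LiuAlg'.gen, LiuAlg'.gen, ← map_mul, RingQuot.mkAlgHom_rel k LiuRel'.x_xInv, map_one]
  inv_val := by
    rw [LiuAlg'.gen, LiuAlg'.gen, ← map_mul, RingQuot.mkAlgHom_rel k LiuRel'.xInv_x, map_one]

/-- The generator `g` of the second presentation. -/
noncomputable abbrev g' : LiuAlg' D.n D.w D.ξ := LiuAlg'.gen _ _ _ .g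

/-- The generator `y` of the second presentation. -/
noncomputable abbrev y' : LiuAlg' D.n D.w D.ξ := LiuAlg'.gen _ _ _ .y

theorem y'_g' : D.y' * D.g' = D.ξ • (D.g' * D.y') := by
  simp only [LiuAlg'.gen]
  rw [← map_mul, ← map_mul, RingQuot.mkAlgHom_rel k LiuRel'.y_g, map_smul]

theorem y'_pow : D.y' ^ D.n = 1 - (D.x' : LiuAlg' D.n D.w D.ξ) ^ D.w := by
  simp only [LiuAlg'.gen, x']
  rw [← map_pow, RingQuot.mkAlgHom_rel k LiuRel'.y_pow, map_sub, map_one, map_pow]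

theorem g'_pow : D.g' ^ D.n = (D.x' : LiuAlg' D.n D.w D.ξ) ^ D.w := by
  have h := RingQuot.mkAlgHom_rel k (LiuRel'.x_pow (n := D.n) (w := D.w) (ξ := D.ξ))
  rw [map_sub, map_sub, map_pow, map_pow] at h
  exact (sub_right_inj.1 h).symm

theorem x'_y' : Commute (D.x' : LiuAlg' D.n D.w D.ξ) D.y' := by
  change LiuAlg'.gen _ _ _ _ * LiuAlg'.gen _ _ _ _ = LiuAlg'.gen _ _ _ _ * LiuAlg'.gen _ _ _ _
  simp only [LiuAlg'.gen]
  rw [← map_mul, ← map_mul, RingQuot.mkAlgHom_rel k LiuRel'.x_y]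

theorem x'_g' : Commute (D.x' : LiuAlg' D.n D.w D.ξ) D.g' := by
  change LiuAlg'.gen _ _ _ _ * LiuAlg'.gen _ _ _ _ = LiuAlg'.gen _ _ _ _ * LiuAlg'.gen _ _ _ _
  simp only [LiuAlg'.gen]
  rw [← map_mul, ← map_mul, RingQuot.mkAlgHom_rel k LiuRel'.x_g]

/-- The monomials `x ^ a g ^ i y ^ l` of the second presentation. -/
noncomputable def mono' (a : ℤ) (i l : ℕ) : LiuAlg' D.n D.w D.ξ :=
  ((D.x' ^ a : (LiuAlg' D.n D.w D.ξ)ˣ) : LiuAlg' D.n D.w D.ξ) * D.g' ^ i * D.y' ^ l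

theorem zpow_x'_y' (a : ℤ) : Commute ((D.x' ^ a : (LiuAlg' D.n D.w D.ξ)ˣ) : LiuAlg' D.n D.w D.ξ) D.y' :=
  Commute.units_zpow_left D.x'_y' a

/-- The section of `ofAlg'` sending a basis element to the corresponding monomial. -/
noncomputable def toAlg' : D.Alg →ₗ[k] LiuAlg' D.n D.w D.ξ :=
  D.basisK.constr k fun p => D.mono' (D.groupEquiv.symm p.1).1 (D.groupEquiv.symm p.1).2 p.2

theorem ofAlg'_mono' (a : ℤ) (i l : ℕ) :
    D.ofAlg' (D.mono' a i l) = (D.U (D.xG ^ a * D.gG ^ i) : D.Alg) * D.y ^ l := by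
  have hx : Units.map (D.ofAlg' : LiuAlg' D.n D.w D.ξ →* D.Alg) D.x' = D.U D.xG :=
    Units.ext (by rw [U_xG]; exact D.ofAlg'_gen .x)
  have hxa := congrArg (fun t : D.Algˣ => ((t ^ a : D.Algˣ) : D.Alg)) hx
  simp only [← map_zpow] at hxa
  rw [mono', map_mul, map_mul, map_pow, map_pow, ofAlg'_gen, ofAlg'_gen, map_mul, map_pow, U_gG,
    Units.val_mul, Units.val_pow_eq_pow_val, ← hxa]
  rfl

theorem ofAlg'_toAlg' (t : D.Alg) : D.ofAlg' (D.toAlg' t) = t := by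
  have : D.ofAlg'.toLinearMap ∘ₗ D.toAlg' = LinearMap.id := D.basisK.ext fun ⟨v, l⟩ => by
    rw [LinearMap.comp_apply, toAlg', Module.Basis.constr_basis, AlgHom.toLinearMap_apply,
      ofAlg'_mono', ← groupEquiv_apply, Prod.mk.eta, Equiv.apply_symm_apply, basisK_apply]
    rfl
  exact LinearMap.congr_fun this t

/-- Reduced monomials are images of basis elements by construction. Excess powers are removed by gⁿ
= xʷ and yⁿ = 1 - xʷ, with an outer induction on l and an inner one on i. -/
theorem mono'_mem (a : ℤ) (i l : ℕ) : D.mono' a i l ∈ LinearMap.range D.toAlg' := by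
  have hn := D.n_pos
  induction l using Nat.strong_induction_on generalizing a i with
  | _ l ihl =>
    by_cases hl : l < D.n
    · induction i using Nat.strong_induction_on generalizing a with
      | _ i ihi =>
        by_cases hi : i < D.n
        · refine ⟨D.basisK (D.groupEquiv (a, ⟨i, hi⟩), ⟨l, hl⟩), ?_⟩
          rw [toAlg', Module.Basis.constr_basis]
          simp
        · obtain ⟨m, rfl⟩ := Nat.exists_eq_add_of_le (not_lt.1 hi)
          have : D.mono' a (D.n + m) l = D.mono' (a + D.w) m l := by
            rw [mono', mono', pow_add, g'_pow, zpow_add, Units.val_mul, zpow_natCast,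
              Units.val_pow_eq_pow_val]
            simp only [mul_assoc]
          rw [this]
          exact ihi m (by omega) _
    · obtain ⟨m, rfl⟩ := Nat.exists_eq_add_of_le (not_lt.1 hl)
      have : D.mono' a i (D.n + m) = D.mono' a i m - D.mono' (a + D.w) i m := by
        have h1 : D.g' ^ i * (D.x' : LiuAlg' D.n D.w D.ξ) ^ D.w =
            (D.x' : LiuAlg' D.n D.w D.ξ) ^ D.w * D.g' ^ i := (D.x'_g'.pow_pow _ _).symm.eq
        rw [mono', mono', mono', pow_add, y'_pow, zpow_add, Units.val_mul, zpow_natCast,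
          Units.val_pow_eq_pow_val, sub_mul, mul_sub, one_mul, ← mul_assoc (_ * D.g' ^ i),
          mul_assoc _ (D.g' ^ i) ((D.x' : LiuAlg' D.n D.w D.ξ) ^ D.w), h1]
        simp only [mul_assoc]
      rw [this]
      exact sub_mem (ihl m (by omega) _ _) (ihl m (by omega) _ _)

/-- The range contains 1 and is stable under left multiplication by the generators, as these send
monomials to scalar multiples of monomials. Since `ofAlg'` is a left inverse of `toAlg'`,
surjectivity makes `ofAlg'` bijective without a normal form theorem for the second presentation. -/
theorem toAlg'_surjective : Function.Surjective D.toAlg' := by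
  rw [← LinearMap.range_eq_top, Submodule.eq_top_iff']
  have key : ∀ a : FreeAlgebra k LiuGen', ∀ t ∈ LinearMap.range D.toAlg',
      RingQuot.mkAlgHom k (LiuRel' D.n D.w D.ξ) a * t ∈ LinearMap.range D.toAlg' := by
    have red : ∀ z : LiuAlg' D.n D.w D.ξ,
        (∀ a i l, z * D.mono' a i l ∈ LinearMap.range D.toAlg') →
        ∀ t ∈ LinearMap.range D.toAlg', z * t ∈ LinearMap.range D.toAlg' := by
      rintro z hz _ ⟨t, rfl⟩
      have : (⊤ : Submodule k D.Alg) ≤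
          (LinearMap.range D.toAlg').comap (LinearMap.mulLeft k z ∘ₗ D.toAlg') := by
        rw [← D.basisK.span_eq, Submodule.span_le]
        rintro _ ⟨p, rfl⟩
        rw [SetLike.mem_coe, Submodule.mem_comap, LinearMap.comp_apply, toAlg',
          Module.Basis.constr_basis]
        exact hz _ _ _
      exact this Submodule.mem_top
    intro a
    induction a using FreeAlgebra.induction with
    | grade0 c =>
      intro t ht
      rw [AlgHom.commutes, ← Algebra.smul_def]
      exact Submodule.smul_mem _ _ ht
    | grade1 s =>
      refine red _ fun a i l => ?_
      cases s with
      | x =>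
        have : (D.x' : LiuAlg' D.n D.w D.ξ) * D.mono' a i l = D.mono' (1 + a) i l := by
          rw [mono', mono', zpow_add, zpow_one, Units.val_mul]; simp only [mul_assoc]
        exact this ▸ D.mono'_mem _ _ _
      | xInv =>
        have : ((D.x'⁻¹ : (LiuAlg' D.n D.w D.ξ)ˣ) : LiuAlg' D.n D.w D.ξ) * D.mono' a i l =
            D.mono' (-1 + a) i l := by
          rw [mono', mono', zpow_add, zpow_neg_one, Units.val_mul]; simp only [mul_assoc]
        exact this ▸ D.mono'_mem _ _ _
      | g =>
        have : D.g' * D.mono' a i l = D.mono' a (i + 1) l := by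
          rw [mono', mono', pow_succ', ← mul_assoc, ← mul_assoc, ← mul_assoc,
            (Commute.units_zpow_left D.x'_g' a).eq]
        exact this ▸ D.mono'_mem _ _ _
      | y =>
        have : D.y' * D.mono' a i l = D.ξ ^ i • D.mono' a i (l + 1) := by
          rw [mono', mono', ← mul_assoc, ← mul_assoc, ← (D.zpow_x'_y' a).eq, mul_assoc _ D.y',
            skew_pow D.y'_g', mul_smul_comm, smul_mul_assoc, pow_succ']
          simp only [mul_assoc]
        exact this ▸ Submodule.smul_mem _ _ (D.mono'_mem _ _ _)
    | mul a c ha hc => intro t ht; rw [map_mul, mul_assoc]; exact ha _ (hc t ht)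
    | add a c ha hc => intro t ht; rw [map_add, add_mul]; exact add_mem (ha t ht) (hc t ht)
  intro t
  obtain ⟨a, rfl⟩ := RingQuot.mkAlgHom_surjective k (LiuRel' D.n D.w D.ξ) t
  rw [← mul_one (RingQuot.mkAlgHom k (LiuRel' D.n D.w D.ξ) a)]
  refine key a 1 ?_
  have := D.mono'_mem 0 0 0
  simpa [mono'] using this

/-- The two presentations define the same algebra. -/
noncomputable def presentationEquiv : LiuAlg' D.n D.w D.ξ ≃ₐ[k] D.Alg :=
  AlgEquiv.ofBijective D.ofAlg' ⟨by
    rw [injective_iff_map_eq_zero]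
    intro a ha
    obtain ⟨t, rfl⟩ := D.toAlg'_surjective a
    rw [ofAlg'_toAlg'] at ha
    rw [ha, map_zero], fun t => ⟨_, D.ofAlg'_toAlg' t⟩⟩

theorem presentationEquiv_gen (s : LiuGen') :
    D.presentationEquiv (LiuAlg'.gen _ _ _ s) = D.ofAlg' (LiuAlg'.gen _ _ _ s) := rfl

end presentation

/-! ### Finiteness and the centre -/

open LaurentPolynomial

instance : Finite LiuGen :=
  .of_surjective ![LiuGen.h, .hInv, .f, .y] fun s => by
    cases s
    exacts [⟨0, rfl⟩, ⟨1, rfl⟩, ⟨2, rfl⟩, ⟨3, rfl⟩]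

theorem finiteType : Algebra.FiniteType k D.Alg :=
  .of_surjective D.ofFree D.ofFree_surjective

theorem isNoetherianRing : IsNoetherianRing D.Alg :=
  isNoetherian_of_tower k[T;T⁻¹] inferInstance

theorem isNoetherianRing_op : IsNoetherianRing D.Algᵐᵒᵖ := by
  have : Module.Finite k[T;T⁻¹] D.Algᵐᵒᵖ := .equiv (MulOpposite.opLinearEquiv k[T;T⁻¹])
  exact isNoetherian_of_tower k[T;T⁻¹] inferInstance

theorem mem_of_repr {S : Submodule k D.Alg} {t : D.Alg}
    (h : ∀ v l, D.basisK.repr t (v, l) ≠ 0 → (D.U v : D.Alg) * D.y ^ (l : ℕ) ∈ S) : t ∈ S := by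
  rw [← D.basisK.linearCombination_repr t, Finsupp.linearCombination_apply]
  refine Submodule.sum_mem _ fun p hp => Submodule.smul_mem _ _ ?_
  rw [← Prod.mk.eta (p := p), basisK_apply]
  exact h _ _ (Finsupp.mem_support_iff.1 hp)

theorem repr_of_eigen {φ : D.Alg →ₗ[k] D.Alg} {a : D.G → Fin D.n → k}
    (h : ∀ v (l : Fin D.n), φ ((D.U v : D.Alg) * D.y ^ (l : ℕ)) = a v l • ((D.U v : D.Alg) * D.y ^ (l : ℕ)))
    (t : D.Alg) (v : D.G) (l : Fin D.n) :
    D.basisK.repr (φ t) (v, l) = a v l * D.basisK.repr t (v, l) := by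
  have : Finsupp.lapply (v, l) ∘ₗ D.basisK.repr.toLinearMap ∘ₗ φ =
      a v l • (Finsupp.lapply (v, l) ∘ₗ D.basisK.repr.toLinearMap) := by
    refine D.basisK.ext fun ⟨v', l'⟩ => ?_
    simp only [LinearMap.comp_apply, LinearMap.smul_apply, basisK_apply, h, map_smul]
    rw [← basisK_apply]
    simp only [LinearEquiv.coe_coe, Module.Basis.repr_self, Finsupp.lapply_apply, smul_eq_mul,
      Finsupp.single_apply]
    split_ifs with h
    · obtain ⟨rfl, rfl⟩ := Prod.ext_iff.1 h; rfl
    · simp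
  exact LinearMap.congr_fun this t

/-- A vector fixed by an operator that is diagonal in the basis v yˡ involves only basis elements of
eigenvalue 1. The centre and both fixed rings are found with this criterion. -/
theorem eq_one_of_eigen {φ : D.Alg →ₗ[k] D.Alg} {a : D.G → Fin D.n → k}
    (h : ∀ v (l : Fin D.n), φ ((D.U v : D.Alg) * D.y ^ (l : ℕ)) = a v l • ((D.U v : D.Alg) * D.y ^ (l : ℕ)))
    {t : D.Alg} (ht : φ t = t) {v : D.G} {l : Fin D.n} (hv : D.basisK.repr t (v, l) ≠ 0) :
    a v l = 1 := by
  have := D.repr_of_eigen h t v l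
  rw [ht] at this
  exact mul_right_cancel₀ hv (by rw [one_mul]; exact this.symm)

/-- The map `k[T;T⁻¹] → D.Alg` sending `T` to `x`. -/
noncomputable def laurentAlg : k[T;T⁻¹] →ₐ[k] D.Alg := D.incl.comp D.laurentHom

theorem laurentAlg_T (a : ℤ) : D.laurentAlg (T a) = D.U (D.xG ^ a) := by
  rw [laurentAlg, AlgHom.comp_apply, laurentHom_T, incl_s]

theorem laurentAlg_injective : Function.Injective D.laurentAlg :=
  FaithfulSMul.algebraMap_injective k[T;T⁻¹] D.Alg

theorem coeff_σ (r : D.R) (v : D.G) : (D.σ r).coeff v = D.χ v * r.coeff v := by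
  let e : D.R →ₗ[k] k := Finsupp.lapply v ∘ₗ (MonoidAlgebra.coeffLinearEquiv k).toLinearMap
  have : e ∘ₗ D.σ.toLinearMap = (D.χ v : k) • e := D.R_linearMap_ext fun v' => by
    simp only [LinearMap.comp_apply, AlgHom.toLinearMap_apply, σ_s, map_smul, LinearMap.smul_apply]
    by_cases h : v' = v
    · rw [h]
    · have : e (D.s v') = 0 := Finsupp.single_eq_of_ne (Ne.symm h)
      rw [this, smul_zero, smul_zero]
  exact LinearMap.congr_fun this r

/-- Conjugation by g scales v yˡ by ξ⁻ˡ, so a central element has y-degree 0 and lies in R.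
Commuting with y then forces σ-invariance, that is, support in ker χ = ⟨x⟩. -/
theorem range_laurentAlg : D.laurentAlg.range = Subalgebra.center k D.Alg := by
  apply le_antisymm
  · rintro _ ⟨p, rfl⟩
    rw [Subalgebra.mem_center_iff]
    intro t
    exact (Algebra.commutes p t).symm
  · intro t ht
    rw [Subalgebra.mem_center_iff] at ht
    have h1 : ∀ v l, D.basisK.repr t (v, l) ≠ 0 → (l : ℕ) = 0 := by
      intro v l hv
      have := D.eq_one_of_eigen (a := fun v l => D.ξ⁻¹ ^ (l : ℕ)) (t := t) (v := v) (l := l)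
        (φ := LinearMap.mulLeft k (D.U D.gG : D.Alg) ∘ₗ
          LinearMap.mulRight k (D.U D.gG⁻¹ : D.Alg)) ?_ ?_ hv
      · have h2 : D.ξ ^ (l : ℕ) = 1 := by simpa using this
        exact Nat.eq_zero_of_dvd_of_lt ((D.ξ_primitive.pow_eq_one_iff_dvd _).1 h2) l.2
      · intro v l
        rw [LinearMap.comp_apply, LinearMap.mulRight_apply, LinearMap.mulLeft_apply, mul_assoc,
          pow_y_mul_U, mul_smul_comm, mul_smul_comm, ← mul_assoc, ← mul_assoc, ← Units.val_mul,
          ← Units.val_mul, ← map_mul, ← map_mul, mul_inv_cancel_comm, map_inv, χ_gG]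
        simp
      · rw [LinearMap.comp_apply, LinearMap.mulRight_apply, LinearMap.mulLeft_apply, ← ht,
          ← mul_assoc, ← Units.val_mul, ← map_mul]
        simp
    set r := D.coef 0 t with hr
    have h2 : t = D.incl r := by
      have := D.sum_coef t
      rw [Finset.sum_eq_single 0 (fun l _ hl => ?_) (by simp)] at this
      · simpa [hr] using this.symm
      · have : D.coef l t = 0 := by
          ext v
          rw [← basisK_repr]
          by_contra h
          exact hl (Fin.ext (by simpa using h1 v l h))
        rw [this, map_zero, zero_mul]
    have h3 : D.σ r = r := by
      have h4 := ht D.y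
      rw [h2, y_mul_incl] at h4
      have h5 := congrArg (D.coef ⟨1, D.one_lt_n⟩) h4
      have h6 := fun r => D.coef_incl_mul_y_pow r ⟨1, D.one_lt_n⟩ ⟨1, D.one_lt_n⟩
      simp only [pow_one, if_true] at h6
      rwa [h6, h6] at h5
    rw [h2]
    have h7 : r ∈ LinearMap.range D.laurentHom.toLinearMap := by
      rw [← (MonoidAlgebra.basis D.G k).linearCombination_repr r, Finsupp.linearCombination_apply]
      refine Submodule.sum_mem _ fun v hv => Submodule.smul_mem _ _ ?_
      have h8 : r.coeff v ≠ 0 := Finsupp.mem_support_iff.1 hv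
      have h9 := D.coeff_σ r v
      rw [h3] at h9
      obtain ⟨a, rfl⟩ := D.exists_xG_zpow (v := v)
        (Units.ext (mul_right_cancel₀ h8 (by rw [← h9, Units.val_one, one_mul])))
      exact ⟨T a, D.laurentHom_T a⟩
    obtain ⟨p, hp⟩ := h7
    exact ⟨p, by rw [← hp]; rfl⟩

/-- The centre is the Laurent polynomial algebra in `x`. -/
noncomputable def centerEquiv : k[T;T⁻¹] ≃ₐ[k] Subalgebra.center k D.Alg :=
  (AlgEquiv.ofInjective D.laurentAlg D.laurentAlg_injective).trans
    (Subalgebra.equivOfEq _ _ D.range_laurentAlg)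

theorem centerEquiv_T : (D.centerEquiv (T 1) : D.Alg) = D.x := by
  change D.laurentAlg (T 1) = _
  rw [laurentAlg_T, zpow_one, U_xG]

/-! ### Winding automorphisms -/

theorem isGroupLike_U (v : D.G) : IsGroupLikeElem k (D.U v : D.Alg) := by
  rw [D.eq_hG_fG v, map_mul, map_pow, map_zpow, U_hG, U_fG, Units.val_mul,
    Units.val_pow_eq_pow_val]
  refine .mul ?_ D.isGroupLike_f.pow
  obtain ⟨m, h | h⟩ := Int.eq_nat_or_neg v.1.toAdd
  · rw [h, zpow_natCast, Units.val_pow_eq_pow_val]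
    exact D.isGroupLike_h.pow
  · rw [h, zpow_neg, zpow_natCast, isGroupLikeElem_unitsInv, Units.val_pow_eq_pow_val]
    exact D.isGroupLike_h.pow

theorem comul_U (v : D.G) :
    Coalgebra.comul (R := k) (D.U v : D.Alg) = (D.U v : D.Alg) ⊗ₜ[k] (D.U v : D.Alg) :=
  (D.isGroupLike_U v).comul_eq_tmul_self

theorem counit_U (v : D.G) : Coalgebra.counit (R := k) (D.U v : D.Alg) = 1 :=
  (D.isGroupLike_U v).counit_eq_one

theorem comul_y : Coalgebra.comul (R := k) D.y = D.y ⊗ₜ[k] (D.g : D.Alg) + 1 ⊗ₜ[k] D.y :=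
  D.comulHom_y

theorem counit_y : Coalgebra.counit (R := k) D.y = 0 := D.counitHom_y

/-- The character of the homological integral: `π(v) = χ(v)⁻¹` for group-like `v` and
`π(y) = 0`. -/
noncomputable def π : D.Alg →ₐ[k] k :=
  D.lift D.θU⁻¹ ((D.θU⁻¹ ^ D.n' : kˣ) : k) 0
    (by rw [← Units.val_pow_eq_pow_val, inv_pow, inv_pow, θU_pow]; simp)
    (mul_comm _ _) (by simp) (by simp)
    (by
      rw [zero_pow D.n_pos.ne', ← Units.val_pow_eq_pow_val, inv_pow, pow_mul,
        D.θU_primitive.pow_eq_one]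
      simp)

theorem π_y : D.π D.y = 0 := D.lift_y _ _ _ _ _ _ _ _

theorem π_U (v : D.G) : D.π (D.U v) = ((D.χ v)⁻¹ : kˣ) := by
  have : (Units.map (D.π : D.Alg →* k)).comp D.U = D.χ⁻¹ := by
    apply MonoidHom.ext
    intro v
    rw [D.eq_hG_fG v]
    simp only [map_mul, map_zpow, map_pow, MonoidHom.comp_apply, MonoidHom.inv_apply]
    rw [U_hG, U_fG, χ_hG, χ_fG, ← inv_pow D.θU]
    congr 2
    · exact Units.ext (D.lift_h _ _ _ _ _ _ _ _)
    · exact Units.ext (D.lift_f _ _ _ _ _ _ _ _)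
  exact congrArg Units.val (DFunLike.congr_fun this v)

theorem π_g : D.π D.g = D.ξ⁻¹ := by
  rw [← U_gG, π_U, χ_gG]; simp

theorem windingLeft_U (v : D.G) :
    windingLeft D.π (D.U v) = ((D.χ v)⁻¹ : kˣ) • (D.U v : D.Alg) := by
  change hitLeft D.π.toLinearMap _ = _
  simp [hitLeft, comul_U, π_U, Units.smul_def]

theorem windingLeft_y : windingLeft D.π D.y = D.y := by
  change hitLeft D.π.toLinearMap _ = _
  simp [hitLeft, comul_y, π_y]

theorem windingRight_U (v : D.G) :
    windingRight D.π (D.U v) = ((D.χ v)⁻¹ : kˣ) • (D.U v : D.Alg) := by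
  change hitRight D.π.toLinearMap _ = _
  simp [hitRight, comul_U, π_U, Units.smul_def]

theorem windingRight_y : windingRight D.π D.y = D.ξ⁻¹ • D.y := by
  change hitRight D.π.toLinearMap _ = _
  simp [hitRight, comul_y, π_y, π_g]

theorem windingLeft_basis (v : D.G) (l : Fin D.n) :
    (windingLeft D.π : D.Alg →ₐ[k] D.Alg).toLinearMap ((D.U v : D.Alg) * D.y ^ (l : ℕ)) =
      (((D.χ v)⁻¹ : kˣ) : k) • ((D.U v : D.Alg) * D.y ^ (l : ℕ)) := by
  simp [windingLeft_U, windingLeft_y, Units.smul_def]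

theorem windingRight_basis (v : D.G) (l : Fin D.n) :
    (windingRight D.π : D.Alg →ₐ[k] D.Alg).toLinearMap ((D.U v : D.Alg) * D.y ^ (l : ℕ)) =
      (((D.χ v * D.ξU ^ (l : ℕ))⁻¹ : kˣ) : k) • ((D.U v : D.Alg) * D.y ^ (l : ℕ)) := by
  simp [windingRight_U, windingRight_y, Units.smul_def, smul_pow, smul_smul, mul_comm]

theorem mem_fixed {φ : D.Alg ≃ₐ[k] D.Alg} {t : D.Alg} : t ∈ fixedSubalgebra φ ↔ φ t = t := Iff.rfl

theorem x_zpow_mem {S : Subalgebra k D.Alg} (hx : (D.x : D.Alg) ∈ S)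
    (hx' : ((D.x⁻¹ : D.Algˣ) : D.Alg) ∈ S) (a : ℤ) : (D.U (D.xG ^ a) : D.Alg) ∈ S := by
  rw [map_zpow, U_xG]
  obtain ⟨m, rfl | rfl⟩ := Int.eq_nat_or_neg a
  · rw [zpow_natCast, Units.val_pow_eq_pow_val]; exact pow_mem hx m
  · rw [zpow_neg, zpow_natCast, ← inv_pow, Units.val_pow_eq_pow_val]; exact pow_mem hx' m

theorem windingLeft_x : windingLeft D.π D.x = D.x := by
  rw [← U_xG, windingLeft_U, χ_xG]; simp

theorem windingRight_x : windingRight D.π D.x = D.x := by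
  rw [← U_xG, windingRight_U, χ_xG]; simp

theorem windingLeft_x_inv : windingLeft D.π ((D.x⁻¹ : D.Algˣ) : D.Alg) = (D.x⁻¹ : D.Algˣ) := by
  rw [← U_xG, ← map_inv, windingLeft_U, map_inv, χ_xG]; simp

theorem windingRight_x_inv : windingRight D.π ((D.x⁻¹ : D.Algˣ) : D.Alg) = (D.x⁻¹ : D.Algˣ) := by
  rw [← U_xG, ← map_inv, windingRight_U, map_inv, χ_xG]; simp

theorem windingRight_y_mul : windingRight D.π (D.y * ((D.g⁻¹ : D.Algˣ) : D.Alg)) =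
    D.y * ((D.g⁻¹ : D.Algˣ) : D.Alg) := by
  have := D.ξ_primitive.ne_zero D.n_pos.ne'
  rw [map_mul, windingRight_y, ← U_gG, ← map_inv, windingRight_U, map_inv, χ_gG, inv_inv,
    Units.smul_def, val_ξU, smul_mul_smul_comm, inv_mul_cancel₀ this, one_smul]

theorem fixed_windingLeft : fixedSubalgebra (windingLeft D.π) =
    Algebra.adjoin k {D.y, (D.x : D.Alg), ((D.x⁻¹ : D.Algˣ) : D.Alg)} := by
  apply le_antisymm
  · intro t ht
    rw [← Subalgebra.mem_toSubmodule]
    refine D.mem_of_repr fun v l hv => ?_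
    have h := D.eq_one_of_eigen (a := fun v _ => (((D.χ v)⁻¹ : kˣ) : k))
      D.windingLeft_basis (D.mem_fixed.1 ht) hv
    obtain ⟨a, rfl⟩ := D.exists_xG_zpow (inv_eq_one.1 (Units.ext h))
    rw [Subalgebra.mem_toSubmodule]
    exact mul_mem (D.x_zpow_mem (Algebra.subset_adjoin (by simp)) (Algebra.subset_adjoin (by simp)) a)
      (pow_mem (Algebra.subset_adjoin (by simp)) _)
  · rw [Algebra.adjoin_le_iff]
    rintro t (rfl | rfl | rfl)
    · exact D.windingLeft_y
    · exact D.windingLeft_x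
    · exact D.windingLeft_x_inv

theorem y_mul_g_inv_pow (l : ℕ) : ∃ c : k, c ≠ 0 ∧
    (D.y * ((D.g⁻¹ : D.Algˣ) : D.Alg)) ^ l = c • ((D.U (D.gG⁻¹ ^ l) : D.Alg) * D.y ^ l) := by
  have h := D.y_mul_U D.gG⁻¹
  refine ⟨(D.χ D.gG⁻¹ : k) ^ l * (D.χ D.gG⁻¹ : k) ^ l.choose 2, by simp, ?_⟩
  rw [← U_gG, ← map_inv, h, smul_pow, mul_pow_skew h, smul_smul, map_pow,
    Units.val_pow_eq_pow_val]

/-- The eigenvalue on v yˡ is (χ(v) ξˡ)⁻¹, so invariance puts v gˡ into ⟨x⟩. Then v yˡ = xᵃ g⁻ˡ yˡ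
for some a, which up to a nonzero scalar is xᵃ (y g⁻¹)ˡ. -/
theorem fixed_windingRight : fixedSubalgebra (windingRight D.π) =
    Algebra.adjoin k {D.y * ((D.g⁻¹ : D.Algˣ) : D.Alg), (D.x : D.Alg),
      ((D.x⁻¹ : D.Algˣ) : D.Alg)} := by
  apply le_antisymm
  · intro t ht
    rw [← Subalgebra.mem_toSubmodule]
    refine D.mem_of_repr fun v l hv => ?_
    have h := D.eq_one_of_eigen (a := fun v l => (((D.χ v * D.ξU ^ (l : ℕ))⁻¹ : kˣ) : k))
      D.windingRight_basis (D.mem_fixed.1 ht) hv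
    obtain ⟨a, ha⟩ := D.exists_xG_zpow (v := v * D.gG ^ (l : ℕ)) (by
      rw [map_mul, map_pow, χ_gG]; exact inv_eq_one.1 (Units.ext h))
    obtain ⟨c, hc, h⟩ := D.y_mul_g_inv_pow l
    have hv' : (D.U v : D.Alg) * D.y ^ (l : ℕ) = c⁻¹ • ((D.U (D.xG ^ a) : D.Alg) *
        (D.y * ((D.g⁻¹ : D.Algˣ) : D.Alg)) ^ (l : ℕ)) := by
      rw [h, mul_smul_comm, smul_smul, inv_mul_cancel₀ hc, one_smul, ← mul_assoc, ← Units.val_mul,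
        ← map_mul, ← ha, mul_assoc, ← mul_pow, mul_inv_cancel, one_pow, mul_one]
    rw [hv', Subalgebra.mem_toSubmodule]
    exact Subalgebra.smul_mem _ (mul_mem (D.x_zpow_mem (Algebra.subset_adjoin (by simp))
      (Algebra.subset_adjoin (by simp)) a) (pow_mem (Algebra.subset_adjoin (by simp)) _)) _
  · rw [Algebra.adjoin_le_iff]
    rintro t (rfl | rfl | rfl)
    · exact D.windingRight_y_mul
    · exact D.windingRight_x
    · exact D.windingRight_x_inv

theorem fixed_inf : fixedSubalgebra (windingLeft D.π) ⊓ fixedSubalgebra (windingRight D.π) =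
    Algebra.adjoin k {(D.x : D.Alg), ((D.x⁻¹ : D.Algˣ) : D.Alg)} := by
  apply le_antisymm
  · rintro t ⟨ht, ht'⟩
    rw [← Subalgebra.mem_toSubmodule]
    refine D.mem_of_repr fun v l hv => ?_
    have h := D.eq_one_of_eigen (a := fun v _ => (((D.χ v)⁻¹ : kˣ) : k))
      D.windingLeft_basis (D.mem_fixed.1 ht) hv
    have h' := D.eq_one_of_eigen (a := fun v l => (((D.χ v * D.ξU ^ (l : ℕ))⁻¹ : kˣ) : k))
      D.windingRight_basis (D.mem_fixed.1 ht') hv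
    have h1 := inv_eq_one.1 (Units.ext h)
    have h2 := inv_eq_one.1 (Units.ext h')
    rw [h1, one_mul, D.ξU_primitive.pow_eq_one_iff_dvd] at h2
    obtain ⟨a, rfl⟩ := D.exists_xG_zpow h1
    rw [Nat.eq_zero_of_dvd_of_lt h2 l.2, pow_zero, mul_one]
    exact D.x_zpow_mem (Algebra.subset_adjoin (by simp)) (Algebra.subset_adjoin (by simp)) a
  · rw [Algebra.adjoin_le_iff]
    rintro t (rfl | rfl)
    · exact ⟨D.windingLeft_x, D.windingRight_x⟩
    · exact ⟨D.windingLeft_x_inv, D.windingRight_x_inv⟩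

theorem adjoin_x : Algebra.adjoin k {(D.x : D.Alg), ((D.x⁻¹ : D.Algˣ) : D.Alg)} =
    Subalgebra.center k D.Alg := by
  rw [← range_laurentAlg]
  apply le_antisymm
  · rw [Algebra.adjoin_le_iff]
    rintro t (rfl | rfl)
    · exact ⟨LaurentPolynomial.T 1, by
        change D.laurentAlg _ = _; rw [laurentAlg_T, zpow_one, U_xG]⟩
    · exact ⟨LaurentPolynomial.T (-1), by
        change D.laurentAlg _ = _; rw [laurentAlg_T, zpow_neg_one, map_inv, U_xG]⟩
  · rintro _ ⟨p, rfl⟩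
    have : LinearMap.range D.laurentAlg.toLinearMap ≤ Subalgebra.toSubmodule
        (Algebra.adjoin k {(D.x : D.Alg), ((D.x⁻¹ : D.Algˣ) : D.Alg)}) := by
      rw [LinearMap.range_eq_map, ← (AddMonoidAlgebra.basis ℤ k).span_eq, Submodule.map_span,
        Submodule.span_le]
      rintro _ ⟨_, ⟨a, rfl⟩, rfl⟩
      rw [AddMonoidAlgebra.basis_apply]
      change D.laurentAlg (LaurentPolynomial.T a) ∈ _
      rw [laurentAlg_T]
      exact D.x_zpow_mem (Algebra.subset_adjoin (by simp)) (Algebra.subset_adjoin (by simp)) a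
    exact this ⟨p, rfl⟩

/-! ### Integral order and integral minor -/

theorem convPow_π (m : ℕ) : (∀ v, (WithConv.toConv D.π ^ m).ofConv (D.U v) = (((D.χ v)⁻¹ ^ m : kˣ) : k)) ∧
    (WithConv.toConv D.π ^ m).ofConv D.y = 0 := by
  induction m with
  | zero =>
    rw [pow_zero]
    refine ⟨fun v => ?_, ?_⟩
    · change algebraMap k k (Coalgebra.counit (R := k) (A := D.Alg) _) = _
      rw [counit_U]; simp
    · change algebraMap k k (Coalgebra.counit (R := k) (A := D.Alg) _) = _
      rw [counit_y]; simp
  | succ m ih =>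
    have h := fun t => AlgHom.convMul_apply (WithConv.toConv D.π ^ m) (WithConv.toConv D.π) t
    rw [pow_succ]
    refine ⟨fun v => (h _).trans ?_, (h _).trans ?_⟩
    · simp [comul_U, ih.1, π_U, pow_succ]
    · simp [comul_y, ih.2, π_y]

/-- The value ξ⁻ᵐ of the m-th convolution power at g shows that n divides the order; conversely χⁿ =
1. -/
theorem characterOrder_π : characterOrder D.π = D.n := by
  have key : ∀ m : ℕ, WithConv.toConv D.π ^ m = 1 ↔ D.n ∣ m := by
    intro m
    constructor
    · intro h
      have h1 := (D.convPow_π m).1 D.gG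
      rw [h] at h1
      have h2 : (1 : k) = (((D.χ D.gG)⁻¹ ^ m : kˣ) : k) := by
        rw [← h1]
        change _ = algebraMap k k (Coalgebra.counit (R := k) (A := D.Alg) _)
        rw [counit_U]; simp
      rw [χ_gG, inv_pow] at h2
      exact (D.ξU_primitive.pow_eq_one_iff_dvd m).1 (inv_eq_one.1 (Units.ext h2.symm))
    · rintro ⟨c, rfl⟩
      have h0 := D.convPow_π 0
      have h1 := D.convPow_π (D.n * c)
      rw [← pow_zero (WithConv.toConv D.π)]
      apply WithConv.ofConv_injective
      have hU : ∀ v, (WithConv.toConv D.π ^ (D.n * c)).ofConv (D.U v) =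
          (WithConv.toConv D.π ^ 0).ofConv (D.U v) := by
        intro v
        rw [h0.1, h1.1, pow_mul, inv_pow, χ_pow_n]; simp
      apply D.algHom_ext
      · rw [← U_hG, hU]
      · rw [← U_fG, hU]
      · rw [h0.2, h1.2]
  exact Nat.dvd_antisymm (orderOf_dvd_of_pow_eq_one ((key _).2 dvd_rfl))
    ((key _).1 (pow_orderOf_eq_one _))

theorem windingLeft_pow_U (m : ℕ) (v : D.G) :
    (windingLeft D.π ^ m) (D.U v) = ((D.χ v)⁻¹ ^ m : kˣ) • (D.U v : D.Alg) := by
  induction m with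
  | zero => simp
  | succ m ih =>
    rw [pow_succ', AlgEquiv.mul_apply, ih, Units.smul_def, map_smul, windingLeft_U, Units.smul_def,
      smul_smul, Units.smul_def, pow_succ, Units.val_mul]

theorem windingLeft_pow_y (m : ℕ) : (windingLeft D.π ^ m) D.y = D.y := by
  induction m with
  | zero => simp
  | succ m ih => rw [pow_succ', AlgEquiv.mul_apply, ih, windingLeft_y]

theorem windingRight_pow_y (m : ℕ) : (windingRight D.π ^ m) D.y = (D.ξU⁻¹ ^ m : kˣ) • D.y := by
  induction m with
  | zero => simp
  | succ m ih =>
    rw [pow_succ', AlgEquiv.mul_apply, ih, Units.smul_def, map_smul, windingRight_y,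
      smul_smul, Units.smul_def, pow_succ]
    simp

theorem windingRight_pow_U (m : ℕ) (v : D.G) :
    (windingRight D.π ^ m) (D.U v) = ((D.χ v)⁻¹ ^ m : kˣ) • (D.U v : D.Alg) := by
  induction m with
  | zero => simp
  | succ m ih =>
    rw [pow_succ', AlgEquiv.mul_apply, ih, Units.smul_def, map_smul, windingRight_U, Units.smul_def,
      smul_smul, Units.smul_def, pow_succ, Units.val_mul]

theorem basis_ne_zero (v : D.G) {l : ℕ} (hl : l < D.n) : (D.U v : D.Alg) * D.y ^ l ≠ 0 := by
  have := D.basisK.ne_zero (v, ⟨l, hl⟩)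
  rwa [basisK_apply] at this

theorem y_ne_zero : D.y ≠ 0 := by
  have := D.basis_ne_zero 1 D.one_lt_n
  simpa using this

theorem windingLeft_pow_n : windingLeft D.π ^ D.n = 1 := by
  have hU : ∀ v, (windingLeft D.π ^ D.n) (D.U v) = D.U v := fun v => by
    rw [windingLeft_pow_U, inv_pow, χ_pow_n]; simp
  have : ((windingLeft D.π ^ D.n : D.Alg ≃ₐ[k] D.Alg) : D.Alg →ₐ[k] D.Alg) = AlgHom.id k _ := by
    apply D.algHom_ext
    · rw [← U_hG]; exact hU _
    · rw [← U_fG]; exact hU _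
    · exact D.windingLeft_pow_y _
  exact AlgEquiv.ext fun t => DFunLike.congr_fun this t

theorem windingRight_pow_n : windingRight D.π ^ D.n = 1 := by
  have hU : ∀ v, (windingRight D.π ^ D.n) (D.U v) = D.U v := fun v => by
    rw [windingRight_pow_U, inv_pow, χ_pow_n]; simp
  have : ((windingRight D.π ^ D.n : D.Alg ≃ₐ[k] D.Alg) : D.Alg →ₐ[k] D.Alg) = AlgHom.id k _ := by
    apply D.algHom_ext
    · rw [← U_hG]; exact hU _
    · rw [← U_fG]; exact hU _
    · refine (D.windingRight_pow_y _).trans ?_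
      rw [inv_pow, D.ξU_primitive.pow_eq_one]; simp
  exact AlgEquiv.ext fun t => DFunLike.congr_fun this t

theorem units_smul_eq_self {c : kˣ} {t : D.Alg} (ht : t ≠ 0) (h : c • t = t) : c = 1 := by
  rw [Units.smul_def] at h
  have : (c : k) • t = (1 : k) • t := by rw [h, one_smul]
  exact Units.ext (smul_left_injective k ht this)

/-- The left winding automorphism fixes y and scales g by ξ⁻¹, so it has order n. The right one
scales y by ξ⁻¹: a power of it that is also a power of the left one fixes y, its exponent is a
multiple of n, and it is trivial. The two cyclic groups thus meet trivially. -/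
theorem windingIndex_π : windingIndex D.π = D.n := by
  have h1 : orderOf (windingLeft D.π) = D.n := by
    refine Nat.dvd_antisymm (orderOf_dvd_of_pow_eq_one D.windingLeft_pow_n) ?_
    have h := D.windingLeft_pow_U (orderOf (windingLeft D.π)) D.gG
    rw [pow_orderOf_eq_one, χ_gG, inv_pow, AlgEquiv.one_apply] at h
    exact (D.ξU_primitive.pow_eq_one_iff_dvd _).1
      (inv_eq_one.1 (D.units_smul_eq_self (Units.ne_zero _) h.symm))
  have h2 : Subgroup.zpowers (windingRight D.π) ⊓ Subgroup.zpowers (windingLeft D.π) = ⊥ := by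
    rw [eq_bot_iff]
    rintro φ ⟨hr, hl⟩
    have fin : ∀ ψ : D.Alg ≃ₐ[k] D.Alg, ψ ^ D.n = 1 → φ ∈ Subgroup.zpowers ψ →
        ∃ m : ℕ, ψ ^ m = φ := by
      intro ψ hψ hφ
      have := (isOfFinOrder_iff_pow_eq_one.2 ⟨_, D.n_pos, hψ⟩).mem_powers_iff_mem_zpowers.2 hφ
      exact this
    obtain ⟨i, rfl⟩ := fin _ D.windingRight_pow_n hr
    obtain ⟨j, hj⟩ := fin _ D.windingLeft_pow_n hl
    have h3 := D.windingRight_pow_y i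
    rw [← hj, windingLeft_pow_y] at h3
    have h4 := inv_eq_one.1 ((inv_pow D.ξU i) ▸ D.units_smul_eq_self D.y_ne_zero h3.symm)
    obtain ⟨m, rfl⟩ := (D.ξU_primitive.pow_eq_one_iff_dvd _).1 h4
    rw [Subgroup.mem_bot, pow_mul, windingRight_pow_n, one_pow]
  rw [windingIndex, ← Subgroup.inf_relIndex_right, h2, Subgroup.relIndex_bot_left,
    Nat.card_zpowers, h1]

/-! ### Group-like and skew-primitive elements -/

/-- The index `0` or `1` in `Fin n`. -/
abbrev i₁ : Fin D.n := ⟨1, D.one_lt_n⟩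

/-- The summands y ⊗ g and 1 ⊗ y of Δ(y) commute up to ξ, so the q-binomial theorem applies. -/
theorem comul_U_mul_y_pow (v : D.G) (l : ℕ) :
    Coalgebra.comul (R := k) ((D.U v : D.Alg) * D.y ^ l) = ∑ j ∈ Finset.range (l + 1),
      gauss D.ξ l j • (((D.U v : D.Alg) * D.y ^ j) ⊗ₜ[k]
        ((D.U (v * D.gG ^ j) : D.Alg) * D.y ^ (l - j))) := by
  rw [Bialgebra.comul_mul, Bialgebra.comul_pow, comul_U, comul_y, add_pow_gauss (q := D.ξ),
    Finset.mul_sum]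
  · refine Finset.sum_congr rfl fun j _ => ?_
    rw [mul_smul_comm, Algebra.TensorProduct.tmul_pow, Algebra.TensorProduct.tmul_pow,
      Algebra.TensorProduct.tmul_mul_tmul, Algebra.TensorProduct.tmul_mul_tmul, one_pow, mul_one,
      ← mul_assoc, map_mul, map_pow, U_gG, Units.val_mul, Units.val_pow_eq_pow_val]
  · simp only [Algebra.TensorProduct.tmul_mul_tmul, one_mul, mul_one, y_mul_g,
      TensorProduct.tmul_smul]

/-- The coordinate of a tensor with respect to the basis `v yˡ`. -/
noncomputable def coord₂ (p q : D.G × Fin D.n) : D.Alg ⊗[k] D.Alg →ₗ[k] k :=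
  LinearMap.mul' k k ∘ₗ TensorProduct.map (D.basisK.coord p) (D.basisK.coord q)

theorem coord₂_tmul (p q : D.G × Fin D.n) (a c : D.Alg) :
    D.coord₂ p q (a ⊗ₜ c) = D.basisK.repr a p * D.basisK.repr c q := by
  simp [coord₂]

theorem repr_U_mul_y_pow (v v' : D.G) (i : Fin D.n) {j : ℕ} (hj : j < D.n) :
    D.basisK.repr ((D.U v : D.Alg) * D.y ^ j) (v', i) = if v = v' ∧ j = i then 1 else 0 := by
  have := D.basisK_apply v ⟨j, hj⟩
  simp only at this
  rw [← this, Module.Basis.repr_self, Finsupp.single_apply]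
  simp [Prod.ext_iff, Fin.ext_iff]

/-- The tensor v yⁱ ⊗ v' yʲ occurs in the coproduct of at most one basis element, v yⁱ⁺ʲ, and there
only for v' = v gⁱ. Hence every coefficient of a coproduct is a multiple of a single coefficient of
the element. -/
theorem coord₂_comul (t : D.Alg) (v v' : D.G) (i j : Fin D.n) :
    D.coord₂ (v, i) (v', j) (Coalgebra.comul (R := k) t) =
      if h : (i + j : ℕ) < D.n ∧ v' = v * D.gG ^ (i : ℕ) then
        gauss D.ξ (i + j) i * D.basisK.repr t (v, ⟨i + j, h.1⟩) else 0 := by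
  have key : D.coord₂ (v, i) (v', j) ∘ₗ Coalgebra.comul (R := k) =
      if h : (i + j : ℕ) < D.n ∧ v' = v * D.gG ^ (i : ℕ) then
        gauss D.ξ (i + j) i • D.basisK.coord (v, ⟨i + j, h.1⟩) else 0 := by
    refine D.basisK.ext fun ⟨u, l⟩ => ?_
    have h1 : (if h : (i + j : ℕ) < D.n ∧ v' = v * D.gG ^ (i : ℕ) then
        gauss D.ξ (i + j) i • D.basisK.coord (v, ⟨i + j, h.1⟩) else 0) (D.basisK (u, l)) =
        if (i + j : ℕ) = l ∧ v' = v * D.gG ^ (i : ℕ) ∧ u = v then gauss D.ξ l i else 0 := by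
      split_ifs with h h' h'
      · obtain ⟨h1, h2, rfl⟩ := h'
        simp [h1]
      · have : ((u, l) : D.G × Fin D.n) ≠ (v, ⟨i + j, h.1⟩) := by
          intro h3
          obtain ⟨h4, h5⟩ := Prod.ext_iff.1 h3
          exact h' ⟨(congrArg Fin.val h5).symm, h.2, h4⟩
        simp [Finsupp.single_eq_of_ne (Ne.symm this)]
      · exact absurd ⟨h'.1 ▸ l.2, h'.2.1⟩ h
      · rfl
    rw [h1, LinearMap.comp_apply, basisK_apply, comul_U_mul_y_pow, map_sum]
    have h2 : ∀ m ∈ Finset.range ((l : ℕ) + 1), D.coord₂ (v, i) (v', j)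
        (gauss D.ξ l m • (((D.U u : D.Alg) * D.y ^ m) ⊗ₜ[k]
          ((D.U (u * D.gG ^ m) : D.Alg) * D.y ^ ((l : ℕ) - m)))) =
        if m = i then (if (i + j : ℕ) = l ∧ v' = v * D.gG ^ (i : ℕ) ∧ u = v then
          gauss D.ξ l i else 0) else 0 := by
      intro m hm
      have hm' := Finset.mem_range.1 hm
      have hl := l.2
      rw [map_smul, coord₂_tmul, D.repr_U_mul_y_pow _ _ _ (by omega),
        D.repr_U_mul_y_pow _ _ _ (by omega)]
      by_cases hmi : m = i
      · subst hmi
        by_cases huv : u = v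
        · subst huv
          by_cases hv' : v' = u * D.gG ^ (i : ℕ)
          · have : (l - i : ℕ) = j ↔ (i + j : ℕ) = l := by omega
            simp [hv', this]
          · simp [hv', Ne.symm hv']
        · simp [huv]
      · simp [hmi]
    rw [Finset.sum_congr rfl h2, Finset.sum_ite_eq']
    split_ifs with h3 h4 h4
    · rfl
    · rfl
    · exact absurd (Finset.mem_range.2 (by omega)) h3
    · rfl
  have := LinearMap.congr_fun key t
  rw [LinearMap.comp_apply] at this
  rw [this]
  split_ifs <;> rfl

/-- If v yⁱ occurs in `a` with i maximal, the coefficient of v yⁱ ⊗ v yⁱ in a ⊗ a is a nonzero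
square, so v y²ⁱ occurs as well and i = 0. The remaining coefficients are idempotent and pairwise
orthogonal, whence exactly one is 1. -/
theorem eq_U_of_isGroupLike {a : D.Alg} (ha : IsGroupLikeElem k a) : ∃ v, a = D.U v := by
  have h0 : D.basisK.repr a ≠ 0 := by
    rw [Ne, LinearEquiv.map_eq_zero_iff]
    exact ha.ne_zero
  have h1 : ∀ v v' i j, D.basisK.repr a (v, i) * D.basisK.repr a (v', j) =
      if h : (i + j : ℕ) < D.n ∧ v' = v * D.gG ^ (i : ℕ) then
        gauss D.ξ (i + j) i * D.basisK.repr a (v, ⟨i + j, h.1⟩) else 0 := by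
    intro v v' i j
    rw [← coord₂_comul, ha.comul_eq_tmul_self, coord₂_tmul]
  obtain ⟨⟨v, i⟩, hv, hmax⟩ := Finset.exists_max_image (D.basisK.repr a).support
    (fun p => (p.2 : ℕ)) (Finsupp.support_nonempty_iff.2 h0)
  rw [Finsupp.mem_support_iff] at hv
  have hi : (i : ℕ) = 0 := by
    have h2 := h1 v v i i
    split_ifs at h2 with h
    · have h3 : D.basisK.repr a (v, ⟨i + i, h.1⟩) ≠ 0 := by
        intro h4
        rw [h4, mul_zero] at h2
        exact hv (mul_self_eq_zero.1 h2)
      have := hmax _ (Finsupp.mem_support_iff.2 h3)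
      simp only at this
      omega
    · exact absurd (mul_self_eq_zero.1 h2) hv
  have hi' : i = 0 := Fin.ext hi
  subst hi'
  have hv1 : D.basisK.repr a (v, 0) = 1 := by
    have h2 := h1 v v 0 0
    rw [dif_pos ⟨by simpa using D.n_pos, by simp⟩] at h2
    have h3 : gauss D.ξ ((0 : Fin D.n) + (0 : Fin D.n) : ℕ) (0 : Fin D.n) = 1 := by simp [gauss]
    rw [h3, one_mul] at h2
    exact mul_right_cancel₀ hv (by simpa using h2)
  refine ⟨v, D.basisK.ext_elem fun ⟨v', j⟩ => ?_⟩
  have h3 := D.repr_U_mul_y_pow v v' j D.n_pos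
  rw [pow_zero, mul_one] at h3
  rw [h3]
  by_cases hj : (j : ℕ) = 0
  · obtain rfl : j = 0 := Fin.ext hj
    by_cases hvv : v = v'
    · subst hvv; simp [hv1]
    · have h2 := h1 v v' 0 0
      rw [dif_neg (by simpa using fun _ => Ne.symm hvv), hv1, one_mul] at h2
      simp [h2, hvv]
  · rw [if_neg (fun h => hj h.2.symm)]
    by_contra h4
    exact hj (by simpa using hmax _ (Finsupp.mem_support_iff.2 h4))

theorem U_injective : Function.Injective D.U := by
  intro v v' h
  have h1 := D.repr_U_mul_y_pow v v' 0 D.n_pos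
  rw [h, D.repr_U_mul_y_pow v' v' 0 D.n_pos] at h1
  by_contra h2
  simp [h2] at h1

/-- The group of group-like elements is `C_∞ × C_b`. -/
noncomputable def groupLikeEquiv : D.G ≃* GroupLike k D.Alg :=
  MulEquiv.ofBijective
    ({ toFun := fun v => ⟨D.U v, D.isGroupLike_U v⟩
       map_one' := by ext; simp
       map_mul' := fun v v' => by ext; simp } : D.G →* GroupLike k D.Alg)
    ⟨fun v v' h => D.U_injective (Units.ext (congrArg GroupLike.val h)), fun a => by
      obtain ⟨v, hv⟩ := D.eq_U_of_isGroupLike a.isGroupLikeElem_val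
      exact ⟨v, by ext; exact hv.symm⟩⟩

theorem val_groupLikeEquiv (v : D.G) : (D.groupLikeEquiv v : D.Alg) = D.U v := rfl

/-- The coefficient is (1 - ξˡ)/(1 - ξ), by `gauss_step`. -/
theorem gauss_one_ne_zero {l : ℕ} (hl : 0 < l) (hln : l < D.n) : gauss D.ξ l 1 ≠ 0 := by
  have := gauss_step D.ξ l 0
  intro h
  rw [zero_add, h, mul_zero, pow_zero] at this
  have h1 : gauss D.ξ l 0 = 1 := by cases l <;> rfl
  rw [h1, mul_one] at this
  exact D.ξ_primitive.pow_ne_one_of_pos_of_lt hl.ne' hln (sub_eq_zero.1 this.symm).symm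

/-- Both sides of Δ(z) = z ⊗ v + 1 ⊗ z are compared on basis tensors. The tensor u y ⊗ u g yˡ⁻¹ is
absent on the right for l ≥ 2, so degrees above 1 vanish. In degree 1, u ⊗ u y forces u = 1, and y ⊗
g forces v = g. In degree 0 only 1 and v survive, with opposite coefficients because of 1 ⊗ v. -/
theorem skewPrimitive_eq {v : D.G} (hv : v ≠ 1) {z : D.Alg}
    (hz : Coalgebra.comul (R := k) z = z ⊗ₜ[k] (D.U v : D.Alg) + 1 ⊗ₜ[k] z) :
    ∃ c d : k, z = c • D.y + d • (1 - (D.U v : D.Alg)) ∧ (c ≠ 0 → v = D.gG) := by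
  have hU := fun v v' i => D.repr_U_mul_y_pow v v' i D.n_pos
  simp only [pow_zero, mul_one] at hU
  have h1 := hU 1
  simp only [map_one, Units.val_one] at h1
  have key : ∀ (u u' : D.G) (i j : Fin D.n), D.basisK.repr z (u, i) * (if v = u' ∧ 0 = (j : ℕ) then 1 else 0) +
      (if 1 = u ∧ 0 = (i : ℕ) then 1 else 0) * D.basisK.repr z (u', j) =
      if h : (i + j : ℕ) < D.n ∧ u' = u * D.gG ^ (i : ℕ) then
        gauss D.ξ (i + j) i * D.basisK.repr z (u, ⟨i + j, h.1⟩) else 0 := by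
    intro u u' i j
    rw [← coord₂_comul, hz, map_add, coord₂_tmul, coord₂_tmul, hU, h1]
  have hn := D.one_lt_n
  have hz2 : ∀ (u : D.G) (l : Fin D.n), 2 ≤ (l : ℕ) → D.basisK.repr z (u, l) = 0 := by
    intro u l hl
    have hl' := l.2
    have h := key u (u * D.gG) D.i₁ ⟨l - 1, by omega⟩
    have e : (⟨(D.i₁ : ℕ) + (⟨l - 1, by omega⟩ : Fin D.n), by simp only; omega⟩ : Fin D.n) = l :=
      Fin.ext (by simp only; omega)
    rw [dif_pos ⟨by simp only; omega, by simp⟩, e, if_neg (by simp; omega),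
      if_neg (by simp), mul_zero, zero_mul, add_zero] at h
    have e' : ((D.i₁ : ℕ) + (⟨l - 1, by omega⟩ : Fin D.n) : ℕ) = l := congrArg Fin.val e
    rw [e'] at h
    exact (mul_eq_zero.1 h.symm).resolve_left (D.gauss_one_ne_zero (by omega) hl')
  have hz1 : ∀ u : D.G, D.basisK.repr z (u, D.i₁) ≠ 0 → u = 1 ∧ v = D.gG := by
    intro u hu
    have ha := key u u 0 D.i₁
    have hb := key u (u * D.gG) D.i₁ 0
    have e1 : (⟨((0 : Fin D.n) : ℕ) + (D.i₁ : ℕ), by simpa using hn⟩ : Fin D.n) = D.i₁ :=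
      Fin.ext (by simp)
    have e2 : (⟨(D.i₁ : ℕ) + ((0 : Fin D.n) : ℕ), by simpa using hn⟩ : Fin D.n) = D.i₁ :=
      Fin.ext (by simp)
    rw [dif_pos ⟨by simpa using hn, by simp⟩, e1] at ha
    rw [dif_pos ⟨by simpa using hn, by simp⟩, e2] at hb
    simp only [Fin.val_zero, zero_add, add_zero, gauss, and_true] at ha hb
    have hu1 : u = 1 := by
      by_contra hu1
      simp [Ne.symm hu1] at ha
      exact hu ha.symm
    subst hu1
    refine ⟨rfl, ?_⟩
    by_contra hvg
    simp [hvg] at hb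
    exact hu hb.symm
  have hz0 : ∀ u : D.G, u ≠ 1 → u ≠ v → D.basisK.repr z (u, 0) = 0 := by
    intro u hu1 huv
    have h := key u u 0 0
    rw [dif_pos ⟨by simpa using D.n_pos, by simp⟩] at h
    simp [Ne.symm hu1, Ne.symm huv, gauss] at h
    exact h.symm
  have hz01 : D.basisK.repr z (1, 0) + D.basisK.repr z (v, 0) = 0 := by
    have h := key 1 v 0 0
    rw [dif_neg (by simp [hv])] at h
    simpa using h
  refine ⟨D.basisK.repr z (1, D.i₁), D.basisK.repr z (1, 0), D.basisK.ext_elem fun ⟨u, l⟩ => ?_,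
    fun h => (hz1 1 h).2⟩
  have hy := D.repr_U_mul_y_pow 1 u l D.one_lt_n
  rw [map_one, Units.val_one, one_mul, pow_one] at hy
  simp only [map_add, map_smul, map_sub, Finsupp.add_apply, Finsupp.smul_apply, Finsupp.sub_apply,
    hy, hU, h1, smul_eq_mul]
  rcases lt_trichotomy (l : ℕ) 1 with hl | hl | hl
  · obtain rfl : l = 0 := Fin.ext (by simpa using hl)
    by_cases hu : u = 1
    · subst hu; simp [hv]
    · by_cases huv : u = v
      · subst huv
        simp [Ne.symm hv]
        linear_combination hz01
      · simp [Ne.symm hu, Ne.symm huv, hz0 u hu huv]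
  · obtain rfl : l = D.i₁ := Fin.ext hl
    by_cases hu : u = 1
    · subst hu; simp
    · have : D.basisK.repr z (u, D.i₁) = 0 := by
        by_contra h
        exact hu (hz1 u h).1
      simp [this, Ne.symm hu]
  · rw [hz2 u l hl, if_neg (by omega), if_neg (by omega), if_neg (by omega)]
    simp

theorem skewPrimitive {a z : D.Alg} (ha : IsGroupLikeElem k a) (ha1 : a ≠ 1)
    (hz : Coalgebra.comul (R := k) z = z ⊗ₜ[k] a + 1 ⊗ₜ[k] z)
    (hz' : z ∉ Submodule.span k {1 - a}) :
    a = D.g ∧ z ∈ Submodule.span k {D.y, 1 - (D.g : D.Alg)} := by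
  obtain ⟨v, rfl⟩ := D.eq_U_of_isGroupLike ha
  obtain ⟨c, d, rfl, h⟩ := D.skewPrimitive_eq (fun h => ha1 (by rw [h]; simp)) hz
  have hc : c ≠ 0 := by
    rintro rfl
    exact hz' (by rw [zero_smul, zero_add]
                  exact Submodule.smul_mem _ _ (Submodule.mem_span_singleton_self _))
  obtain rfl := h hc
  rw [U_gG]
  exact ⟨rfl, Submodule.mem_span_pair.2 ⟨c, d, rfl⟩⟩

/-! ### Rigidity under Hopf algebra isomorphisms -/

theorem gG_ne_one : D.gG ≠ 1 := by
  intro h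
  have := D.χ_gG
  rw [h, map_one] at this
  exact D.ξU_primitive.ne_one D.one_lt_n this.symm

theorem xG_pow_w_ne_one : D.xG ^ D.w ≠ 1 := by
  intro h
  have : D.xG ^ (D.w : ℤ) = D.xG ^ (0 : ℤ) := by rw [zpow_natCast, h, zpow_zero]
  have := D.xG_zpow_injective this
  exact D.w_pos.ne' (by exact_mod_cast this)

/-- The image of x is group-like and central, and a group element commuting with y lies in ker χ =
⟨x⟩. -/
theorem exists_map_U_xG {D D' : LiuDatum k} (φ : D'.Alg ≃ₐc[k] D.Alg) :
    ∃ a : ℤ, φ (D'.U D'.xG) = D.U (D.xG ^ a) := by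
  obtain ⟨u, hu⟩ := D.eq_U_of_isGroupLike ((D'.isGroupLike_U D'.xG).map φ)
  have hc : D.y * D.U u = D.U u * D.y := by
    obtain ⟨t, ht⟩ := EquivLike.surjective φ D.y
    rw [← hu, ← ht, ← map_mul, ← map_mul, U_xG, x_comm]
  rw [y_mul_U] at hc
  have h2 := D.basis_ne_zero u D.one_lt_n
  rw [pow_one] at h2
  obtain ⟨a, rfl⟩ := D.exists_xG_zpow (D.units_smul_eq_self h2 (by rw [Units.smul_def]; exact hc))
  exact ⟨a, hu⟩

/-- The image of y is skew-primitive with respect to the image of g and nontrivial, so the image of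
g is g and that of y is η y + μ (1 - g). In the relation y g = ξ g y the coefficient of g y
identifies the two values of ξ, and the coefficient of g gives (1 - ξ) μ = 0. Finally yⁿ = 1 - gⁿ
with gⁿ ≠ 1 gives ηⁿ = 1. -/
theorem iso_invariants (D' : LiuDatum k) (φ : D'.Alg ≃ₐc[k] D.Alg) :
    D'.n = D.n ∧ D'.w = D.w ∧ D'.ξ = D.ξ ∧
      φ D'.x = D.x ∧ φ D'.g = D.g ∧ ∃ η : k, η ^ D.n = 1 ∧ φ D'.y = η • D.y := by
  have hgl : ∀ v : D'.G, ∃ v', φ (D'.U v) = D.U v' := fun v =>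
    D.eq_U_of_isGroupLike ((D'.isGroupLike_U v).map φ)
  obtain ⟨v, hv⟩ := hgl D'.gG
  have hv1 : v ≠ 1 := by
    rintro rfl
    rw [map_one, Units.val_one, ← map_one φ] at hv
    have h1 := EquivLike.injective φ hv
    exact D'.gG_ne_one (D'.U_injective (Units.ext (by rw [h1]; simp)))
  have hz : Coalgebra.comul (R := k) (φ D'.y) =
      φ D'.y ⊗ₜ[k] (D.U v : D.Alg) + 1 ⊗ₜ[k] φ D'.y := by
    rw [← CoalgHomClass.map_comp_comul_apply, comul_y, map_add, TensorProduct.map_tmul,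
      TensorProduct.map_tmul, ← U_gG]
    simp [hv]
  obtain ⟨η, μ, hy, hg⟩ := D.skewPrimitive_eq hv1 hz
  have hη : η ≠ 0 := by
    rintro rfl
    rw [zero_smul, zero_add, ← hv] at hy
    have h1 : D'.y = μ • (1 - (D'.U D'.gG : D'.Alg)) := EquivLike.injective φ (by
      rw [hy]; simp)
    have h2 := congrArg (fun t => D'.basisK.repr t (1, D'.i₁)) h1
    have e1 := D'.repr_U_mul_y_pow 1 1 D'.i₁ D'.one_lt_n
    have e2 := D'.repr_U_mul_y_pow 1 1 D'.i₁ D'.n_pos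
    have e3 := D'.repr_U_mul_y_pow D'.gG 1 D'.i₁ D'.n_pos
    simp only [map_one, Units.val_one, one_mul, pow_one, pow_zero, mul_one] at e1 e2 e3
    simp [e1, e2, e3] at h2
  obtain rfl := hg hη
  have hgg : φ D'.g = D.g := by rw [← U_gG, hv, U_gG]
  have hyg := congrArg φ D'.y_mul_g
  rw [map_mul, map_smul, map_mul, hgg, hy, U_gG] at hyg
  have hyg' : (η * D.ξ) • ((D.U D.gG : D.Alg) * D.y) + μ • (D.U D.gG : D.Alg) - μ • (D.U (D.gG ^ 2) : D.Alg) =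
      (η * D'.ξ) • ((D.U D.gG : D.Alg) * D.y) + (D'.ξ * μ) • (D.U D.gG : D.Alg) -
        (D'.ξ * μ) • (D.U (D.gG ^ 2) : D.Alg) := by
    rw [map_pow, U_gG, Units.val_pow_eq_pow_val]
    simp only [add_mul, mul_add, smul_mul_assoc, mul_smul_comm, sub_mul, mul_sub, one_mul, mul_one,
      y_mul_g, smul_add, smul_sub, smul_smul, ← pow_two] at hyg
    rw [mul_comm η D'.ξ, add_sub_assoc, add_sub_assoc]
    exact hyg
  have e1 := fun u j => D.repr_U_mul_y_pow D.gG u j D.one_lt_n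
  have e2 := fun u j => D.repr_U_mul_y_pow D.gG u j D.n_pos
  have e3 := fun u j => D.repr_U_mul_y_pow (D.gG ^ 2) u j D.n_pos
  simp only [pow_one, pow_zero, mul_one] at e1 e2 e3
  have hξ : D'.ξ = D.ξ := by
    have h := congrArg (fun t => D.basisK.repr t (D.gG, D.i₁)) hyg'
    simp only [map_add, map_sub, map_smul, Finsupp.add_apply, Finsupp.sub_apply,
      Finsupp.smul_apply, e1, e2, e3] at h
    simp at h
    exact (h.resolve_right hη).symm
  have hμ : μ = 0 := by
    have h := congrArg (fun t => D.basisK.repr t (D.gG, 0)) hyg'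
    have : D.gG ^ 2 ≠ D.gG := by
      rw [pow_two]; simpa using D.gG_ne_one
    simp only [map_add, map_sub, map_smul, Finsupp.add_apply, Finsupp.sub_apply,
      Finsupp.smul_apply, e1, e2, e3] at h
    simp [this] at h
    have h' : (1 - D'.ξ) * μ = 0 := by linear_combination h
    exact (mul_eq_zero.1 h').resolve_left (sub_ne_zero.2 (D'.ξ_primitive.ne_one D'.one_lt_n).symm)
  have hn : D'.n = D.n := (hξ ▸ D'.ξ_primitive).unique D.ξ_primitive
  rw [hμ, zero_smul, add_zero] at hy
  have hηn : η ^ D.n = 1 := by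
    have h := congrArg φ D'.y_pow_n_x
    rw [x_pow_w, hn, map_pow, hy, map_sub, map_one, map_pow, hgg, smul_pow, y_pow_n_x,
      x_pow_w] at h
    have h' : (η ^ D.n - 1) • (1 - (D.U (D.gG ^ D.n) : D.Alg)) = 0 := by
      rw [map_pow, U_gG, Units.val_pow_eq_pow_val, sub_smul, one_smul, h, sub_self]
    refine sub_eq_zero.1 ((smul_eq_zero.1 h').resolve_right fun h0 => ?_)
    refine D.xG_pow_w_ne_one (D.U_injective (Units.ext ?_))
    rw [map_one, ← gG_pow_n]
    exact (sub_eq_zero.1 h0).symm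
  -- Now x goes to xᵃ; the inverse isomorphism shows a = ±1, and xʷ = gⁿ gives a `D'.w` = `D.w`.
  -- Positivity of both numbers excludes a = -1.
  obtain ⟨a, ha⟩ := exists_map_U_xG φ
  obtain ⟨a', ha'⟩ := exists_map_U_xG φ.symm
  have haa : a * a' = 1 := by
    have h := congrArg φ ha'
    have h1 : φ (D'.U (D'.xG ^ a')) = D.U (D.xG ^ (a * a')) := by
      have h2 : Units.map (φ : D'.Alg →* D.Alg) (D'.U D'.xG) = D.U (D.xG ^ a) := Units.ext ha
      have h3 := congrArg (fun t => ((t ^ a' : D.Algˣ) : D.Alg)) h2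
      simp only [← map_zpow, ← zpow_mul] at h3
      exact h3
    rw [h1] at h
    have h4 : φ (φ.symm (D.U D.xG : D.Alg)) = D.U D.xG := EquivLike.right_inv φ _
    rw [h4] at h
    refine (D.xG_zpow_injective (?_ : D.xG ^ (1 : ℤ) = D.xG ^ (a * a'))).symm
    rw [zpow_one]
    exact D.U_injective (Units.ext h)
  have haw : a * D'.w = D.w := by
    have h := congrArg φ D'.x_pow_w
    rw [map_pow, map_pow, hgg, hn, ← x_pow_w, ← U_xG, ha, ← U_xG] at h
    refine D.xG_zpow_injective (?_ : D.xG ^ (a * (D'.w : ℤ)) = D.xG ^ (D.w : ℤ))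
    refine D.U_injective (Units.ext ?_)
    rw [zpow_mul, zpow_natCast, zpow_natCast, map_pow, map_pow, Units.val_pow_eq_pow_val,
      Units.val_pow_eq_pow_val]
    exact h
  have hw := D.w_pos
  have hw' := D'.w_pos
  obtain rfl : a = 1 := by
    rcases Int.eq_one_or_neg_one_of_mul_eq_one haa with h | h
    · exact h
    · subst h; omega
  refine ⟨hn, by omega, hξ, ?_, hgg, η, hηn, hy⟩
  rw [← U_xG, ha, zpow_one, U_xG]

end LiuDatum

/-! ### Matrices with nilpotent entries -/

/-- The finitely many entries generate a nilpotent ideal I, and the entries of Mᵐ lie in Iᵐ. -/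
theorem Matrix.isNilpotent_of_forall {ι C : Type*} [Fintype ι] [DecidableEq ι] [CommRing C]
    {M : Matrix ι ι C} (h : ∀ i j, IsNilpotent (M i j)) : IsNilpotent M := by
  let I : Ideal C := Ideal.span (Set.range fun p : ι × ι => M p.1 p.2)
  have hI : IsNilpotent I := by
    rw [Ideal.FG.isNilpotent_iff_le_nilradical (Submodule.fg_span (Set.finite_range _)),
      Ideal.span_le]
    rintro _ ⟨p, rfl⟩
    exact h _ _
  obtain ⟨K, hK⟩ := hI
  have key : ∀ (m : ℕ) (i j : ι), (M ^ m) i j ∈ I ^ m := by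
    intro m
    induction m with
    | zero => intro i j; simp
    | succ m ih =>
      intro i j
      rw [pow_succ, pow_succ, Matrix.mul_apply]
      exact Submodule.sum_mem _ fun l _ => Ideal.mul_mem_mul (ih i l) (Ideal.subset_span ⟨(l, j), rfl⟩)
  refine ⟨K, Matrix.ext fun i j => ?_⟩
  have := key K i j
  rw [hK] at this
  simpa using this

/-- The characteristic polynomial of a nilpotent matrix differs from a power of X by nilpotent
coefficients; over a reduced ring it equals that power, and Cayley-Hamilton applies. -/
theorem Matrix.pow_card_eq_zero {ι C : Type*} [Fintype ι] [DecidableEq ι] [CommRing C] [IsReduced C]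
    {M : Matrix ι ι C} (h : IsNilpotent M) : M ^ Fintype.card ι = 0 := by
  have h1 : M.charpoly - Polynomial.X ^ Fintype.card ι = 0 := Polynomial.ext fun i =>
    (Polynomial.isNilpotent_iff.1 (Matrix.isNilpotent_charpoly_sub_pow_of_isNilpotent h) i).eq_zero
  have h2 := M.aeval_self_charpoly
  rw [sub_eq_zero.1 h1] at h2
  simpa using h2

/-- This is the reduced case applied modulo the nilradical. -/
theorem Matrix.isNilpotent_pow_card_apply {ι C : Type*} [Fintype ι] [DecidableEq ι] [CommRing C]
    {M : Matrix ι ι C} (h : IsNilpotent M) (i j : ι) : IsNilpotent ((M ^ Fintype.card ι) i j) := by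
  let f := Ideal.Quotient.mk (nilradical C)
  have : IsReduced (C ⧸ nilradical C) :=
    (Ideal.isRadical_iff_quotient_reduced _).1 (Ideal.radical_isRadical _)
  have h1 := Matrix.pow_card_eq_zero (h.map f.mapMatrix)
  rw [← map_pow] at h1
  have h2 := congrFun (congrFun h1 i) j
  exact mem_nilradical.1 (Ideal.Quotient.eq_zero_iff_mem.1 h2)

namespace LiuDatum

variable {k : Type u} [Field k] (D : LiuDatum k)

/-! ### Primeness and PI-degree -/

/-- The faithful representation on the group algebra by linear maps over the centre. -/
noncomputable def repP : D.Alg →+* Module.End k[T;T⁻¹] D.R where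
  toFun t :=
    { toFun := D.rep _ D.N_one_sub_gG t
      map_add' := map_add _
      map_smul' := fun p r => by
        have h : ∀ r, p • r = D.rep _ D.N_one_sub_gG (D.incl (D.laurentHom p)) r := fun r => by
          rw [rep_incl]; rfl
        rw [RingHom.id_apply, h, h, ← Module.End.mul_apply, ← Module.End.mul_apply, ← map_mul,
          ← map_mul, incl_laurentHom_comm] }
  map_one' := by ext; simp
  map_mul' a c := by ext; simp
  map_zero' := by ext; simp
  map_add' a c := by ext; simp

theorem repP_apply (t : D.Alg) (r : D.R) : D.repP t r = D.rep _ D.N_one_sub_gG t r := rfl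

/-- The embedding into `n × n` matrices over the Laurent polynomials. -/
noncomputable def toMat : D.Alg →+* Matrix (Fin D.n) (Fin D.n) k[T;T⁻¹] :=
  (LinearMap.toMatrixAlgEquiv D.basisR : _ →+* _).comp D.repP

theorem toMat_injective : Function.Injective D.toMat := by
  refine (LinearMap.toMatrixAlgEquiv D.basisR).injective.comp fun a c h => ?_
  refine D.rep_injective D.N_one_sub_gG (LinearMap.ext fun r => ?_)
  rw [← repP_apply, h, repP_apply]

theorem sum_primitive (i j : Fin D.n) :
    ∑ l : Fin D.n, (D.ξ ^ (i : ℕ)) ^ (l : ℕ) * ((D.ξ ^ (j : ℕ))⁻¹) ^ (l : ℕ) =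
      if i = j then (D.n : k) else 0 := by
  have h0 := D.ξ_primitive.ne_zero D.n_pos.ne'
  simp only [← mul_pow]
  rw [Fin.sum_univ_eq_sum_range (fun l => (D.ξ ^ (i : ℕ) * (D.ξ ^ (j : ℕ))⁻¹) ^ l)]
  split_ifs with h
  · subst h
    simp [mul_inv_cancel₀ (pow_ne_zero _ h0)]
  · have h1 : D.ξ ^ (i : ℕ) * (D.ξ ^ (j : ℕ))⁻¹ - 1 ≠ 0 := fun h2 => h <| by
      have h3 : D.ξ ^ (i : ℕ) = D.ξ ^ (j : ℕ) := by
        rw [sub_eq_zero, mul_inv_eq_one₀ (pow_ne_zero _ h0)] at h2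
        exact h2
      exact Fin.ext (D.ξ_primitive.pow_inj i.2 j.2 h3)
    have h2 := mul_geom_sum (D.ξ ^ (i : ℕ) * (D.ξ ^ (j : ℕ))⁻¹) D.n
    rw [mul_pow, inv_pow, ← pow_mul, ← pow_mul, mul_comm (i : ℕ), mul_comm (j : ℕ), pow_mul,
      pow_mul, D.ξ_primitive.pow_eq_one, one_pow, one_pow, inv_one, mul_one, sub_self] at h2
    exact (mul_eq_zero.1 h2).resolve_left h1

/-- The elements corresponding to the matrix units, up to a central factor. -/
noncomputable def matUnit (i j : Fin D.n) : D.Alg :=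
  (D.n : k)⁻¹ • ∑ l : Fin D.n, ((D.ξ ^ (j : ℕ))⁻¹) ^ (l : ℕ) •
    (D.incl (D.s (D.gG ^ (i : ℕ) * (D.gG ^ (j : ℕ))⁻¹) *
      ∏ m ∈ Finset.Ico (l : ℕ) D.n, (D.σ ^ m) (1 - D.s D.gG)) * D.y ^ (l : ℕ))

/-- In the l-th summand of `matUnit` the product over m ≥ l completes the partial norm N_l to c, so
the summand takes gᵐ to ξ^(m l) c gⁱ⁻ʲ⁺ᵐ up to its scalar ξ^(-j l). Averaging over l selects m = j
by orthogonality of the powers of ξ; this is where n ≠ 0 in k is used. -/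
theorem repP_matUnit (i j m : Fin D.n) :
    D.repP (D.matUnit i j) (D.basisR m) = if m = j then D.cP • D.basisR i else 0 := by
  have h : ∀ l : Fin D.n, D.rep _ D.N_one_sub_gG
      (D.incl (D.s (D.gG ^ (i : ℕ) * (D.gG ^ (j : ℕ))⁻¹) *
      ∏ m ∈ Finset.Ico (l : ℕ) D.n, (D.σ ^ m) (1 - D.s D.gG)) * D.y ^ (l : ℕ)) (D.basisR m) =
      (D.ξ ^ (m : ℕ)) ^ (l : ℕ) •
        (D.cP • D.s (D.gG ^ (i : ℕ) * (D.gG ^ (j : ℕ))⁻¹ * D.gG ^ (m : ℕ))) := by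
    intro l
    rw [rep_incl_mul_y_pow, mul_assoc (D.s _), mul_comm (Finset.prod _ _), N,
      Finset.prod_range_mul_prod_Ico _ l.2.le]
    change _ * D.N (1 - D.s D.gG) D.n * _ = _
    rw [N_one_sub_gG, basisR_apply, σ_pow_s, map_pow, χ_gG, ← c_mul, mul_comm _ D.c, mul_smul_comm,
      mul_assoc, ← s_mul]
    simp
  rw [repP_apply, matUnit]
  simp only [map_smul, map_sum, LinearMap.smul_apply, LinearMap.sum_apply, h, smul_smul]
  rw [← Finset.sum_smul]
  simp only [mul_comm _ ((D.ξ ^ (m : ℕ)) ^ _)]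
  rw [sum_primitive, smul_smul]
  split_ifs with hm
  · subst hm
    rw [inv_mul_cancel₀ D.n_ne_zero, one_smul, inv_mul_cancel_right, basisR_apply]
  · simp

theorem toMat_matUnit (i j : Fin D.n) : D.toMat (D.matUnit i j) = Matrix.single i j D.cP := by
  refine Matrix.ext fun i' j' => ?_
  change LinearMap.toMatrixAlgEquiv D.basisR (D.repP _) i' j' = _
  rw [LinearMap.toMatrixAlgEquiv_apply, repP_matUnit, Matrix.single_apply]
  split_ifs with h h' h'
  · rw [map_smul, Module.Basis.repr_self]
    simp [h'.1]
  · have : i ≠ i' := fun h3 => h' ⟨h3, h.symm⟩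
    rw [map_smul, Module.Basis.repr_self]
    simp [this]
  · exact absurd h'.2.symm h
  · simp

theorem toMat_smul (p : k[T;T⁻¹]) (t : D.Alg) : D.toMat (p • t) = p • D.toMat t := by
  have : D.repP (p • t) = p • D.repP t := by
    refine LinearMap.ext fun r => ?_
    rw [repP_apply, Algebra.smul_def, algebraMap_Alg, map_mul, Module.End.mul_apply, rep_incl]
    rfl
  change LinearMap.toMatrixAlgEquiv D.basisR (D.repP _) = _
  rw [this, map_smul]
  rfl

theorem exists_toMat_eq (M : Matrix (Fin D.n) (Fin D.n) k[T;T⁻¹]) :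
    ∃ t, D.toMat t = D.cP • M := by
  refine ⟨∑ i, ∑ j, M i j • D.matUnit i j, ?_⟩
  simp only [map_sum, toMat_smul, toMat_matUnit]
  conv_rhs => rw [Matrix.matrix_eq_sum_single M]
  simp only [Finset.smul_sum, Matrix.smul_single, smul_eq_mul, mul_comm]

/-- The image in the matrix ring contains `cP` times each matrix unit. Placing the right one between
two nonzero matrices gives an entry that is a product of three nonzero elements of a domain. -/
theorem isPrimeRing : IsPrimeRing D.Alg := by
  refine ⟨inferInstance, fun a c h => ?_⟩
  by_contra! hac
  have h1 : ∀ t : D.Alg, t ≠ 0 → ∃ i j, D.toMat t i j ≠ 0 := by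
    intro t ht
    by_contra! h2
    exact ht (D.toMat_injective (by rw [map_zero]; exact Matrix.ext h2))
  obtain ⟨i, j, hij⟩ := h1 a hac.1
  obtain ⟨i', j', hij'⟩ := h1 c hac.2
  have h2 := congrArg (fun t => D.toMat t i j') (h (D.matUnit j i'))
  simp only [map_mul, map_zero, toMat_matUnit] at h2
  rw [Matrix.mul_apply, Finset.sum_eq_single i'] at h2
  · rw [Matrix.mul_single_apply_same] at h2
    exact mul_ne_zero (mul_ne_zero hij D.cP_ne_zero) hij' h2
  · intro l _ hl
    rw [Matrix.mul_single_apply_of_ne _ _ _ _ _ hl, zero_mul]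
  · simp

/-! ### The lower bound for the PI-degree -/

/-- The shift matrix. -/
def shift (n : ℕ) (C : Type*) [CommRing C] : Matrix (Fin n) (Fin n) C :=
  Matrix.of fun i j => if (i : ℕ) + 1 = j then 1 else 0

theorem shift_pow_apply (n : ℕ) {C : Type*} [CommRing C] (l : ℕ) (i j : Fin n) :
    (shift n C ^ l) i j = if (i : ℕ) + l = j then 1 else 0 := by
  induction l generalizing j with
  | zero => simp [Matrix.one_apply, Fin.ext_iff]
  | succ l ih =>
    rw [pow_succ, Matrix.mul_apply]
    simp only [ih]
    simp only [shift, Matrix.of_apply, ite_mul, one_mul, zero_mul]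
    by_cases h : (i : ℕ) + l < n
    · rw [Finset.sum_eq_single ⟨i + l, h⟩]
      · simp [add_assoc]
      · intro x _ hx
        rw [if_neg fun h2 => hx (Fin.ext h2.symm)]
      · simp
    · rw [Finset.sum_eq_zero, if_neg (by omega)]
      intro x _
      rw [if_neg (by omega)]

/-- Suppose m < n. A multiple of the n × n shift comes from a nilpotent t in `B`. In m × m matrices
over any commutative ring the m-th power of a nilpotent matrix has nilpotent entries, so tᵐ t' is
nilpotent for every t'. But the m-th power of the shift is nonzero, and for a suitable t' the trace
of tᵐ t' over P is not nilpotent. -/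
theorem le_of_embedding {m : ℕ} {C : Type*} [CommRing C] (φ : D.Alg →+* Matrix (Fin m) (Fin m) C)
    (hφ : Function.Injective φ) : D.n ≤ m := by
  by_contra! hm
  obtain ⟨t, ht⟩ := D.exists_toMat_eq (shift D.n _)
  obtain ⟨t', ht'⟩ := D.exists_toMat_eq (Matrix.single ⟨m, hm⟩ 0 1)
  have h1 : IsNilpotent t := ⟨D.n, D.toMat_injective <| by
    rw [map_pow, ht, smul_pow, map_zero]
    refine Matrix.ext fun i j => ?_
    rw [Matrix.smul_apply, shift_pow_apply, if_neg (by omega)]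
    simp⟩
  have h2 : IsNilpotent (φ (t ^ m * t')) := by
    refine Matrix.isNilpotent_of_forall fun i j => ?_
    rw [map_mul, Matrix.mul_apply]
    refine isNilpotent_sum fun l _ => ?_
    refine (Commute.all _ _).isNilpotent_mul_right ?_
    have := Matrix.isNilpotent_pow_card_apply (h1.map φ) i l
    rwa [Fintype.card_fin, ← map_pow] at this
  obtain ⟨K, hK⟩ := h2
  rw [← map_pow, map_eq_zero_iff φ hφ] at hK
  have h3 : IsNilpotent (D.toMat (t ^ m * t')) := ⟨K, by rw [← map_pow, hK, map_zero]⟩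
  have h4 := (Matrix.isNilpotent_trace_of_isNilpotent h3).eq_zero
  rw [map_mul, map_pow, ht, ht', smul_pow, smul_mul_smul_comm, Matrix.trace_smul,
    Matrix.trace_mul_single, shift_pow_apply] at h4
  simp [D.cP_ne_zero] at h4

theorem isPIDegree : IsPIDegree D.Alg D.n :=
  ⟨⟨_, inferInstance, D.toMat, D.toMat_injective⟩, fun _ ⟨_, _, φ, hφ⟩ => D.le_of_embedding φ hφ⟩

end LiuDatum

/-! ### Gel'fand-Kirillov dimension -/

section GK

open LaurentPolynomial Filter

/-- For V = k x the powers xⁱ with i < m already lie in (k + V)ᵐ, so its dimension is at least m. -/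
theorem one_le_gkDim {k A : Type*} [Field k] [Ring A] [Algebra k A] {x : A}
    (hx : LinearIndependent k fun i : ℕ => x ^ i) : 1 ≤ gkDim k A := by
  refine le_trans ?_ (le_iSup _ ⟨Submodule.span k {x}, Submodule.fg_span_singleton x⟩)
  rw [← limsup_const (f := (atTop : Filter ℕ)) (1 : EReal)]
  refine limsup_le_limsup ?_
  filter_upwards [eventually_ge_atTop 2] with m hm
  have hm' : (0 : ℝ) < Real.log m := Real.log_pos (by exact_mod_cast hm)
  rw [← EReal.coe_one, EReal.coe_le_coe_iff, le_div_iff₀ hm', one_mul]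
  refine Real.log_le_log (by positivity) ?_
  have hfg : ((1 : Submodule k A) ⊔ Submodule.span k {x}).FG :=
    .sup (Submodule.one_eq_span (R := k) (A := A) ▸ Submodule.fg_span_singleton 1) (Submodule.fg_span_singleton x)
  have : Module.Finite k ↥(((1 : Submodule k A) ⊔ Submodule.span k {x}) ^ m) :=
    Module.Finite.iff_fg.2 (hfg.pow m)
  have hmem : ∀ i : Fin m, x ^ (i : ℕ) ∈ ((1 : Submodule k A) ⊔ Submodule.span k {x}) ^ m := by
    intro i
    have h1 : x ^ (i : ℕ) ∈ ((1 : Submodule k A) ⊔ Submodule.span k {x}) ^ (i : ℕ) :=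
      Submodule.pow_mem_pow _ (Submodule.mem_sup_right (Submodule.mem_span_singleton_self x)) _
    have h3 := pow_le_pow_right₀ (le_sup_left : 1 ≤ (1 : Submodule k A) ⊔ Submodule.span k {x}) i.2.le
    exact h3 h1
  have h2 : LinearIndependent k fun i : Fin m =>
      (⟨x ^ (i : ℕ), hmem i⟩ : ↥(((1 : Submodule k A) ⊔ Submodule.span k {x}) ^ m)) :=
    LinearIndependent.of_comp (Submodule.subtype _) (hx.comp _ Fin.val_injective)
  exact_mod_cast (Fintype.card_fin m).symm.le.trans h2.fintype_card_le_finrank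

variable {k A ι : Type*} [Field k] [Ring A] [Algebra k A] [Algebra k[T;T⁻¹] A]
  [IsScalarTower k k[T;T⁻¹] A] [Fintype ι] (B : Module.Basis ι k[T;T⁻¹] A)

/-- The span of the elements `Tᵃ e` with `|a| ≤ r` and `e` in the basis. -/
noncomputable def degreeLE (r : ℕ) : Submodule k A :=
  Submodule.span k ((fun p : ℤ × ι => (T p.1 : k[T;T⁻¹]) • B p.2) ''
    ((Finset.Icc (-r : ℤ) r ×ˢ Finset.univ : Finset (ℤ × ι)) : Set (ℤ × ι)))

variable {B}

omit [IsScalarTower k k[T;T⁻¹] A] in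
theorem T_smul_mem_degreeLE {r : ℕ} {a : ℤ} (h : |a| ≤ r) (i : ι) :
    (T a : k[T;T⁻¹]) • B i ∈ degreeLE B r :=
  Submodule.subset_span ⟨(a, i), by simpa using abs_le.1 h, rfl⟩

omit [IsScalarTower k k[T;T⁻¹] A] in
theorem degreeLE_mono : Monotone (degreeLE B) := by
  intro r s h
  refine Submodule.span_le.2 ?_
  rintro _ ⟨⟨a, i⟩, ha, rfl⟩
  simp only [Finset.coe_product, Set.mem_prod, Finset.mem_coe, Finset.mem_Icc] at ha
  exact T_smul_mem_degreeLE ((abs_le.2 ha.1).trans (by exact_mod_cast h)) i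

omit [IsScalarTower k k[T;T⁻¹] A] in
theorem finrank_degreeLE_le (r : ℕ) :
    Module.finrank k (degreeLE B r) ≤ (2 * r + 1) * Fintype.card ι := by
  classical
  rw [degreeLE, ← Finset.coe_image]
  refine (finrank_span_finset_le_card _).trans (Finset.card_image_le.trans ?_)
  rw [Finset.card_product, Int.card_Icc, Finset.card_univ]
  exact Nat.mul_le_mul_right _ (by omega)

theorem T_smul_degreeLE {r s : ℕ} {a : ℤ} (h : |a| ≤ s) {t : A} (ht : t ∈ degreeLE B r) :
    (T a : k[T;T⁻¹]) • t ∈ degreeLE B (s + r) := by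
  induction ht using Submodule.span_induction with
  | mem t ht =>
    obtain ⟨⟨c, i⟩, hc, rfl⟩ := ht
    simp only [Finset.coe_product, Set.mem_prod, Finset.mem_coe, Finset.mem_Icc] at hc
    rw [smul_smul, ← T_add]
    exact T_smul_mem_degreeLE ((abs_add_le _ _).trans
      (by push_cast; exact add_le_add h (abs_le.2 hc.1))) i
  | zero => rw [smul_zero]; exact zero_mem _
  | add t t' _ _ h1 h2 => rw [smul_add]; exact add_mem h1 h2
  | smul c t _ h1 => rw [smul_comm]; exact Submodule.smul_mem _ _ h1

variable (B) in
theorem exists_mem_degreeLE (t : A) : ∃ r, t ∈ degreeLE B r := by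
  have h : ∀ (p : k[T;T⁻¹]) (i : ι), ∃ r, p • B i ∈ degreeLE B r := by
    intro p i
    induction p using LaurentPolynomial.induction_on' with
    | add p q hp hq =>
      obtain ⟨r, hr⟩ := hp
      obtain ⟨s, hs⟩ := hq
      rw [add_smul]
      exact ⟨max r s, add_mem (degreeLE_mono (le_max_left _ _) hr)
        (degreeLE_mono (le_max_right _ _) hs)⟩
    | C_mul_T a c =>
      refine ⟨a.natAbs, ?_⟩
      rw [← LaurentPolynomial.smul_eq_C_mul, smul_assoc]
      exact Submodule.smul_mem _ _ (T_smul_mem_degreeLE (by simp) i)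
  choose f hf using fun i => h (B.repr t i) i
  refine ⟨Finset.univ.sup f, ?_⟩
  rw [← B.sum_repr t]
  exact Submodule.sum_mem _ fun i _ => degreeLE_mono (Finset.le_sup (Finset.mem_univ i)) (hf i)

variable (B) in
theorem exists_le_degreeLE {V : Submodule k A} (hV : V.FG) : ∃ r, V ≤ degreeLE B r := by
  obtain ⟨s, rfl⟩ := hV
  choose f hf using exists_mem_degreeLE B
  exact ⟨s.sup f, Submodule.span_le.2 fun t ht => degreeLE_mono (Finset.le_sup ht) (hf t)⟩

variable (B) in
-- The powers of T are central, so the excess in degree comes only from the finitely many products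
-- of two basis elements.
theorem exists_degreeLE_mul_le :
    ∃ r₀, ∀ r s, degreeLE B r * degreeLE B s ≤ degreeLE B (r + s + r₀) := by
  choose f hf using exists_mem_degreeLE B
  refine ⟨Finset.univ.sup fun p : ι × ι => f (B p.1 * B p.2), fun r s => ?_⟩
  rw [degreeLE, degreeLE, Submodule.span_mul_span, Submodule.span_le]
  rintro _ ⟨_, ⟨⟨a, i⟩, ha, rfl⟩, _, ⟨⟨c, j⟩, hc, rfl⟩, rfl⟩
  simp only [Finset.coe_product, Set.mem_prod, Finset.mem_coe, Finset.mem_Icc] at ha hc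
  simp only [smul_mul_smul_comm, ← T_add]
  refine T_smul_degreeLE ((abs_add_le _ _).trans
      (by push_cast; exact add_le_add (abs_le.2 ha.1) (abs_le.2 hc.1))) ?_
  exact degreeLE_mono (Finset.le_sup (f := fun p : ι × ι => f (B p.1 * B p.2))
    (Finset.mem_univ (i, j))) (hf _)

/-- If V has degree at most s and products cost an excess r₀, then Vᵐ⁺¹ has degree at most (s + r₀)
m + s, and the dimension of the filtration is linear in the degree. -/
theorem exists_finrank_pow_le (B : Module.Basis ι k[T;T⁻¹] A) {V : Submodule k A} (hV : V.FG) :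
    ∃ C : ℕ, ∀ m : ℕ, 0 < m → Module.finrank k ↥(V ^ m) ≤ C * m := by
  obtain ⟨s, hs⟩ := exists_le_degreeLE B hV
  obtain ⟨r₀, h⟩ := exists_degreeLE_mul_le B
  have key : ∀ m : ℕ, V ^ (m + 1) ≤ degreeLE B ((s + r₀) * m + s) := by
    intro m
    induction m with
    | zero => simpa using hs
    | succ m ih =>
      rw [pow_succ]
      refine (mul_le_mul' ih hs).trans ((h _ _).trans (degreeLE_mono ?_))
      rw [mul_add]
      omega
  refine ⟨(2 * (s + r₀) + 2 * s + 1) * Fintype.card ι, fun m hm => ?_⟩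
  obtain ⟨m, rfl⟩ : ∃ l, m = l + 1 := ⟨m - 1, by omega⟩
  have : Module.Finite k (degreeLE B ((s + r₀) * m + s)) :=
    Module.Finite.span_of_finite k (Set.toFinite _)
  refine (Submodule.finrank_mono (key m)).trans ((finrank_degreeLE_le _).trans ?_)
  rw [mul_right_comm]
  refine Nat.mul_le_mul_right _ ?_
  nlinarith [Nat.zero_le (s + r₀), Nat.zero_le (s * m)]

theorem tendsto_log_div_log (C : ℝ) (hC : 0 < C) :
    Tendsto (fun m : ℕ => Real.log (C * m) / Real.log m) atTop (nhds 1) := by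
  have h1 : Tendsto (fun m : ℕ => Real.log (m : ℝ)) atTop atTop :=
    Real.tendsto_log_atTop.comp tendsto_natCast_atTop_atTop
  have h2 : Tendsto (fun m : ℕ => Real.log C / Real.log m + 1) atTop (nhds (0 + 1)) :=
    (h1.const_div_atTop _).add_const 1
  rw [zero_add] at h2
  refine h2.congr' ?_
  filter_upwards [eventually_ge_atTop 2] with m hm
  have hm' : (0 : ℝ) < Real.log m := Real.log_pos (by exact_mod_cast hm)
  rw [Real.log_mul hC.ne' (by positivity), add_div, div_self hm'.ne']

theorem gkDim_le_one (B : Module.Basis ι k[T;T⁻¹] A) : gkDim k A ≤ 1 := by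
  refine iSup_le fun V => ?_
  obtain ⟨C, hC⟩ := exists_finrank_pow_le B (V := 1 ⊔ V.1) (.sup (Submodule.one_eq_span (R := k) (A := A) ▸ Submodule.fg_span_singleton 1) V.2)
  -- Passing from C to C + 1 makes the constant positive, as the limit of log (C m) / log m
  -- requires.
  have h1 : Tendsto (fun m : ℕ => ((Real.log (((C + 1 : ℕ) : ℝ) * m) / Real.log m : ℝ) : EReal))
      atTop (nhds ((1 : ℝ) : EReal)) :=
    (continuous_coe_real_ereal.tendsto 1).comp (tendsto_log_div_log _ (by positivity))
  refine (limsup_le_limsup ?_).trans h1.limsup_eq.le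
  filter_upwards [eventually_ge_atTop 1] with m hm
  rw [EReal.coe_le_coe_iff]
  refine div_le_div_of_nonneg_right ?_ (Real.log_natCast_nonneg m)
  have h2 : (1 : ℝ) ≤ ((C + 1 : ℕ) : ℝ) * m := by
    exact_mod_cast Nat.mul_pos (Nat.succ_pos C) hm
  -- Monotonicity of log needs a positive argument; rank 0 is covered by the convention log 0 = 0.
  rcases Nat.eq_zero_or_pos (Module.finrank k ↥((1 ⊔ V.1) ^ m)) with h0 | h0
  · rw [h0, Nat.cast_zero, Real.log_zero]
    exact Real.log_nonneg h2
  · refine Real.log_le_log (by exact_mod_cast h0) ?_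
    exact_mod_cast (hC m hm).trans (Nat.mul_le_mul_right _ (Nat.le_succ C))

end GK

namespace LiuDatum

variable {k : Type u} [Field k] (D : LiuDatum k)

theorem linearIndependent_x_pow : LinearIndependent k fun i : ℕ => (D.x : D.Alg) ^ i := by
  have h := D.basisK.linearIndependent.comp (fun i : ℕ => (D.xG ^ (i : ℤ), (0 : Fin D.n)))
    fun i j hij => by exact_mod_cast D.xG_zpow_injective (Prod.ext_iff.1 hij).1
  convert h using 1
  ext i
  simp [basisK_apply, U_xG]

theorem gkDim_eq_one : gkDim k D.Alg = 1 :=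
  le_antisymm (gkDim_le_one D.basisP) (one_le_gkDim D.linearIndependent_x_pow)

end LiuDatum

/-! ### Submodules of projective modules over principal ideal domains -/

section PID

variable {P : Type u} [CommRing P] [IsDomain P] [IsPrincipalIdealRing P]

/-- By Baer's criterion only ideals (a) matter, for which extension amounts to divisibility by a.
Divisibility passes from an injective module to its quotients. -/
theorem Module.Injective.of_surjective_of_isPrincipalIdealRing {I Q : Type u} [AddCommGroup I]
    [Module P I] [AddCommGroup Q] [Module P Q] [hI : Module.Injective P I] (f : I →ₗ[P] Q)
    (hf : Function.Surjective f) : Module.Injective P Q := by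
  refine Module.Baer.injective fun J g => ?_
  obtain ⟨a, rfl⟩ := IsPrincipalIdealRing.principal J
  have ha : a ∈ Submodule.span P {a} := Submodule.mem_span_singleton_self a
  obtain ⟨q, hq⟩ : ∃ q, a • q = g ⟨a, ha⟩ := by
    by_cases h0 : a = 0
    · subst h0
      refine ⟨0, ?_⟩
      rw [zero_smul, ← map_zero g]
      rfl
    · obtain ⟨i, hi⟩ := hf (g ⟨a, ha⟩)
      obtain ⟨h, hh⟩ := hI.out (LinearMap.mulLeft P a) (mul_right_injective₀ h0)
        (LinearMap.toSpanSingleton P I i)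
      refine ⟨f (h 1), ?_⟩
      have := hh 1
      rw [LinearMap.mulLeft_apply, mul_one, LinearMap.toSpanSingleton_apply, one_smul] at this
      rw [← hi, ← this, ← map_smul, ← map_smul, smul_eq_mul, mul_one]
  refine ⟨LinearMap.toSpanSingleton P Q q, fun x hx => ?_⟩
  obtain ⟨c, rfl⟩ := Submodule.mem_span_singleton.1 hx
  rw [LinearMap.toSpanSingleton_apply, smul_assoc, hq, ← map_smul]
  rfl

open CategoryTheory in
-- To lift g : K → Y along f : X → Y, embed X in an injective module I. Then Y maps to Q = I/ker f,
-- which is injective because it is a quotient of I. Hence K → Y → Q extends to M, lifts to I by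
-- projectivity of M, and its restriction to K is the desired lift. No finiteness of K is involved.
theorem Module.Projective.of_injective_of_isPrincipalIdealRing {K M : Type u} [AddCommGroup K]
    [Module P K] [AddCommGroup M] [Module P M] [Module.Projective P M] (i : K →ₗ[P] M)
    (hi : Function.Injective i) : Module.Projective P K := by
  refine Module.Projective.of_lifting_property fun {X Y} _ _ _ _ f g hf => ?_
  let I := CategoryTheory.Injective.under (ModuleCat.of P X)
  let j : X →ₗ[P] I := (CategoryTheory.Injective.ι (ModuleCat.of P X)).hom
  have hj : Function.Injective j := (ModuleCat.mono_iff_injective _).1 inferInstance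
  have hI : Module.Injective P I :=
    Module.injective_module_of_injective_object P I (inj := inferInstanceAs (CategoryTheory.Injective I))
  let q := (Submodule.map j (LinearMap.ker f)).mkQ
  have hQ := Module.Injective.of_surjective_of_isPrincipalIdealRing q (Submodule.mkQ_surjective _)
  obtain ⟨f', hf'⟩ : ∃ f' : Y →ₗ[P] I ⧸ Submodule.map j (LinearMap.ker f), f' ∘ₗ f = q ∘ₗ j := by
    have hle : LinearMap.ker f ≤ LinearMap.ker (q ∘ₗ j) := fun x hx => by
      rw [LinearMap.mem_ker, LinearMap.comp_apply, Submodule.mkQ_apply,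
        Submodule.Quotient.mk_eq_zero]
      exact Submodule.mem_map_of_mem hx
    refine ⟨(LinearMap.ker f).liftQ (q ∘ₗ j) hle ∘ₗ (f.quotKerEquivOfSurjective hf).symm, ?_⟩
    ext x
    have : (f.quotKerEquivOfSurjective hf).symm (f x) = Submodule.Quotient.mk x := by
      rw [LinearEquiv.symm_apply_eq]
      rfl
    simp only [LinearMap.comp_apply, LinearEquiv.coe_coe, this]
    rfl
  obtain ⟨G, hG⟩ := hQ.out i hi (f' ∘ₗ g)
  obtain ⟨H, hH⟩ := Module.projective_lifting_property q G (Submodule.mkQ_surjective _)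
  -- The lift lands in X because its class in Q comes from Y, hence from X, and I → Q has kernel
  -- inside X.
  have key : ∀ x, H (i x) ∈ LinearMap.range j := by
    intro x
    obtain ⟨t, ht⟩ := hf (g x)
    have h1 : q (H (i x)) = q (j t) := by
      rw [← LinearMap.comp_apply, hH, hG, LinearMap.comp_apply, ← ht, ← LinearMap.comp_apply, hf']
      rfl
    rw [← sub_eq_zero, ← map_sub, Submodule.mkQ_apply, Submodule.Quotient.mk_eq_zero] at h1
    obtain ⟨r, _, hr⟩ := h1
    exact ⟨t + r, by rw [map_add, hr, add_sub_cancel]⟩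
  let e := LinearEquiv.ofInjective j hj
  refine ⟨e.symm ∘ₗ (H ∘ₗ i).codRestrict _ key, ?_⟩
  ext x
  obtain ⟨t, ht⟩ := hf (g x)
  have h0 : j (e.symm ⟨H (i x), key x⟩) = H (i x) := congrArg Subtype.val (e.apply_symm_apply _)
  have h1 : q (j (e.symm ⟨H (i x), key x⟩ - t)) = 0 := by
    rw [map_sub, h0, map_sub, ← LinearMap.comp_apply, hH, hG, LinearMap.comp_apply, ← ht,
      ← LinearMap.comp_apply, hf', LinearMap.comp_apply, sub_self]
  rw [Submodule.mkQ_apply, Submodule.Quotient.mk_eq_zero] at h1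
  obtain ⟨r, hr, hr'⟩ := h1
  have h2 := hj hr'
  change f (e.symm ⟨H (i x), key x⟩) = g x
  rw [← ht, ← sub_eq_zero, ← map_sub, ← h2]
  exact hr

end PID

/-! ### Frobenius extensions of principal ideal domains -/

section Frobenius

open CategoryTheory Abelian

variable {P A : Type u} [CommRing P] [Ring A] [Algebra P A]

/-- The linear form `ψ` on `A` is a Frobenius form: every linear form is `a ↦ ψ (a c)` for a
unique `c`. -/
def IsFrobeniusForm (ψ : A →ₗ[P] P) : Prop :=
  Function.Bijective fun c : A => ψ ∘ₗ LinearMap.mulRight P c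

namespace IsFrobeniusForm

variable {ψ : A →ₗ[P] P} (hψ : IsFrobeniusForm ψ)
include hψ

theorem ext {a c : A} (h : ∀ t, ψ (t * a) = ψ (t * c)) : a = c :=
  hψ.1 (LinearMap.ext h)

theorem exists_eq (f : A →ₗ[P] P) : ∃ c, ∀ t, ψ (t * c) = f t := by
  obtain ⟨c, hc⟩ := hψ.2 f
  exact ⟨c, fun t => LinearMap.congr_fun hc t⟩

theorem linearMap_ext {M : Type*} [AddCommGroup M] [Module A M] {f f' : M →ₗ[A] A}
    (h : ∀ m, ψ (f m) = ψ (f' m)) : f = f' :=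
  LinearMap.ext fun m => hψ.ext fun t => by
    rw [← smul_eq_mul, ← smul_eq_mul, ← map_smul, ← map_smul, h]

/-- The value F(m) is the element representing the linear form a ↦ f(a m). With `linearMap_ext` this
is the duality Hom_A(M, A) = Hom_P(M, P). -/
theorem exists_linearMap {M : Type*} [AddCommGroup M] [Module A M] [Module P M]
    [IsScalarTower P A M] (f : M →ₗ[P] P) : ∃ F : M →ₗ[A] A, ∀ m, ψ (F m) = f m := by
  choose F hF using fun m : M => hψ.exists_eq
    ({ toFun := fun a => f (a • m)
       map_add' := fun a c => by rw [add_smul, map_add]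
       map_smul' := fun p a => by rw [smul_assoc, map_smul]; rfl } : A →ₗ[P] P)
  refine ⟨{ toFun := F, map_add' := fun m m' => hψ.ext fun t => ?_,
            map_smul' := fun a m => hψ.ext fun t => ?_ }, fun m => ?_⟩
  · rw [mul_add, map_add, hF, hF, hF]
    simp
  · rw [hF, RingHom.id_apply, smul_eq_mul, ← mul_assoc, hF]
    simp [mul_smul]
  · have := hF m 1
    simpa using this

/-- Linear maps into a Frobenius extension can be extended from submodules which are direct
summands over the base ring. -/
theorem exists_extension {K M : Type*} [AddCommGroup K] [Module A K] [AddCommGroup M] [Module A M]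
    [Module P K] [IsScalarTower P A K] [Module P M] [IsScalarTower P A M]
    (i : K →ₗ[A] M) (r : M →ₗ[P] K) (hr : ∀ x, r (i x) = x) (f : K →ₗ[A] A) :
    ∃ F : M →ₗ[A] A, F ∘ₗ i = f := by
  obtain ⟨F, hF⟩ := hψ.exists_linearMap (ψ ∘ₗ f.restrictScalars P ∘ₗ r)
  refine ⟨F, hψ.linearMap_ext fun x => ?_⟩
  rw [LinearMap.comp_apply, hF]
  simp [hr]

end IsFrobeniusForm

/-- `Ext¹` vanishes if all maps from the kernel of a presentation extend. -/
theorem ext_one_eq_zero_of_extension {S : ShortComplex (ModuleCat.{u} A)} (hS : S.ShortExact)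
    [Projective S.X₂] (Y : ModuleCat.{u} A)
    (h : ∀ f : S.X₁ ⟶ Y, ∃ F : S.X₂ ⟶ Y, S.f ≫ F = f) (e : Ext.{u} S.X₃ Y 1) : e = 0 := by
  obtain ⟨x₁, rfl⟩ := Ext.contravariant_sequence_exact₃ hS Y e (Ext.eq_zero_of_projective _)
    (n₀ := 0) rfl
  obtain ⟨f, rfl⟩ := Ext.homEquiv₀.symm.surjective x₁
  obtain ⟨F, rfl⟩ := h f
  rw [Ext.homEquiv₀_symm_apply, ← Ext.mk₀_comp_mk₀]
  exact ShortComplex.ShortExact.extClass_comp_assoc hS _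

/-- A presentation of K by a free A-module splits over P, so by Frobenius duality every A-linear map
from the kernel to A extends. -/
theorem IsFrobeniusForm.subsingleton_ext_one {ψ : A →ₗ[P] P} (hψ : IsFrobeniusForm ψ)
    (K : Type u) [AddCommGroup K] [Module A K] [Module P K] [IsScalarTower P A K]
    [Module.Projective P K] : Subsingleton (Ext.{u} (ModuleCat.of A K) (ModuleCat.of A A) 1) := by
  refine subsingleton_of_forall_eq 0 fun e => ?_
  let p : (K →₀ A) →ₗ[A] K := Finsupp.linearCombination A id
  have hp : Function.Surjective p := Finsupp.linearCombination_id_surjective A K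
  have : Projective (ModuleCat.of A (K →₀ A)) :=
    ModuleCat.projective_of_free Finsupp.basisSingleOne
  refine ext_one_eq_zero_of_extension (LinearMap.shortExact_shortComplexKer hp) _ (fun f => ?_) e
  obtain ⟨s, hs⟩ := Module.projective_lifting_property (p.restrictScalars P)
    (LinearMap.id : K →ₗ[P] K) hp
  -- For a P-linear section s of p, the map id - s p is a P-linear retraction onto ker p.
  let r : (K →₀ A) →ₗ[P] LinearMap.ker p :=
    LinearMap.codRestrict ((LinearMap.ker p).restrictScalars P)
      (LinearMap.id - s ∘ₗ p.restrictScalars P) fun t => by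
        have := LinearMap.congr_fun hs (p t)
        simp only [LinearMap.comp_apply, LinearMap.restrictScalars_apply, LinearMap.id_apply]
          at this
        simp [this]
  obtain ⟨F, hF⟩ := hψ.exists_extension (LinearMap.ker p).subtype r (fun x => by
    refine Subtype.ext ?_
    have h1 : p x.1 = 0 := x.2
    change x.1 - s (p x.1) = x.1
    rw [h1, map_zero, sub_zero]) f.hom
  exact ⟨ModuleCat.ofHom F, ModuleCat.hom_ext hF⟩

variable [IsDomain P] [IsPrincipalIdealRing P] [Module.Free P A]

/-- Dimension shifting reduces Ext² of M to Ext¹ of the kernel of a free cover. That kernel lies in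
a free P-module, so it is P-projective. -/
theorem IsFrobeniusForm.hasInjectiveDimensionLT_two {ψ : A →ₗ[P] P} (hψ : IsFrobeniusForm ψ) :
    HasInjectiveDimensionLT (ModuleCat.of A A) 2 := by
  refine hasInjectiveDimensionLT_of_enoughProjectives _ 2 fun M => ?_
  refine subsingleton_of_forall_eq 0 fun e => ?_
  let p : (M →₀ A) →ₗ[A] M := Finsupp.linearCombination A id
  have hp : Function.Surjective p := Finsupp.linearCombination_id_surjective A M
  have : Projective (ModuleCat.of A (M →₀ A)) :=
    ModuleCat.projective_of_free Finsupp.basisSingleOne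
  have hS := LinearMap.shortExact_shortComplexKer hp
  obtain ⟨x₁, rfl⟩ := Ext.contravariant_sequence_exact₃ hS _ e (Ext.eq_zero_of_projective _)
    (n₀ := 1) rfl
  have : Module.Projective P (LinearMap.ker p) :=
    Module.Projective.of_injective_of_isPrincipalIdealRing (K := LinearMap.ker p) (M := M →₀ A)
      ((LinearMap.ker p).subtype.restrictScalars P) Subtype.val_injective
  have h := hψ.subsingleton_ext_one (LinearMap.ker p)
  rw [Subsingleton.elim x₁ 0, Ext.comp_zero]

end Frobenius

/-! ### The Artin-Schelter Gorenstein property of augmented Frobenius extensions -/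

section Augmented

open CategoryTheory Abelian

variable {k P A : Type u} [Field k] [CommRing P] [IsDomain P] [IsPrincipalIdealRing P] [Ring A]
  [Algebra k P] [Algebra k A] [Algebra P A] [IsScalarTower k P A] [Module.Free P A]

omit [IsPrincipalIdealRing P] [Module.Free P A] in
-- The form t ↦ ψ(t v)/z is P-linear, so it is represented by some v'; uniqueness of representation
-- gives v = z v'.
theorem IsFrobeniusForm.exists_eq_smul {ψ : A →ₗ[P] P} (hψ : IsFrobeniusForm ψ) {z : P}
    (hz : z ≠ 0) {v : A} (h : ∀ t, z ∣ ψ (t * v)) : ∃ v', v = z • v' := by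
  choose q hq using h
  obtain ⟨c, hc⟩ := hψ.exists_eq
    ({ toFun := q
       map_add' := fun a c => mul_left_cancel₀ hz (by rw [← hq, mul_add, ← hq, ← hq, add_mul, map_add])
       map_smul' := fun p a => mul_left_cancel₀ hz (by
        rw [← hq, smul_mul_assoc, map_smul, hq, RingHom.id_apply, smul_eq_mul, smul_eq_mul,
          mul_left_comm]) } : A →ₗ[P] P)
  refine ⟨c, hψ.ext fun t => ?_⟩
  rw [mul_smul_comm, map_smul, hc, hq]
  rfl

omit [IsDomain P] [IsPrincipalIdealRing P] in
-- A linear form on a free module may be prescribed on a basis, where the values of ε are lifted to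
-- constants of P.
theorem exists_linearMap_augmentation (ε : A →ₐ[k] k) :
    ∃ f : A →ₗ[P] P, ∀ a, ε (algebraMap P A (f a)) = ε a := by
  let b := Module.Free.chooseBasis P A
  let η : P →+* k := (ε : A →+* k).comp (algebraMap P A)
  let f : A →ₗ[P] P := b.constr P fun i => algebraMap k P (ε (b i))
  let f₁ : A →ₛₗ[η] k :=
    { toFun := fun a => η (f a)
      map_add' := fun a c => by rw [map_add, map_add]
      map_smul' := fun p a => by rw [map_smul, smul_eq_mul, map_mul]; rfl }
  let f₂ : A →ₛₗ[η] k :=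
    { toFun := fun a => ε a
      map_add' := fun a c => by rw [map_add]
      map_smul' := fun p a => by rw [Algebra.smul_def, map_mul]; rfl }
  have h : f₁ = f₂ := b.ext fun i => by
    change ε (algebraMap P A (f (b i))) = ε (b i)
    rw [Module.Basis.constr_basis, ← IsScalarTower.algebraMap_apply k P A, AlgHom.commutes]
    rfl
  exact ⟨f, fun a => LinearMap.congr_fun h a⟩

variable (ε : A →ₐ[k] k) {ψ : A →ₗ[P] P} (hψ : IsFrobeniusForm ψ) {z : P} (hz0 : z ≠ 0)
  (hz : ∀ p, ε (algebraMap P A p) = 0 ↔ z ∣ p)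

/-- The elements which are killed by the augmentation ideal modulo `z`. -/
def IsSocle (z : P) (v : A) : Prop := ∀ t, ∃ a, t * v = ε t • v + z • a

omit [IsPrincipalIdealRing P] [Module.Free P A] in
include hψ hz0 hz in
variable {ε} in
-- From t v ≡ ε(t) v follows ψ(t v) ≡ ε(t) ψ(v) modulo z. So the class of v modulo z is detected by
-- the single scalar ε(ψ(v)), and the socle elements modulo z form at most a line.
theorem IsSocle.exists_eq_smul {v : A} (hv : IsSocle ε z v) (h : ε (algebraMap P A (ψ v)) = 0) :
    ∃ v', v = z • v' := by
  refine hψ.exists_eq_smul hz0 fun t => ?_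
  obtain ⟨a, ha⟩ := hv t
  rw [ha, map_add, LinearMap.map_smul_of_tower, LinearMap.map_smul, smul_eq_mul]
  rw [Algebra.smul_def]
  exact dvd_add (((hz _).1 h).mul_left _) (dvd_mul_right _ _)

omit [IsPrincipalIdealRing P] in
include hψ hz0 hz in
-- Take v representing a lift f of the augmentation. Then ψ(s (t v - ε(t) v)) = f(s t) - ε(t) f(s),
-- which ε kills; hence it is divisible by z.
theorem exists_isSocle : ∃ v : A, IsSocle ε z v ∧ ε (algebraMap P A (ψ v)) ≠ 0 := by
  obtain ⟨f, hf⟩ := exists_linearMap_augmentation (P := P) ε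
  obtain ⟨v, hv⟩ := hψ.exists_eq f
  refine ⟨v, fun t => ?_, ?_⟩
  · obtain ⟨a, ha⟩ := hψ.exists_eq_smul hz0 (v := t * v - ε t • v) fun s => by
      rw [mul_sub, ← mul_assoc, mul_smul_comm, map_sub, LinearMap.map_smul_of_tower, hv, hv, ← hz,
        map_sub, map_sub, hf, Algebra.smul_def, map_mul, map_mul, map_mul, hf,
        ← IsScalarTower.algebraMap_apply k P A, AlgHom.commutes]
      simp [mul_comm]
    exact ⟨a, by rw [← ha]; abel⟩
  · have := hv 1
    rw [one_mul] at this
    rw [this, hf, map_one]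
    exact one_ne_zero

/-! ### Ext¹ of the trivial module via the augmentation ideal -/

/-- The augmentation as a map of modules. -/
noncomputable def augmentationMap : A →ₗ[A] trivialModule k A ε :=
  LinearMap.toSpanSingleton A (trivialModule k A ε) (1 : k)

theorem augmentationMap_apply (a : A) : augmentationMap ε a = ε a := mul_one (ε a)

theorem augmentationMap_surjective : Function.Surjective (augmentationMap ε) := fun c =>
  ⟨algebraMap k A c, (augmentationMap_apply ε _).trans (ε.commutes c)⟩

theorem mem_ker_augmentationMap {a : A} : a ∈ LinearMap.ker (augmentationMap ε) ↔ ε a = 0 := by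
  rw [LinearMap.mem_ker, augmentationMap_apply]
  rfl

theorem shortExact_augmentation : (augmentationMap ε).shortComplexKer.ShortExact :=
  LinearMap.shortExact_shortComplexKer (augmentationMap_surjective ε)

/-- The connecting map `Hom (ker ε, A) → Ext¹ (k, A)`. -/
noncomputable def connecting (f : LinearMap.ker (augmentationMap ε) →ₗ[A] A) :
    extTrivial k A ε 1 :=
  (shortExact_augmentation ε).extClass.comp
    (Ext.mk₀ (ModuleCat.ofHom f : (augmentationMap ε).shortComplexKer.X₁ ⟶ ModuleCat.of A A))
    (add_zero 1)

theorem connecting_surjective : Function.Surjective (connecting ε) := by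
  intro e
  have : Projective (ModuleCat.of A A) := (ModuleCat.of A A).projective_of_categoryTheory_projective
  obtain ⟨x₁, hx⟩ := Ext.contravariant_sequence_exact₃ (shortExact_augmentation ε) _ e
    (Ext.eq_zero_of_projective _) (n₀ := 0) rfl
  obtain ⟨f, rfl⟩ := Ext.homEquiv₀.symm.surjective x₁
  exact ⟨f.hom, hx⟩

theorem connecting_eq_zero_iff (f : LinearMap.ker (augmentationMap ε) →ₗ[A] A) :
    connecting ε f = 0 ↔ ∃ a, ∀ x, f x = x.1 * a := by
  constructor
  · intro h
    obtain ⟨x₂, hx⟩ := Ext.contravariant_sequence_exact₁ (shortExact_augmentation ε) _ _ _ h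
    obtain ⟨F, rfl⟩ := Ext.homEquiv₀.symm.surjective x₂
    rw [Ext.homEquiv₀_symm_apply, Ext.mk₀_comp_mk₀] at hx
    have hF := (Ext.mk₀_bijective _ _).1 hx
    refine ⟨F.hom (1 : A), fun x => ?_⟩
    have := LinearMap.congr_fun (ModuleCat.hom_ext_iff.1 hF) x
    refine this.symm.trans ?_
    change F.hom (x.1 : A) = x.1 • F.hom (1 : A)
    rw [← map_smul, smul_eq_mul, mul_one]
  · rintro ⟨a, ha⟩
    have : (ModuleCat.ofHom f : (augmentationMap ε).shortComplexKer.X₁ ⟶ ModuleCat.of A A) =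
        (augmentationMap ε).shortComplexKer.f ≫ ModuleCat.ofHom (LinearMap.toSpanSingleton A A a) :=
      ModuleCat.hom_ext (LinearMap.ext fun x => ha x)
    rw [connecting, this, ← Ext.mk₀_comp_mk₀]
    exact ShortComplex.ShortExact.extClass_comp_assoc _ _

theorem connecting_sub (f f' : LinearMap.ker (augmentationMap ε) →ₗ[A] A) :
    connecting ε (f - f') = connecting ε f - connecting ε f' := by
  rw [eq_sub_iff_add_eq, connecting, connecting, connecting, ← Ext.comp_add, ← Ext.mk₀_add,
    ← ModuleCat.ofHom_add, sub_add_cancel]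

theorem connecting_smul (c : k) (f : LinearMap.ker (augmentationMap ε) →ₗ[A] A) :
    connecting ε (c • f) = c • connecting ε f := by
  rw [connecting, connecting, ← Ext.comp_smul, ← Ext.mk₀_smul]
  congr 2
  exact ModuleCat.hom_ext (LinearMap.ext fun x => Algebra.smul_def c (f x))

theorem extRightAct_connecting (f : LinearMap.ker (augmentationMap ε) →ₗ[A] A) (a : A) :
    extRightAct ε (connecting ε f) a =
      connecting ε (LinearMap.toSpanSingleton A A a ∘ₗ f) := by
  rw [extRightAct, connecting, Ext.comp_assoc_of_third_deg_zero, Ext.mk₀_comp_mk₀]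
  rfl

variable {ε} in
/-- The value of a map `ker ε → A` at `z`. -/
noncomputable def valueAt (h : ε (algebraMap P A z) = 0) (f : LinearMap.ker (augmentationMap ε) →ₗ[A] A) : A :=
  f ⟨algebraMap P A z, (mem_ker_augmentationMap ε).2 h⟩

omit [IsDomain P] [IsPrincipalIdealRing P] [Algebra k P] [IsScalarTower k P A] [Module.Free P A] in
variable {ε} in
-- As z is central, x f(z) = f(x z) = z f(x). Where multiplication by z is injective, f is therefore
-- determined by its value at z.
theorem mul_valueAt (h : ε (algebraMap P A z) = 0)
    (f : LinearMap.ker (augmentationMap ε) →ₗ[A] A) (x : LinearMap.ker (augmentationMap ε)) :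
    x.1 * valueAt h f = z • f x := by
  rw [valueAt, ← smul_eq_mul, ← map_smul, Algebra.smul_def, ← smul_eq_mul, ← map_smul]
  congr 1
  exact Subtype.ext (Algebra.commutes z x.1).symm

omit [IsDomain P] [IsPrincipalIdealRing P] [Algebra k P] [IsScalarTower k P A] [Module.Free P A] in
variable {ε} in
theorem isSocle_valueAt (h : ε (algebraMap P A z) = 0)
    (f : LinearMap.ker (augmentationMap ε) →ₗ[A] A) : IsSocle ε z (valueAt h f) := by
  intro t
  have ht : t - algebraMap k A (ε t) ∈ LinearMap.ker (augmentationMap ε) :=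
    (mem_ker_augmentationMap ε).2 (by rw [map_sub, AlgHom.commutes]; exact sub_self _)
  refine ⟨f ⟨_, ht⟩, ?_⟩
  rw [← mul_valueAt h, sub_mul, Algebra.smul_def]
  abel

omit [Algebra k P] [IsScalarTower k P A] in
include hz0 in
variable {ε} in
-- If f(z) = z v, cancelling z in x f(z) = z f(x) shows that f is right multiplication by v, which
-- extends to all of A.
theorem connecting_eq_zero (h : ε (algebraMap P A z) = 0)
    {f : LinearMap.ker (augmentationMap ε) →ₗ[A] A} (hf : ∃ v, valueAt h f = z • v) :
    connecting ε f = 0 := by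
  obtain ⟨v, hv⟩ := hf
  refine (connecting_eq_zero_iff ε f).2 ⟨v, fun x => ?_⟩
  have h1 := mul_valueAt h f x
  rw [hv, mul_smul_comm] at h1
  exact (smul_right_injective A hz0 h1).symm

omit [Algebra k P] [IsScalarTower k P A] in
include hz0 in
variable {ε} in
-- The map is x ↦ x v / z: the socle condition makes x v divisible by z for every x in the
-- augmentation ideal.
theorem IsSocle.exists_valueAt (h : ε (algebraMap P A z) = 0) {v : A} (hv : IsSocle ε z v) :
    ∃ f, valueAt h f = v := by
  have h1 : ∀ x : LinearMap.ker (augmentationMap ε), ∃ a, x.1 * v = z • a := fun x => by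
    obtain ⟨a, ha⟩ := hv x.1
    rw [(mem_ker_augmentationMap ε).1 x.2, zero_smul, zero_add] at ha
    exact ⟨a, ha⟩
  choose f hf using h1
  have hi := smul_right_injective A hz0
  refine ⟨{ toFun := f
            map_add' := fun x y => hi ?_
            map_smul' := fun a x => hi ?_ }, hi ?_⟩
  · change z • f (x + y) = z • (f x + f y)
    rw [smul_add, ← hf, ← hf, ← hf, Submodule.coe_add, add_mul]
  · change z • f (a • x) = z • (a * f x)
    rw [← mul_smul_comm, ← hf, ← hf, Submodule.coe_smul, smul_eq_mul, mul_assoc]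
  · change z • f _ = z • v
    rw [← hf, Algebra.smul_def]

include hψ hz0 hz in
-- Evaluation at z identifies Ext¹(k, A) with the socle elements of A modulo z, a line by
-- `exists_isSocle` and `IsSocle.exists_eq_smul`. Its nonvanishing also shows that the injective
-- dimension is not 0.
theorem isLeftASGorenstein_one : IsLeftASGorenstein k A ε 1 := by
  have hε : ε (algebraMap P A z) = 0 := (hz z).2 dvd_rfl
  have hinj := hψ.hasInjectiveDimensionLT_two
  obtain ⟨v₀, hv₀, hv₀'⟩ := exists_isSocle ε hψ hz0 hz
  obtain ⟨f₀, rfl⟩ := hv₀.exists_valueAt hz0 hε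
  have hne : connecting ε f₀ ≠ 0 := by
    intro h
    obtain ⟨a, ha⟩ := (connecting_eq_zero_iff ε f₀).1 h
    apply hv₀'
    rw [valueAt, ha, ← Algebra.smul_def, map_smul, smul_eq_mul, map_mul, map_mul, hε, zero_mul]
  refine ⟨le_antisymm ?_ ?_, ?_, ?_⟩
  · exact (injectiveDimension_le_iff _ 1).2 hinj
  · refine (injectiveDimension_ge_iff _ 1).2 fun h => hne ?_
    exact Ext.eq_zero_of_hasInjectiveDimensionLT _ 1 le_rfl
  · refine finrank_eq_one_iff'.2 ⟨connecting ε f₀, hne, fun e => ?_⟩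
    obtain ⟨f, rfl⟩ := connecting_surjective ε e
    refine ⟨ε (algebraMap P A (ψ (valueAt hε f))) * (ε (algebraMap P A (ψ (valueAt hε f₀))))⁻¹, ?_⟩
    rw [← connecting_smul, ← sub_eq_zero, ← connecting_sub]
    refine connecting_eq_zero hz0 hε
      (IsSocle.exists_eq_smul hψ hz0 hz (isSocle_valueAt hε _) ?_)
    have h1 : ∀ c : k, valueAt hε (c • f₀ - f) = c • valueAt hε f₀ - valueAt hε f := fun c => rfl
    rw [h1, map_sub, LinearMap.map_smul_of_tower, map_sub, map_sub, Algebra.smul_def, map_mul,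
      map_mul, ← IsScalarTower.algebraMap_apply k P A, AlgHom.commutes]
    change _ * _ - _ = (0 : k)
    rw [Algebra.algebraMap_self, RingHom.id_apply, inv_mul_cancel_right₀ hv₀', sub_self]
  · intro i hi
    refine subsingleton_of_forall_eq 0 fun e => ?_
    obtain _ | _ | i := i
    · obtain ⟨f, rfl⟩ := Ext.homEquiv₀.symm.surjective e
      rw [Ext.homEquiv₀_symm_apply, Ext.mk₀_eq_zero_iff]
      refine ModuleCat.hom_ext (LinearMap.ext fun c => ?_)
      -- In degree 0, the image of a map k → A is killed by z, while A is torsion-free over P.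
      have h1 : algebraMap P A z • c = 0 := @mul_eq_zero_of_left k _ _ hε c
      have h2 := congrArg f.hom h1
      rw [map_smul, map_zero, smul_eq_mul, ← Algebra.smul_def] at h2
      exact (smul_eq_zero.1 h2).resolve_left hz0
    · exact absurd rfl hi
    · exact Ext.eq_zero_of_hasInjectiveDimensionLT _ 2 (by omega)

include hψ hz0 hz in
-- Modulo z every value f(z) is a multiple of v, and right multiplication of f by a replaces f(z) by
-- f(z) a. So the right action on Ext¹ can be read off from v a ≡ π(a) v.
theorem extRightAct_eq_smul (π : A →ₐ[k] k) {v : A} (hv : IsSocle ε z v)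
    (hv' : ε (algebraMap P A (ψ v)) ≠ 0) (hπ : ∀ a, ∃ c, v * a = π a • v + z • c)
    (e : extTrivial k A ε 1) (a : A) : extRightAct ε e a = π a • e := by
  have hε : ε (algebraMap P A z) = 0 := (hz z).2 dvd_rfl
  obtain ⟨f, rfl⟩ := connecting_surjective ε e
  rw [extRightAct_connecting, ← connecting_smul, ← sub_eq_zero, ← connecting_sub]
  refine connecting_eq_zero hz0 hε ?_
  have h1 : valueAt hε (LinearMap.toSpanSingleton A A a ∘ₗ f - π a • f) =
      valueAt hε f * a - π a • valueAt hε f := rfl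
  obtain ⟨f₀, rfl⟩ := hv.exists_valueAt hz0 hε
  obtain ⟨d, hd⟩ : ∃ d : k, ∃ v', valueAt hε (f - d • f₀) = z • v' := by
    refine ⟨ε (algebraMap P A (ψ (valueAt hε f))) * (ε (algebraMap P A (ψ (valueAt hε f₀))))⁻¹,
      IsSocle.exists_eq_smul hψ hz0 hz (isSocle_valueAt hε _) ?_⟩
    have h1 : ∀ c : k, valueAt hε (f - c • f₀) = valueAt hε f - c • valueAt hε f₀ := fun c => rfl
    rw [h1, map_sub, LinearMap.map_smul_of_tower, map_sub, map_sub, Algebra.smul_def, map_mul,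
      map_mul, ← IsScalarTower.algebraMap_apply k P A, AlgHom.commutes]
    change _ - _ * _ = (0 : k)
    rw [Algebra.algebraMap_self, RingHom.id_apply, inv_mul_cancel_right₀ hv', sub_self]
  obtain ⟨v', hd⟩ := hd
  have h2 : valueAt hε f = d • valueAt hε f₀ + z • v' := by
    rw [← hd]
    change valueAt hε f = d • valueAt hε f₀ + (valueAt hε f - d • valueAt hε f₀)
    abel
  obtain ⟨c, hc⟩ := hπ a
  refine ⟨d • c + v' * a - π a • v', ?_⟩
  rw [h1, h2, add_mul, smul_mul_assoc, hc, smul_mul_assoc, smul_add, smul_sub, smul_add, smul_add,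
    smul_comm d (π a), smul_comm d z, smul_comm (π a) z]
  abel

end Augmented

/-! ### Criteria for Frobenius forms -/

section Frobenius

variable {P A : Type*} [CommRing P] [Ring A] [Algebra P A]

open MulOpposite

/-- The family v, rescaled by inverse units, gives explicit preimages of all forms. Since the dual
of M and N are free of the same finite rank, surjectivity implies injectivity; v need not be known
to be a basis. -/
theorem LinearMap.bijective_of_dual_family {M N ι : Type*} [Finite ι] [AddCommGroup M]
    [Module P M] [AddCommGroup N] [Module P N] (B : N →ₗ[P] M →ₗ[P] P) (b : Module.Basis ι P M)
    (b' : Module.Basis ι P N) (v : ι → N)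
    (h : ∀ i, IsUnit (B (v i) (b i))) (h' : ∀ i j, i ≠ j → B (v i) (b j) = 0) :
    Function.Bijective B := by
  classical
  have := Fintype.ofFinite ι
  have hs : Function.Surjective B := by
    intro f
    refine ⟨∑ i, (f (b i) * Ring.inverse (B (v i) (b i))) • v i, b.ext fun j => ?_⟩
    rw [map_sum, LinearMap.sum_apply, Finset.sum_eq_single j]
    · rw [map_smul, LinearMap.smul_apply, smul_eq_mul, mul_assoc, Ring.inverse_mul_cancel _ (h j),
        mul_one]
    · intro i _ hij
      rw [map_smul, LinearMap.smul_apply, h' i j hij, smul_zero]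
    · simp
  refine ⟨?_, hs⟩
  let e : Module.Dual P M ≃ₗ[P] N := b.toDualEquiv.symm.trans (b.equiv b' (Equiv.refl _))
  have : Module.Finite P N := .of_basis b'
  have hi := OrzechProperty.injective_of_surjective_endomorphism (e.toLinearMap ∘ₗ B)
    (e.surjective.comp hs)
  exact fun x y hxy => hi (congrArg e hxy)

end Frobenius

section Frobenius

variable {P A : Type u} [CommRing P] [Ring A] [Algebra P A]

open MulOpposite

theorem IsFrobeniusForm.of_dual_family {ι : Type*} [Finite ι] {ψ : A →ₗ[P] P}
    (b : Module.Basis ι P A) (v : ι → A) (h : ∀ i, IsUnit (ψ (b i * v i)))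
    (h' : ∀ i j, i ≠ j → ψ (b j * v i) = 0) : IsFrobeniusForm ψ :=
  LinearMap.bijective_of_dual_family ((LinearMap.mul P A).flip.compr₂ ψ) b b v h h'

/-- Passing to the opposite algebra swaps the arguments of (t, c) ↦ ψ(t c), and for finite free
modules a pairing perfect on one side is perfect on the other. -/
theorem IsFrobeniusForm.op [Module.Free P A] [Module.Finite P A] {ψ : A →ₗ[P] P}
    (hψ : IsFrobeniusForm ψ) :
    IsFrobeniusForm (ψ ∘ₗ (opLinearEquiv P : A ≃ₗ[P] Aᵐᵒᵖ).symm.toLinearMap) := by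
  have h := LinearMap.IsPerfPair.of_bijective ((LinearMap.mul P A).flip.compr₂ ψ) hψ
  have h2 := LinearMap.IsPerfPair.bijective_right ((LinearMap.mul P A).flip.compr₂ ψ)
  have h3 := ((LinearEquiv.congrLeft P P (opLinearEquiv P : A ≃ₗ[P] Aᵐᵒᵖ)).bijective.comp
    h2).comp (opLinearEquiv P : A ≃ₗ[P] Aᵐᵒᵖ).symm.bijective
  exact h3

end Frobenius

namespace LiuDatum

variable {k : Type u} [Field k] (D : LiuDatum k)

open LaurentPolynomial

/-! ### The homological integral -/

/-- The coefficient of `y ^ (n - 1)`, and there the coefficient of `1` in the basis `gⁱ`. -/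
noncomputable def frobeniusForm : D.Alg →ₗ[k[T;T⁻¹]] k[T;T⁻¹] :=
  D.basisR.coord ⟨0, D.n_pos⟩ ∘ₗ D.coef ⟨D.n - 1, Nat.sub_lt D.n_pos one_pos⟩

theorem frobeniusForm_U_mul_y_pow (v : D.G) {m : ℕ} (hm : m < D.n) :
    D.frobeniusForm ((D.U v : D.Alg) * D.y ^ m) =
      if m = D.n - 1 then D.basisR.coord ⟨0, D.n_pos⟩ (D.s v) else 0 := by
  have := D.coef_incl_mul_y_pow (D.s v) ⟨D.n - 1, Nat.sub_lt D.n_pos one_pos⟩ ⟨m, hm⟩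
  rw [frobeniusForm, LinearMap.comp_apply, ← incl_s, this]
  simp only [Fin.mk.injEq, eq_comm (a := D.n - 1)]
  split_ifs <;> simp

theorem coord_s_gG_pow {m : ℕ} (hm : m < D.n) :
    D.basisR.coord ⟨0, D.n_pos⟩ (D.s (D.gG ^ m)) = if m = 0 then 1 else 0 := by
  have h := D.basisR_apply ⟨m, hm⟩
  rw [← h, Module.Basis.coord_apply, Module.Basis.repr_self, Finsupp.single_apply]
  simp

theorem y_pow_add_n (m : ℕ) : D.y ^ (m + D.n) = D.cP • D.y ^ m := by
  rw [pow_add, y_pow_n', ← laurentHom_cP, ← algebraMap_Alg, ← Algebra.commutes, ← Algebra.smul_def]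

/-- The dual family is yⁿ⁻¹⁻ʲ g⁻ⁱ. Its product with gⁱ yʲ is yⁿ⁻¹ up to a root of unity; for any
other basis element either the y-degree misses n - 1 or the power of g is not a power of x. -/
theorem isFrobeniusForm : IsFrobeniusForm D.frobeniusForm := by
  refine .of_dual_family D.basisP
    (fun p => D.y ^ (D.n - 1 - (p.2 : ℕ)) * (D.U (D.gG ^ (p.1 : ℕ))⁻¹ : D.Algˣ)) ?_ ?_
  · rintro ⟨i, j⟩
    have hj : (j : ℕ) + (D.n - 1 - j) = D.n - 1 := by omega
    rw [basisP_apply, mul_assoc, ← mul_assoc (D.y ^ _), ← pow_add, hj, pow_y_mul_U,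
      mul_smul_comm, ← mul_assoc, ← Units.val_mul, ← map_mul, mul_inv_cancel,
      LinearMap.map_smul_of_tower, frobeniusForm_U_mul_y_pow _ _ (by have := D.n_pos; omega),
      if_pos rfl]
    have := D.coord_s_gG_pow (m := 0) D.n_pos
    rw [pow_zero, if_pos rfl] at this
    rw [this, ← Algebra.algebraMap_eq_smul_one]
    exact (((D.χ _).isUnit.pow _)).map _
  · rintro ⟨i, j⟩ ⟨i', j'⟩ hne
    obtain ⟨q, hq⟩ : ∃ q, (j' : ℕ) + (D.n - 1 - j) = q := ⟨_, rfl⟩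
    rw [basisP_apply, mul_assoc, ← mul_assoc (D.y ^ _), ← pow_add, hq, pow_y_mul_U,
      mul_smul_comm, ← mul_assoc, ← Units.val_mul, ← map_mul,
      LinearMap.map_smul_of_tower]
    rcases lt_or_ge q D.n with hqn | hqn
    · rw [frobeniusForm_U_mul_y_pow _ _ hqn]
      split_ifs with hq'
      · have hj : j' = j := Fin.ext (by omega)
        subst hj
        have hi : (i : ℕ) ≠ i' := fun h => hne (by rw [Fin.ext h])
        rcases lt_or_gt_of_ne hi with h | h
        · obtain ⟨d, hd⟩ := Nat.exists_eq_add_of_lt h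
          rw [hd, add_assoc, pow_add, mul_comm (D.gG ^ _), mul_assoc, mul_inv_cancel, mul_one,
            coord_s_gG_pow _ (by omega), if_neg (by omega), smul_zero]
        · obtain ⟨d, hd⟩ := Nat.exists_eq_add_of_lt h
          -- A negative power of g is brought into the range 0 < e < n of basis exponents by gⁿ =
          -- xʷ.
          have e1 : D.gG ^ (i' : ℕ) * (D.gG ^ (i : ℕ))⁻¹ =
              D.xG ^ (-(D.w : ℤ)) * D.gG ^ (D.n - (d + 1)) := by
            rw [zpow_neg, zpow_natCast, ← gG_pow_n, mul_inv_eq_iff_eq_mul, mul_assoc,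
              ← pow_add, hd, eq_inv_mul_iff_mul_eq, ← pow_add]
            congr 1
            omega
          rw [e1, s_mul, ← T_smul_R, map_smul, coord_s_gG_pow _ (by have := D.n_pos; omega),
            if_neg (by omega), smul_zero, smul_zero]
      · rw [smul_zero]
    · obtain ⟨d, rfl⟩ := Nat.exists_eq_add_of_le hqn
      -- Since j' + (n - 1 - j) ≤ 2n - 2, reduction by yⁿ = c leaves y-degree at most n - 2, which
      -- the form does not see.
      rw [add_comm D.n d, y_pow_add_n, mul_smul_comm, map_smul,
        frobeniusForm_U_mul_y_pow _ _ (by omega), if_neg (by omega), smul_zero, smul_zero]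

theorem counit_laurent_T (a : ℤ) :
    Bialgebra.counitAlgHom k D.Alg (algebraMap k[T;T⁻¹] D.Alg (T a)) = 1 := by
  rw [algebraMap_Alg, laurentHom_T, incl_s]
  exact D.counit_U _

theorem T_one_sub_one_dvd (a : ℤ) : (T 1 - 1 : k[T;T⁻¹]) ∣ T a - 1 := by
  induction a using Int.induction_on with
  | zero => rw [T_zero, sub_self]; exact dvd_zero _
  | succ a ih =>
    have : (T (a + 1) - 1 : k[T;T⁻¹]) = (T 1 - 1) * T a + (T a - 1) := by
      rw [sub_mul, ← T_add, add_comm (1 : ℤ)]; ring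
    rw [this]
    exact dvd_add (dvd_mul_right _ _) ih
  | pred a ih =>
    have : (T (-a - 1) - 1 : k[T;T⁻¹]) = (T (-a) - 1) - (T 1 - 1) * T (-a - 1) := by
      rw [sub_mul, ← T_add]; ring_nf
    rw [this]
    exact dvd_sub ih (dvd_mul_right _ _)

theorem T_one_sub_one_ne_zero : (T 1 - 1 : k[T;T⁻¹]) ≠ 0 := by
  intro h
  rw [sub_eq_zero, ← T_zero] at h
  have := congrArg (fun p : k[T;T⁻¹] => AddMonoidAlgebra.coeff p 0) h
  simp [T_apply] at this

/-- Modulo T - 1 every power of T is 1, so every Laurent polynomial is congruent to its counit. -/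
theorem counit_eq_zero_iff (p : k[T;T⁻¹]) :
    Bialgebra.counitAlgHom k D.Alg (algebraMap k[T;T⁻¹] D.Alg p) = 0 ↔ (T 1 - 1) ∣ p := by
  let η : k[T;T⁻¹] →ₐ[k] k := (Bialgebra.counitAlgHom k D.Alg).comp (IsScalarTower.toAlgHom k _ _)
  have hT : ∀ a, η (T a) = 1 := D.counit_laurent_T
  have key : ∀ p, (T 1 - 1 : k[T;T⁻¹]) ∣ p - algebraMap k _ (η p) := by
    intro p
    rw [← Ideal.mem_span_singleton, ← Ideal.Quotient.eq]
    have : (Ideal.Quotient.mkₐ k (Ideal.span {(T 1 - 1 : k[T;T⁻¹])})).toLinearMap =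
        (Algebra.linearMap k _) ∘ₗ η.toLinearMap := by
      refine linearMap_ext fun a => ?_
      rw [LinearMap.comp_apply, AlgHom.toLinearMap_apply, AlgHom.toLinearMap_apply, hT,
        Algebra.linearMap_apply, map_one,
        ← map_one (Ideal.Quotient.mkₐ k (Ideal.span {(T 1 - 1 : k[T;T⁻¹])}))]
      exact (Ideal.Quotient.eq).2 (Ideal.mem_span_singleton.2 (T_one_sub_one_dvd a))
    exact LinearMap.congr_fun this p
  change η p = 0 ↔ _
  constructor
  · intro h
    have := key p
    rwa [h, map_zero, sub_zero] at this
  · rintro ⟨q, rfl⟩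
    rw [map_mul, map_sub, hT, map_one, sub_self, zero_mul]

theorem induction_U {C : D.Alg → Prop} (hc : ∀ c, C (algebraMap k _ c)) (hU : ∀ v, C (D.U v))
    (hy : C D.y) (hadd : ∀ t t', C t → C t' → C (t + t')) (hmul : ∀ t t', C t → C t' → C (t * t'))
    (t : D.Alg) : C t := by
  induction t using D.induction with
  | hc c => exact hc c
  | hh => rw [← U_hG]; exact hU _
  | hh' => rw [← U_hG, ← map_inv]; exact hU _
  | hf => rw [← U_fG]; exact hU _
  | hy => exact hy
  | hadd t t' h h' => exact hadd _ _ h h'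
  | hmul t t' h h' => exact hmul _ _ h h'

/-! ### The left integral modulo x - 1 -/

/-- A generator of the left integral modulo `x - 1`. -/
noncomputable def integral : D.Alg :=
  (∑ i ∈ Finset.range D.n, (D.U (D.gG ^ i) : D.Alg)) * D.y ^ (D.n - 1)

theorem frobeniusForm_integral : D.frobeniusForm D.integral = 1 := by
  rw [integral, Finset.sum_mul, map_sum, Finset.sum_eq_single 0]
  · rw [frobeniusForm_U_mul_y_pow _ _ (Nat.sub_lt D.n_pos one_pos), if_pos rfl,
      coord_s_gG_pow _ D.n_pos, if_pos rfl]
  · intro i hi hi0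
    rw [frobeniusForm_U_mul_y_pow _ _ (Nat.sub_lt D.n_pos one_pos), if_pos rfl,
      coord_s_gG_pow _ (Finset.mem_range.1 hi), if_neg hi0]
  · intro h; exact absurd (Finset.mem_range.2 D.n_pos) h

theorem exists_U_xG_zpow_mul (a : ℤ) (t : D.Alg) :
    ∃ t', (D.U (D.xG ^ a) : D.Alg) * t = t + (T 1 - 1 : k[T;T⁻¹]) • t' := by
  obtain ⟨q, hq⟩ := T_one_sub_one_dvd (k := k) a
  refine ⟨q • t, ?_⟩
  rw [smul_smul, ← hq, sub_smul, one_smul, T_smul_Alg, add_sub_cancel]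

/-- Multiplication by g permutes the gⁱ cyclically up to replacing gⁿ = xʷ by 1, which is harmless
modulo x - 1. -/
theorem exists_U_mul_integral (v : D.G) :
    ∃ t, (D.U v : D.Alg) * D.integral = D.integral + (T 1 - 1 : k[T;T⁻¹]) • t := by
  have hg : ∀ i, ∃ t, (D.U (D.gG ^ i) : D.Alg) * D.integral =
      D.integral + (T 1 - 1 : k[T;T⁻¹]) • t := by
    intro i
    induction i with
    | zero => exact ⟨0, by simp⟩
    | succ i ih =>
      obtain ⟨t, ht⟩ := ih
      obtain ⟨t', ht'⟩ := D.exists_U_xG_zpow_mul D.w (D.y ^ (D.n - 1))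
      rw [zpow_natCast, ← gG_pow_n] at ht'
      refine ⟨t' + (D.U D.gG : D.Alg) * t, ?_⟩
      have h1 : (D.U D.gG : D.Alg) * D.integral =
          D.integral + (T 1 - 1 : k[T;T⁻¹]) • t' := by
        have h2 := Finset.sum_range_succ' (fun i => (D.U (D.gG ^ i) : D.Alg) * D.y ^ (D.n - 1)) D.n
        rw [Finset.sum_range_succ, ht', ← Finset.sum_mul, ← Finset.sum_mul, ← integral, pow_zero,
          map_one, Units.val_one, one_mul, ← add_assoc, add_right_comm] at h2
        rw [add_right_cancel h2, integral, ← mul_assoc, Finset.mul_sum]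
        simp only [← Units.val_mul, ← map_mul, ← pow_succ']
      rw [pow_succ', map_mul, Units.val_mul, mul_assoc, ht, mul_add, h1, mul_smul_comm, smul_add,
        add_assoc]
  obtain ⟨a, i, _, rfl⟩ := D.exists_eq_xG_gG v
  obtain ⟨t, ht⟩ := hg i
  obtain ⟨t', ht'⟩ := D.exists_U_xG_zpow_mul a (D.integral + (T 1 - 1 : k[T;T⁻¹]) • t)
  exact ⟨t + t', by rw [map_mul, Units.val_mul, mul_assoc, ht, ht', smul_add, add_assoc]⟩

/-- The power yⁿ = 1 - xʷ is central and divisible by x - 1. -/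
theorem exists_mul_y_pow_n (t t' : D.Alg) :
    ∃ a, t * D.y ^ D.n * t' = (T 1 - 1 : k[T;T⁻¹]) • a := by
  obtain ⟨q, hq⟩ := T_one_sub_one_dvd (k := k) D.w
  have : D.cP = (T 1 - 1) * -q := by rw [mul_neg, ← hq, neg_sub, cP]
  refine ⟨-q • (t * t'), ?_⟩
  have h := D.y_pow_add_n 0
  rw [zero_add, pow_zero] at h
  rw [h, mul_smul_comm, mul_one, smul_mul_assoc, this, mul_smul]

theorem isSocle_integral : IsSocle (Bialgebra.counitAlgHom k D.Alg) (T 1 - 1 : k[T;T⁻¹])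
    D.integral := by
  intro t
  induction t using D.induction_U with
  | hc c =>
    exact ⟨0, by rw [AlgHom.commutes, Algebra.algebraMap_self, RingHom.id_apply, smul_zero,
      add_zero, Algebra.smul_def]⟩
  | hU v =>
    rw [show Bialgebra.counitAlgHom k D.Alg (D.U v) = 1 from D.counit_U v, one_smul]
    exact D.exists_U_mul_integral v
  | hy =>
    rw [show Bialgebra.counitAlgHom k D.Alg D.y = 0 from D.counit_y, zero_smul, integral,
      ← mul_assoc, Finset.mul_sum]
    simp only [y_mul_U, zero_add]
    obtain ⟨a, ha⟩ := D.exists_mul_y_pow_n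
      (∑ i ∈ Finset.range D.n, (D.χ (D.gG ^ i) : k) • (D.U (D.gG ^ i) : D.Alg)) 1
    refine ⟨a, ?_⟩
    rw [← ha, mul_one, ← Nat.sub_add_cancel (show 1 ≤ D.n from D.n_pos), pow_succ', ← mul_assoc,
      Nat.add_sub_cancel, Finset.sum_mul]
    simp only [Finset.sum_mul, smul_mul_assoc]
  | hadd t t' h h' =>
    obtain ⟨a, ha⟩ := h
    obtain ⟨a', ha'⟩ := h'
    exact ⟨a + a', by rw [add_mul, ha, ha', map_add, add_smul, smul_add]; abel⟩
  | hmul t t' h h' =>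
    obtain ⟨a, ha⟩ := h
    obtain ⟨a', ha'⟩ := h'
    exact ⟨Bialgebra.counitAlgHom k D.Alg t' • a + t * a', by
      rw [mul_assoc, ha', mul_add, mul_smul_comm, ha, mul_smul_comm, map_mul, smul_add, smul_add,
        smul_smul, mul_comm, smul_comm (T 1 - 1 : k[T;T⁻¹]), add_assoc]⟩

theorem exists_integral_mul (t : D.Alg) :
    ∃ a, D.integral * t = D.π t • D.integral + (T 1 - 1 : k[T;T⁻¹]) • a := by
  induction t using D.induction_U with
  | hc c =>
    exact ⟨0, by rw [AlgHom.commutes, Algebra.algebraMap_self, RingHom.id_apply, smul_zero,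
      add_zero, ← Algebra.commutes, Algebra.smul_def]⟩
  | hU v =>
    obtain ⟨t, ht⟩ := D.exists_U_mul_integral v
    refine ⟨D.π (D.U v) • t, ?_⟩
    -- Moving v to the left past yⁿ⁻¹ produces χ(v)ⁿ⁻¹, which is χ(v)⁻¹ as χⁿ = 1; hence the shape
    -- of π.
    have h1 : (D.χ v : k) ^ (D.n - 1) = ((D.χ v)⁻¹ : kˣ) := by
      rw [← Units.val_pow_eq_pow_val]
      congr 1
      rw [eq_inv_iff_mul_eq_one, ← pow_succ, Nat.sub_add_cancel (show 1 ≤ D.n from D.n_pos),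
        χ_pow_n]
    have h2 : D.integral * D.U v = D.π (D.U v) • ((D.U v : D.Alg) * D.integral) := by
      rw [π_U, ← h1, integral, mul_assoc, pow_y_mul_U, mul_smul_comm, ← mul_assoc, ← mul_assoc,
        Finset.sum_mul, Finset.mul_sum]
      simp only [← Units.val_mul, ← map_mul, mul_comm]
    rw [h2, ht, smul_add, smul_comm (T 1 - 1 : k[T;T⁻¹])]
  | hy =>
    obtain ⟨a, ha⟩ := D.exists_mul_y_pow_n
      (∑ i ∈ Finset.range D.n, (D.U (D.gG ^ i) : D.Alg)) 1
    refine ⟨a, ?_⟩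
    rw [← ha, π_y, zero_smul, zero_add, mul_one, integral, mul_assoc, ← pow_succ,
      Nat.sub_add_cancel (show 1 ≤ D.n from D.n_pos)]
  | hadd t t' h h' =>
    obtain ⟨a, ha⟩ := h
    obtain ⟨a', ha'⟩ := h'
    exact ⟨a + a', by rw [mul_add, ha, ha', map_add, add_smul, smul_add]; abel⟩
  | hmul t t' h h' =>
    obtain ⟨a, ha⟩ := h
    obtain ⟨a', ha'⟩ := h'
    exact ⟨D.π t • a' + a * t', by
      rw [← mul_assoc, ha, add_mul, smul_mul_assoc, ha', smul_mul_assoc, map_mul, smul_add,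
        smul_add, smul_smul, smul_comm (T 1 - 1 : k[T;T⁻¹]), add_assoc]⟩

theorem isIntegralCharacter_π : IsIntegralCharacter (Bialgebra.counitAlgHom k D.Alg) D.π := by
  have : Module.Free k[T;T⁻¹] D.Algᵐᵒᵖ := .of_equiv (MulOpposite.opLinearEquiv k[T;T⁻¹])
  refine ⟨1, ⟨isLeftASGorenstein_one _ D.isFrobeniusForm T_one_sub_one_ne_zero
    D.counit_eq_zero_iff, isLeftASGorenstein_one _ D.isFrobeniusForm.op T_one_sub_one_ne_zero
    D.counit_eq_zero_iff⟩, extRightAct_eq_smul _ D.isFrobeniusForm T_one_sub_one_ne_zero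
    D.counit_eq_zero_iff D.π D.isSocle_integral ?_ D.exists_integral_mul⟩
  rw [frobeniusForm_integral, map_one, map_one]
  exact one_ne_zero

end LiuDatum

/-! ### Finite global dimension -/

section Derivation

variable {k : Type*} [Field k]

open LaurentPolynomial

/-- The Euler operator `T ^ a ↦ a T ^ a`. -/
noncomputable def LaurentPolynomial.euler : k[T;T⁻¹] →ₗ[k] k[T;T⁻¹] :=
  (AddMonoidAlgebra.basis ℤ k).constr k fun a => (a : k) • T a

theorem LaurentPolynomial.euler_T (a : ℤ) : euler (T a : k[T;T⁻¹]) = (a : k) • T a := by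
  have h : (T a : k[T;T⁻¹]) = AddMonoidAlgebra.basis ℤ k a := by
    rw [AddMonoidAlgebra.basis_apply]; rfl
  rw [h, euler, Module.Basis.constr_basis, ← h]

theorem LaurentPolynomial.euler_T_one_mul (p : k[T;T⁻¹]) :
    euler (T 1 * p) = T 1 * euler p + T 1 * p := by
  have : euler ∘ₗ LinearMap.mulLeft k (T 1 : k[T;T⁻¹]) =
      LinearMap.mulLeft k (T 1) ∘ₗ euler + LinearMap.mulLeft k (T 1) := by
    refine LaurentPolynomial.linearMap_ext fun a => ?_
    simp only [LinearMap.comp_apply, LinearMap.add_apply, LinearMap.mulLeft_apply]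
    rw [← T_add, euler_T, euler_T, mul_smul_comm, ← T_add]
    push_cast
    rw [add_smul, one_smul, add_comm]
  exact LinearMap.congr_fun this p

/-- A projective module over the Laurent polynomials carries a connection. -/
theorem LaurentPolynomial.exists_connection (M : Type*) [AddCommGroup M] [Module k M]
    [Module k[T;T⁻¹] M] [IsScalarTower k k[T;T⁻¹] M] [Module.Projective k[T;T⁻¹] M] :
    ∃ D : M →ₗ[k] M, ∀ m, D ((T 1 : k[T;T⁻¹]) • m) =
      (T 1 : k[T;T⁻¹]) • D m + (T 1 : k[T;T⁻¹]) • m := by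
  obtain ⟨s, hs⟩ := Module.projective_lifting_property
    (Finsupp.linearCombination k[T;T⁻¹] (id : M → M)) LinearMap.id
    (Finsupp.linearCombination_id_surjective _ _)
  have hs' : ∀ m, Finsupp.linearCombination k[T;T⁻¹] (id : M → M) (s m) = m :=
    LinearMap.congr_fun hs
  -- On a free module the Euler operator acts coefficientwise; the connection on M is its
  -- compression along the splitting s.
  let E : (M →₀ k[T;T⁻¹]) →ₗ[k] (M →₀ k[T;T⁻¹]) := Finsupp.mapRange.linearMap euler
  have hE : ∀ v, E ((T 1 : k[T;T⁻¹]) • v) = (T 1 : k[T;T⁻¹]) • E v + (T 1 : k[T;T⁻¹]) • v := by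
    intro v
    ext1 m
    exact euler_T_one_mul (v m)
  refine ⟨(Finsupp.linearCombination k[T;T⁻¹] id).restrictScalars k ∘ₗ E ∘ₗ s.restrictScalars k,
    fun m => ?_⟩
  simp only [LinearMap.comp_apply, LinearMap.restrictScalars_apply]
  rw [map_smul, hE, map_add, map_smul, map_smul, hs']

variable {E : Type*} [Ring E] [Algebra k E]

/-- The Leibniz rule for the commutator with d, in telescoping form. -/
theorem sum_pow_mul_commutator (d y : E) (m : ℕ) :
    ∑ i ∈ Finset.range m, y ^ i * (d * y - y * d) * y ^ (m - 1 - i) = d * y ^ m - y ^ m * d := by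
  have h : ∀ i ∈ Finset.range m, y ^ i * (d * y - y * d) * y ^ (m - 1 - i) =
      y ^ i * d * y ^ (m - i) - y ^ (i + 1) * d * y ^ (m - (i + 1)) := by
    intro i hi
    have hi := Finset.mem_range.1 hi
    rw [show m - i = m - 1 - i + 1 by omega, show m - (i + 1) = m - 1 - i by omega,
      pow_succ' y (m - 1 - i), pow_succ y i]
    noncomm_ring
  rw [Finset.sum_congr rfl h, Finset.sum_range_sub']
  simp

/-- Write S for the average of d over conjugation by g, up to the factor n. Commuting with S acts
like the logarithmic derivation with x ↦ n x and g ↦ w g, so applied to yⁿ = 1 - xʷ it gives -n w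
xʷ. By the Leibniz rule ∑ yⁱ [S, y] yⁿ⁻¹⁻ⁱ = -n w xʷ. Dividing by -n w yields xʷ, which is what y/n,
contributing yⁿ = 1 - xʷ, lacks to reach 1. -/
theorem exists_homotopy {n w : ℕ} (hn0 : (n : k) ≠ 0) (hw : (w : k) ≠ 0) {x g : Eˣ} {y d : E}
    {ξ : k} (hd : d * x = x * d + x) (hxg : Commute x g) (hg : g ^ n = x ^ w)
    (hyx : y * x = x * y) (hyg : y * g = ξ • (g * y)) (hy : y ^ n = 1 - (x : E) ^ w) :
    ∃ φ : E, φ * x = x * φ ∧ φ * g = ξ • (g * φ) ∧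
      ∑ i ∈ Finset.range n, y ^ i * φ * y ^ (n - 1 - i) = 1 := by
  have hdx : ∀ m : ℕ, d * (x : E) ^ m = x ^ m * d + (m : k) • (x : E) ^ m := by
    intro m
    induction m with
    | zero => simp
    | succ m ih =>
      rw [pow_succ, ← mul_assoc, ih, add_mul, mul_assoc, hd, smul_mul_assoc, mul_add, ← mul_assoc]
      push_cast
      rw [add_smul, one_smul, add_assoc, add_comm (_ • _)]
  let S : E := ∑ j ∈ Finset.range n, ((g ^ j : Eˣ) : E) * d * ((g⁻¹ ^ j : Eˣ) : E)
  have hSx : S * x = x * S + (n : k) • (x : E) := by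
    have : ∀ j ∈ Finset.range n, ((g ^ j : Eˣ) : E) * d * ((g⁻¹ ^ j : Eˣ) : E) * x =
        x * (((g ^ j : Eˣ) : E) * d * ((g⁻¹ ^ j : Eˣ) : E)) + x := by
      intro j _
      have h1 : ((g⁻¹ ^ j : Eˣ) : E) * x = x * ((g⁻¹ ^ j : Eˣ) : E) := by
        rw [← Units.val_mul, ← Units.val_mul, ((hxg.inv_right.pow_right j).eq)]
      have h2 : ((g ^ j : Eˣ) : E) * x = x * ((g ^ j : Eˣ) : E) := by
        rw [← Units.val_mul, ← Units.val_mul, ((hxg.pow_right j).eq)]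
      have h3 : ((g ^ j : Eˣ) : E) * ((g⁻¹ ^ j : Eˣ) : E) = 1 := by
        rw [← Units.val_mul, inv_pow, mul_inv_cancel, Units.val_one]
      rw [mul_assoc, h1, ← mul_assoc, mul_assoc _ d, hd, mul_add, add_mul, ← mul_assoc, h2,
        mul_assoc (x : E) _ ((g⁻¹ ^ j : Eˣ) : E), h3, mul_one]
      noncomm_ring
    rw [Finset.sum_mul, Finset.sum_congr rfl this, Finset.sum_add_distrib, ← Finset.mul_sum,
      Finset.sum_const, Finset.card_range, Nat.cast_smul_eq_nsmul]
  -- Conjugating S by g shifts the sum by one index, and the boundary terms give xʷ d x⁻ʷ - d = -w.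
  have hSg : S * g = g * S + (w : k) • (g : E) := by
    have h1 : (g : E) * S * ((g⁻¹ : Eˣ) : E) =
        ∑ j ∈ Finset.range n, ((g ^ (j + 1) : Eˣ) : E) * d * ((g⁻¹ ^ (j + 1) : Eˣ) : E) := by
      rw [Finset.mul_sum, Finset.sum_mul]
      refine Finset.sum_congr rfl fun j _ => ?_
      rw [pow_succ', pow_succ g⁻¹, Units.val_mul, Units.val_mul]
      simp only [mul_assoc]
    have h2 : (g : E) * S * ((g⁻¹ : Eˣ) : E) + d = S - (w : k) • 1 + d := by
      have h3 := (Finset.sum_range_succ'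
        (fun j => ((g ^ j : Eˣ) : E) * d * ((g⁻¹ ^ j : Eˣ) : E)) n).symm
      rw [Finset.sum_range_succ, inv_pow g n, hg] at h3
      rw [h1, ← sub_eq_zero]
      have h4 : ((x ^ w : Eˣ) : E) * d * (((x ^ w)⁻¹ : Eˣ) : E) = d - (w : k) • 1 := by
        rw [Units.val_pow_eq_pow_val, ← sub_eq_iff_eq_add.2 (hdx w), sub_mul, mul_assoc,
          smul_mul_assoc, ← Units.val_pow_eq_pow_val, Units.mul_inv, mul_one]
      rw [h4] at h3
      simp only [pow_zero, Units.val_one, one_mul, mul_one] at h3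
      rw [h3]
      change S + _ - _ = (0 : E)
      abel
    have h5 := congrArg (· * (g : E)) (add_right_cancel h2)
    simp only [mul_assoc, Units.inv_mul, mul_one, sub_mul, smul_mul_assoc, one_mul] at h5
    rw [h5]
    abel
  -- The scalar defects of S against x and g cancel in this commutator, so c commutes with x and g
  -- exactly as y does.
  let c : E := S * y - y * S
  have hcx : c * x = x * c := by
    simp only [c, sub_mul, mul_sub, mul_assoc]
    rw [hyx, hSx, mul_add, mul_smul_comm, hyx, ← mul_assoc S, hSx, add_mul, smul_mul_assoc,
      ← mul_assoc y, hyx]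
    simp only [mul_assoc]
    abel
  have hcg : c * g = ξ • (g * c) := by
    simp only [c, sub_mul, mul_sub, mul_assoc]
    rw [hyg, hSg, mul_add, mul_smul_comm, mul_smul_comm, hyg, ← mul_assoc S, hSg, add_mul,
      smul_mul_assoc, ← mul_assoc y, hyg, smul_mul_assoc, smul_add, smul_sub, smul_comm ξ (w : k)]
    simp only [mul_assoc]
    abel
  refine ⟨(n : k)⁻¹ • y - ((n : k)⁻¹ * (w : k)⁻¹) • c, ?_, ?_, ?_⟩
  · rw [sub_mul, mul_sub, smul_mul_assoc, smul_mul_assoc, mul_smul_comm, mul_smul_comm, hyx, hcx]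
  · rw [sub_mul, mul_sub, smul_mul_assoc, smul_mul_assoc, mul_smul_comm, mul_smul_comm, hyg, hcg,
      smul_sub, smul_comm ξ, smul_comm ξ]
  · have h1 : ∀ i ∈ Finset.range n, y ^ i * ((n : k)⁻¹ • y - ((n : k)⁻¹ * (w : k)⁻¹) • c) *
        y ^ (n - 1 - i) = (n : k)⁻¹ • y ^ n -
          ((n : k)⁻¹ * (w : k)⁻¹) • (y ^ i * c * y ^ (n - 1 - i)) := by
      intro i hi
      have hi := Finset.mem_range.1 hi
      rw [mul_sub, sub_mul, mul_smul_comm, mul_smul_comm, smul_mul_assoc, smul_mul_assoc, ← pow_succ,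
        ← pow_add, show i + 1 + (n - 1 - i) = n by omega]
    have hSxw : S * (x : E) ^ w - x ^ w * S = ((n : k) * w) • (x : E) ^ w := by
      have : ∀ m : ℕ, S * (x : E) ^ m - x ^ m * S = ((n : k) * m) • (x : E) ^ m := by
        intro m
        induction m with
        | zero => simp
        | succ m ih =>
          have h := sub_eq_iff_eq_add.1 ih
          rw [pow_succ, ← mul_assoc, h, add_mul, mul_assoc _ S, hSx, mul_add, smul_mul_assoc]
          push_cast
          rw [mul_add, add_smul, mul_one, mul_smul_comm]
          simp only [mul_assoc]
          abel
      exact this w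
    rw [Finset.sum_congr rfl h1, Finset.sum_sub_distrib, Finset.sum_const,
      Finset.card_range, ← Finset.smul_sum, sum_pow_mul_commutator, ← Nat.cast_smul_eq_nsmul k, smul_smul,
      mul_inv_cancel₀ hn0, one_smul, hy]
    have : S * (1 - (x : E) ^ w) - (1 - x ^ w) * S = -((n : k) * w) • (x : E) ^ w := by
      rw [neg_smul, ← hSxw]
      noncomm_ring
    rw [this, smul_smul, ← mul_inv, mul_neg, inv_mul_cancel₀ (mul_ne_zero hn0 hw)]
    simp

end Derivation

/-! ### Projectivity over `B` from projectivity over k[x, x⁻¹] -/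

namespace LiuDatum

variable {k : Type u} [Field k] (D : LiuDatum k)

open LaurentPolynomial

/-- If `w` is invertible, modules which are projective over `k[x, x⁻¹]` are projective. -/
theorem projective_of_projective_laurent (hw : (D.w : k) ≠ 0) (M : Type u) [AddCommGroup M]
    [Module D.Alg M] [Module k[T;T⁻¹] M] [IsScalarTower k[T;T⁻¹] D.Alg M]
    [Module.Projective k[T;T⁻¹] M] : Module.Projective D.Alg M := by
  let : Module k M := Module.restrictScalars k D.Alg M
  have : IsScalarTower k D.Alg M := IsScalarTower.restrictScalars k D.Alg M
  have : IsScalarTower k k[T;T⁻¹] M := .of_algebraMap_smul fun r m => by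
    rw [← algebraMap_smul D.Alg, ← IsScalarTower.algebraMap_apply, algebraMap_smul]
  let p : (M →₀ D.Alg) →ₗ[D.Alg] M := Finsupp.linearCombination D.Alg id
  have hp : Function.Surjective p := Finsupp.linearCombination_id_surjective D.Alg M
  obtain ⟨s₀, hs₀⟩ := Module.projective_lifting_property (p.restrictScalars k[T;T⁻¹])
    (LinearMap.id : M →ₗ[k[T;T⁻¹]] M) hp
  have hxs : ∀ (a : ℤ) m, s₀ ((D.U (D.xG ^ a) : D.Alg) • m) = (D.U (D.xG ^ a) : D.Alg) • s₀ m := by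
    intro a m
    have := s₀.map_smul (T a : k[T;T⁻¹]) m
    rwa [← algebraMap_smul D.Alg, ← algebraMap_smul D.Alg (T a : k[T;T⁻¹]) (s₀ m), algebraMap_Alg,
      laurentHom_T, incl_s] at this
  obtain ⟨d, hd⟩ := LaurentPolynomial.exists_connection (k := k) M
  let ρ : D.Alg →ₐ[k] Module.End k M := Algebra.lsmul k k M
  have hd' : d * ρ D.x = ρ D.x * d + ρ D.x := by
    ext m
    have h1 : ∀ m : M, (T 1 : k[T;T⁻¹]) • m = (D.x : D.Alg) • m := fun m => by
      rw [← algebraMap_smul D.Alg, algebraMap_Alg, laurentHom_T, incl_s, zpow_one, U_xG]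
    have := hd m
    simp only [h1] at this
    exact this
  obtain ⟨φ, hφx, hφg, hφ⟩ := exists_homotopy (x := Units.map (ρ : D.Alg →* Module.End k M) D.x)
    (g := Units.map (ρ : D.Alg →* Module.End k M) D.g) (y := ρ D.y) D.n_ne_zero hw hd'
    (by
      rw [← U_xG, ← U_gG]
      exact ((Commute.all D.xG D.gG).map D.U).map _)
    (by rw [← map_pow, ← map_pow, ← U_xG, ← U_gG, ← map_pow, ← map_pow, gG_pow_n])
    (by
      change ρ _ * ρ _ = ρ _ * ρ _
      rw [← map_mul, ← map_mul, ← U_xG, y_mul_U, χ_xG, Units.val_one, one_smul])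
    (ξ := D.ξ)
    (by
      change ρ _ * ρ _ = D.ξ • (ρ _ * ρ _)
      rw [← map_mul, ← map_mul, D.y_mul_g, map_smul])
    (by
      change ρ _ ^ _ = 1 - ρ _ ^ _
      rw [← map_pow, ← map_pow, D.y_pow_n', c, map_sub, map_one, incl_s, map_sub, map_one, map_pow,
        U_xG, Units.val_pow_eq_pow_val])
  have hφx' : ∀ m, φ ((D.x : D.Alg) • m) = (D.x : D.Alg) • φ m := LinearMap.congr_fun hφx
  have hφg' : ∀ m, φ ((D.U D.gG : D.Alg) • m) = D.ξ • (D.U D.gG : D.Alg) • φ m := by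
    rw [U_gG]; exact LinearMap.congr_fun hφg
  have hφ' : ∀ m, ∑ i ∈ Finset.range D.n, D.y ^ i • φ (D.y ^ (D.n - 1 - i) • m) = m := by
    intro m
    have := LinearMap.congr_fun hφ m
    simp only [← map_pow] at this
    rw [LinearMap.sum_apply] at this
    exact this
  have hφxw : ∀ m, φ ((D.U (D.xG ^ D.w) : D.Alg) • m) = (D.U (D.xG ^ D.w) : D.Alg) • φ m := by
    have := (Commute.pow_right hφx D.w).eq
    rw [← Units.val_pow_eq_pow_val, ← map_pow, ← U_xG, ← map_pow] at this
    exact LinearMap.congr_fun this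
  let F := M →₀ D.Alg
  -- Maschke averaging over the powers of g: gⁿ = xʷ is not 1, but s₀ already commutes with it, so n
  -- terms suffice.
  let s₁ : M →ₗ[k] F := (D.n : k)⁻¹ • ∑ j ∈ Finset.range D.n,
    Algebra.lsmul k k F (D.U (D.gG ^ j) : D.Alg) ∘ₗ s₀.restrictScalars k ∘ₗ
      Algebra.lsmul k k M (D.U (D.gG⁻¹ ^ j) : D.Alg)
  have hs₁ : ∀ m, s₁ m = (D.n : k)⁻¹ • ∑ j ∈ Finset.range D.n,
      (D.U (D.gG ^ j) : D.Alg) • s₀ ((D.U (D.gG⁻¹ ^ j) : D.Alg) • m) := by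
    intro m
    simp only [s₁, LinearMap.smul_apply, LinearMap.sum_apply]
    rfl
  have hUcomm : ∀ (v v' : D.G) {N : Type u} [AddCommGroup N] [Module D.Alg N] (m : N),
      (D.U v : D.Alg) • (D.U v' : D.Alg) • m = (D.U v' : D.Alg) • (D.U v : D.Alg) • m := by
    intro v v' N _ _ m
    rw [← mul_smul, ← mul_smul, ← Units.val_mul, ← Units.val_mul, ← map_mul, ← map_mul, mul_comm]
  have hs₁x : ∀ (a : ℤ) m, s₁ ((D.U (D.xG ^ a) : D.Alg) • m) =
      (D.U (D.xG ^ a) : D.Alg) • s₁ m := by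
    intro a m
    rw [hs₁, hs₁, smul_comm _ (D.n : k)⁻¹]
    congr 1
    rw [Finset.smul_sum]
    refine Finset.sum_congr rfl fun j _ => ?_
    rw [hUcomm, hxs, hUcomm]
  have hs₁g : ∀ m, s₁ ((D.U D.gG : D.Alg) • m) = (D.U D.gG : D.Alg) • s₁ m := by
    intro m
    rw [hs₁, hs₁, smul_comm _ (D.n : k)⁻¹]
    congr 1
    rw [Finset.smul_sum]
    have h1 : ∀ j, (D.U D.gG : D.Alg) • (D.U (D.gG ^ j) : D.Alg) •
        s₀ ((D.U (D.gG⁻¹ ^ j) : D.Alg) • m) = (D.U (D.gG ^ (j + 1)) : D.Alg) •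
        s₀ ((D.U (D.gG⁻¹ ^ (j + 1)) : D.Alg) • (D.U D.gG : D.Alg) • m) := by
      intro j
      rw [← mul_smul, ← mul_smul, ← Units.val_mul, ← Units.val_mul, ← map_mul, ← map_mul, pow_succ',
        pow_succ D.gG⁻¹, mul_assoc, inv_mul_cancel, mul_one]
    simp only [h1]
    have h2 := Finset.sum_range_succ' (fun j => (D.U (D.gG ^ j) : D.Alg) •
      s₀ ((D.U (D.gG⁻¹ ^ j) : D.Alg) • (D.U D.gG : D.Alg) • m)) D.n
    rw [Finset.sum_range_succ] at h2
    refine add_right_cancel (h2.trans ?_)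
    congr 1
    rw [inv_pow D.gG D.n, gG_pow_n, ← zpow_natCast D.xG, ← zpow_neg, hxs,
      ← mul_smul (D.U (D.xG ^ (D.w : ℤ)) : D.Alg), ← Units.val_mul, ← map_mul, zpow_neg, mul_inv_cancel]
    simp
  have hps₁ : ∀ m, p (s₁ m) = m := by
    intro m
    have h0 : ∀ m, p (s₀ m) = m := LinearMap.congr_fun hs₀
    have hpk : ∀ (c : k) v, p (c • v) = c • p v := fun c v => LinearMap.map_smul_of_tower p c v
    have h1 : ∀ j, (D.U (D.gG ^ j) : D.Alg) • (D.U (D.gG⁻¹ ^ j) : D.Alg) • m = m := by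
      intro j
      rw [← mul_smul, ← Units.val_mul, ← map_mul, inv_pow, mul_inv_cancel]
      simp
    rw [hs₁, hpk, map_sum]
    simp only [map_smul, h0, h1]
    rw [Finset.sum_const, Finset.card_range, ← Nat.cast_smul_eq_nsmul k, smul_smul,
      inv_mul_cancel₀ D.n_ne_zero, one_smul]
  -- Since p s₁ = id, the composite p s is ∑ yⁱ φ yⁿ⁻¹⁻ⁱ = 1.
  let s : M →ₗ[k] F := ∑ i ∈ Finset.range D.n,
    Algebra.lsmul k k F (D.y ^ i) ∘ₗ s₁ ∘ₗ φ ∘ₗ Algebra.lsmul k k M (D.y ^ (D.n - 1 - i))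
  have hs : ∀ m, s m = ∑ i ∈ Finset.range D.n, D.y ^ i • s₁ (φ (D.y ^ (D.n - 1 - i) • m)) := by
    intro m
    rw [LinearMap.sum_apply]
    rfl
  have hyU : ∀ (v : D.G) (l : ℕ) {N : Type u} [AddCommGroup N] [Module D.Alg N] (m : N),
      D.y ^ l • (D.U v : D.Alg) • m =
        (algebraMap k D.Alg ((D.χ v : k) ^ l)) • (D.U v : D.Alg) • D.y ^ l • m := by
    intro v l N _ _ m
    rw [← mul_smul, pow_y_mul_U, Algebra.smul_def, mul_smul, mul_smul]
  have hsx : ∀ m, s ((D.U D.xG : D.Alg) • m) = (D.U D.xG : D.Alg) • s m := by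
    intro m
    rw [hs, hs, Finset.smul_sum]
    refine Finset.sum_congr rfl fun i _ => ?_
    have h1 := hs₁x 1
    rw [zpow_one] at h1
    rw [hyU, χ_xG, Units.val_one, one_pow, map_one, one_smul, U_xG, hφx', ← U_xG, h1, hyU, χ_xG,
      Units.val_one, one_pow, map_one, one_smul]
  have hsg : ∀ m, s ((D.U D.gG : D.Alg) • m) = (D.U D.gG : D.Alg) • s m := by
    intro m
    rw [hs, hs, Finset.smul_sum]
    refine Finset.sum_congr rfl fun i hi => ?_
    have hi := Finset.mem_range.1 hi
    -- Passing g through yⁿ⁻¹⁻ⁱ, φ and yⁱ costs ξⁿ⁻¹⁻ⁱ, ξ and ξⁱ, in total ξⁿ = 1.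
    rw [hyU, algebraMap_smul, map_smul, hφg', map_smul, map_smul, hs₁g, smul_comm (D.y ^ i),
      smul_comm (D.y ^ i), hyU, algebraMap_smul, χ_gG, val_ξU, smul_smul, smul_smul, ← pow_succ,
      ← pow_add, show D.n - 1 - i + 1 + i = D.n by omega, D.ξ_primitive.pow_eq_one, one_smul]
  have hsy : ∀ m, s (D.y • m) = D.y • s m := by
    intro m
    have hyn : ∀ {N : Type u} [AddCommGroup N] [Module D.Alg N] (m : N),
        D.y ^ D.n • m = m - (D.U (D.xG ^ D.w) : D.Alg) • m := by
      intro N _ _ m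
      rw [y_pow_n', c, map_sub, map_one, incl_s, sub_smul, one_smul]
    -- Both s(y m) and y s(m) are sums of consecutive f(i); they differ by f(n) - f(0), which
    -- vanishes because yⁿ = 1 - xʷ commutes with s₁ φ.
    let f : ℕ → F := fun i => D.y ^ i • s₁ (φ (D.y ^ (D.n - i) • m))
    have h1 : s (D.y • m) = ∑ i ∈ Finset.range D.n, f i := by
      rw [hs]
      refine Finset.sum_congr rfl fun i hi => ?_
      have hi := Finset.mem_range.1 hi
      rw [← mul_smul, ← pow_succ, show D.n - 1 - i + 1 = D.n - i by omega]
    have h2 : D.y • s m = ∑ i ∈ Finset.range D.n, f (i + 1) := by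
      rw [hs, Finset.smul_sum]
      refine Finset.sum_congr rfl fun i hi => ?_
      rw [← mul_smul, ← pow_succ', Nat.sub_sub, add_comm 1 i]
    have h3 : f D.n = f 0 := by
      simp only [f]
      rw [Nat.sub_self, Nat.sub_zero, pow_zero, one_smul, one_smul, hyn, hyn, map_sub, hφxw, map_sub,
        ← zpow_natCast, hs₁x]
    have h4 := Finset.sum_range_succ' f D.n
    rw [Finset.sum_range_succ, h3] at h4
    rw [h1, h2, add_right_cancel h4]
  have hsU : ∀ v m, s ((D.U v : D.Alg) • m) = (D.U v : D.Alg) • s m := by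
    let H : Subgroup D.G :=
      { carrier := {v | ∀ m, s ((D.U v : D.Alg) • m) = (D.U v : D.Alg) • s m}
        mul_mem' := fun {v v'} hv hv' m => by
          rw [map_mul, Units.val_mul, mul_smul, hv, hv', mul_smul]
        one_mem' := fun m => by simp
        inv_mem' := fun {v} hv m => by
          have := hv ((D.U v⁻¹ : D.Alg) • m)
          rw [← mul_smul, ← Units.val_mul, ← map_mul, mul_inv_cancel, map_one, Units.val_one,
            one_smul] at this
          rw [this, ← mul_smul, ← Units.val_mul, ← map_mul, inv_mul_cancel, map_one, Units.val_one,
            one_smul] }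
    intro v
    obtain ⟨a, i, _, rfl⟩ := D.exists_eq_xG_gG v
    exact H.mul_mem (H.zpow_mem (show D.xG ∈ H from hsx) a) (H.pow_mem (show D.gG ∈ H from hsg) i)
  have hst : ∀ (t : D.Alg) m, s (t • m) = t • s m := by
    intro t
    induction t using D.induction_U with
    | hc c => intro m; rw [algebraMap_smul, algebraMap_smul, map_smul]
    | hU v => exact hsU v
    | hy => exact hsy
    | hadd t t' h h' => intro m; rw [add_smul, map_add, h, h', add_smul]
    | hmul t t' h h' => intro m; rw [mul_smul, h, h', mul_smul]
  refine Module.Projective.of_split (R := D.Alg) (P := M) (M := F) ⟨⟨s, s.map_add⟩, hst⟩ p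
    (LinearMap.ext fun m => ?_)
  change p (s m) = m
  rw [hs, map_sum]
  simp only [map_smul, hps₁, hφ']

open CategoryTheory

theorem hasProjectiveDimensionLT_two (hw : (D.w : k) ≠ 0) (M : ModuleCat.{u} D.Alg) :
    HasProjectiveDimensionLT M 2 := by
  let p : (M →₀ D.Alg) →ₗ[D.Alg] M := Finsupp.linearCombination D.Alg id
  have hp : Function.Surjective p := Finsupp.linearCombination_id_surjective D.Alg M
  have hproj : Projective (ModuleCat.of D.Alg (M →₀ D.Alg)) :=
    ModuleCat.projective_of_free Finsupp.basisSingleOne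
  have hK : Module.Projective k[T;T⁻¹] (LinearMap.ker p) :=
    Module.Projective.of_injective_of_isPrincipalIdealRing (K := LinearMap.ker p)
      (M := M →₀ D.Alg) ((LinearMap.ker p).subtype.restrictScalars k[T;T⁻¹]) Subtype.val_injective
  have hK' := D.projective_of_projective_laurent hw (LinearMap.ker p)
  have hS := LinearMap.shortExact_shortComplexKer hp
  refine (hS.hasProjectiveDimensionLT_X₃_iff 0 hproj).2 ?_
  rw [← projective_iff_hasProjectiveDimensionLT_one]
  exact (IsProjective.iff_projective _).1 hK'

/-- The trivial module has nonzero Ext¹ into `B`. -/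
theorem one_le_globalDim : 1 ≤ globalDim D.Alg := by
  refine le_trans ?_ (le_iSup _ (trivialModule k D.Alg (Bialgebra.counitAlgHom k D.Alg)))
  refine (projectiveDimension_ge_iff _ 1).2 fun h => ?_
  have h1 := (isLeftASGorenstein_one _ D.isFrobeniusForm T_one_sub_one_ne_zero
    D.counit_eq_zero_iff).finrank_ext
  have : Subsingleton (extTrivial k D.Alg (Bialgebra.counitAlgHom k D.Alg) 1) :=
    subsingleton_of_forall_eq 0 fun e => Abelian.Ext.eq_zero_of_hasProjectiveDimensionLT e 1 le_rfl
  rw [Module.finrank_zero_of_subsingleton] at h1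
  exact zero_ne_one h1

theorem globalDim_eq_one_of_ne_zero (hw : (D.w : k) ≠ 0) : globalDim D.Alg = 1 :=
  le_antisymm (iSup_le fun M => (projectiveDimension_le_iff M 1).2
    (D.hasProjectiveDimensionLT_two hw M)) D.one_le_globalDim

end LiuDatum

/-! ### Periodic resolutions -/

open CategoryTheory in
/-- If `q` generates the left annihilator of `a` and vice versa, then the left ideal generated by
`q` is projective as soon as it has finite projective dimension. -/
theorem projective_of_periodic {A : Type u} [Ring A] {a q : A}
    (h : LinearMap.ker (LinearMap.toSpanSingleton A A a) =
      LinearMap.range (LinearMap.toSpanSingleton A A q))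
    (h' : LinearMap.ker (LinearMap.toSpanSingleton A A q) =
      LinearMap.range (LinearMap.toSpanSingleton A A a)) (m : ℕ)
    (hm : HasProjectiveDimensionLT
      (ModuleCat.of A (LinearMap.range (LinearMap.toSpanSingleton A A q))) (m + 1)) :
    Module.Projective A (LinearMap.range (LinearMap.toSpanSingleton A A q)) := by
  have hA : Projective (ModuleCat.of A A) :=
    (IsProjective.iff_projective A).1 (inferInstanceAs (Module.Projective A A))
  have step : ∀ (r t : A), LinearMap.ker (LinearMap.toSpanSingleton A A r) =
      LinearMap.range (LinearMap.toSpanSingleton A A t) → ∀ m, HasProjectiveDimensionLT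
        (ModuleCat.of A (LinearMap.range (LinearMap.toSpanSingleton A A r))) (m + 2) →
      HasProjectiveDimensionLT
        (ModuleCat.of A (LinearMap.range (LinearMap.toSpanSingleton A A t))) (m + 1) := by
    intro r t hrt m hm
    rw [← hrt, ← LinearMap.ker_rangeRestrict]
    have hS := LinearMap.shortExact_shortComplexKer
      (LinearMap.surjective_rangeRestrict (LinearMap.toSpanSingleton A A r))
    exact (hS.hasProjectiveDimensionLT_X₃_iff m hA).1 hm
  have key : ∀ m, HasProjectiveDimensionLT
      (ModuleCat.of A (LinearMap.range (LinearMap.toSpanSingleton A A q))) (m + 1) →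
      HasProjectiveDimensionLT
      (ModuleCat.of A (LinearMap.range (LinearMap.toSpanSingleton A A q))) 1 := by
    intro m
    induction m with
    | zero => exact id
    | succ m ih =>
      intro hm
      -- The bound is raised by one, so that the two shifts, from q to a and back to q, lower it by
      -- one altogether.
      have : HasProjectiveDimensionLT
        (ModuleCat.of A (LinearMap.range (LinearMap.toSpanSingleton A A q))) (m + 1 + 2) :=
        hasProjectiveDimensionLT_of_ge _ (m + 2) _ (by omega)
      exact ih (step _ _ h _ (step _ _ h' _ this))
  exact (IsProjective.iff_projective _).2
    (projective_iff_hasProjectiveDimensionLT_one.2 (key m hm))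

namespace LiuDatum

variable {k : Type u} [Field k] (D : LiuDatum k)

open LaurentPolynomial

/-! ### Infinite global dimension -/

/-- The augmentation of the group algebra. -/
noncomputable def augR : D.R →ₐ[k] k := (Bialgebra.counitAlgHom k D.Alg).comp D.incl

theorem augR_s (v : D.G) : D.augR (D.s v) = 1 := by
  rw [augR, AlgHom.comp_apply, incl_s]
  exact D.counit_U v

/-- As p does not divide b, it divides w', so h^w' has a p-th root; and f has one because its order
is prime to p. -/
theorem exists_pow_eq_gG {p : ℕ} (hp : p.Prime) (hpn : ¬ p ∣ D.n) (hpw : p ∣ D.w) :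
    ∃ v : D.G, v ^ p = D.gG := by
  have hpb : ¬ p ∣ D.b := fun h => hpn (h.trans (Nat.gcd_dvd_left _ _))
  obtain ⟨m, hm⟩ : p ∣ D.w' := by
    rw [← D.w'_mul_b] at hpw
    exact (hp.dvd_mul.1 hpw).resolve_right hpb
  obtain ⟨j, hj⟩ := exists_pow_eq_self_of_coprime (x := D.fG) (n := p)
    (((hp.coprime_iff_not_dvd).2 hpb).coprime_dvd_right (orderOf_dvd_of_pow_eq_one D.fG_pow_b))
  refine ⟨D.hG ^ m * D.fG ^ (j * D.i₀), ?_⟩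
  rw [mul_pow, ← pow_mul, ← pow_mul, mul_comm m, ← hm, mul_comm (j * D.i₀), ← mul_assoc, pow_mul,
    pow_mul D.fG, hj, gG]

/-- With v a p-th root of g and ζ = χ(v), take u = (1 - v)ᵖ⁻¹ (1 - ζ v). Each factor 1 - v or 1 - ζ
v has norm 1 - vⁿ, so u has norm (1 - vⁿ)ᵖ = 1 - gⁿ = c. The factor 1 - v makes u augment to 0, and
σⁿ⁻¹ turns 1 - ζ v into 1 - v. For u = 1 - g the second vanishing would fail. -/
theorem exists_twist (hw : (D.w : k) = 0) :
    ∃ u : D.R, D.N u D.n = D.c ∧ D.augR u = 0 ∧ D.augR ((D.σ ^ (D.n - 1)) u) = 0 := by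
  obtain ⟨p, hchar⟩ := CharP.exists k
  have hpw : p ∣ D.w := (CharP.cast_eq_zero_iff k p _).1 hw
  have hp : p.Prime := (CharP.char_is_prime_or_zero k p).resolve_right fun h => by
    have := D.w_pos
    rw [h, zero_dvd_iff] at hpw
    omega
  have hpn : ¬ p ∣ D.n := fun h => D.n_ne_zero ((CharP.cast_eq_zero_iff k p _).2 h)
  obtain ⟨v, hv⟩ := D.exists_pow_eq_gG hp hpn hpw
  let ζ : k := D.χ v
  have hζn : ζ ^ D.n = 1 := by
    rw [← Units.val_pow_eq_pow_val, χ_pow_n, Units.val_one]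
  have hζ : IsPrimitiveRoot ζ D.n := by
    refine ⟨hζn, fun l hl => ?_⟩
    rw [← D.ξ_primitive.pow_eq_one_iff_dvd, ← val_ξU, ← χ_gG, ← hv, map_pow,
      Units.val_pow_eq_pow_val, pow_right_comm]
    exact (congrArg (· ^ p) hl).trans (one_pow p)
  have hσ : ∀ (j : ℕ), (D.σ ^ j) ((1 - D.s v) ^ (p - 1) * (1 - ζ • D.s v)) =
      (1 - ζ ^ j • D.s v) ^ (p - 1) * (1 - ζ ^ j • ζ • D.s v) := by
    intro j
    rw [map_mul, map_pow, map_sub, map_sub, map_one, map_smul, σ_pow_s, smul_comm ζ]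
  refine ⟨(1 - D.s v) ^ (p - 1) * (1 - ζ • D.s v), ?_, ?_, ?_⟩
  · have : CharP D.R p := charP_of_injective_algebraMap (algebraMap k D.R).injective p
    have : Fact p.Prime := ⟨hp⟩
    rw [N, Finset.prod_congr rfl fun j _ => hσ j, Finset.prod_mul_distrib, Finset.prod_pow,
      prod_one_sub D.n_pos hζ, prod_one_sub D.n_pos hζ, smul_pow, hζn, one_smul, ← pow_succ,
      Nat.sub_add_cancel hp.one_le, sub_pow_char, one_pow, pow_right_comm, ← D.s_pow v p, hv,
      s_gG_pow_n, c]
  · rw [map_mul, map_pow, map_sub, map_one, augR_s, sub_self,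
      zero_pow (Nat.sub_ne_zero_of_lt hp.one_lt), zero_mul]
  · rw [hσ, map_mul, smul_smul, ← pow_succ, Nat.sub_add_cancel (show 1 ≤ D.n from D.n_pos), hζn,
      one_smul, map_sub, map_one, augR_s, sub_self, mul_zero]

theorem coef_incl_mul_y_pow_succ (r : D.R) (l m : Fin D.n) :
    D.coef l (D.incl r * D.y ^ ((m : ℕ) + 1)) =
      if (m : ℕ) + 1 = D.n then (if (l : ℕ) = 0 then r * D.c else 0)
      else if (l : ℕ) = m + 1 then r else 0 := by
  split_ifs with h1 h2 h2
  · have := D.coef_incl_mul_y_pow (r * D.c) l ⟨0, D.n_pos⟩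
    rw [if_pos (Fin.ext h2), pow_zero, mul_one, map_mul] at this
    rwa [h1, y_pow_n']
  · have := D.coef_incl_mul_y_pow (r * D.c) l ⟨0, D.n_pos⟩
    rw [if_neg (fun h => h2 (congrArg Fin.val h)), pow_zero, mul_one, map_mul] at this
    rwa [h1, y_pow_n']
  · have := D.coef_incl_mul_y_pow r l ⟨m + 1, by omega⟩
    rwa [if_pos (Fin.ext h2)] at this
  · have := D.coef_incl_mul_y_pow r l ⟨m + 1, by omega⟩
    rwa [if_neg (fun h => h2 (congrArg Fin.val h))] at this

theorem coef_succ_mul_y {l : ℕ} (hl : l + 1 < D.n) (t : D.Alg) :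
    D.coef ⟨l + 1, hl⟩ (t * D.y) = D.coef ⟨l, by omega⟩ t := by
  conv_lhs => rw [← D.sum_coef t, Finset.sum_mul, map_sum]
  simp only [mul_assoc, ← pow_succ, coef_incl_mul_y_pow_succ]
  rw [Finset.sum_eq_single ⟨l, by omega⟩]
  · simp only
    rw [if_neg (by omega), if_pos trivial]
  · intro m _ hm
    have hm : (m : ℕ) ≠ l := fun h => hm (Fin.ext h)
    split_ifs <;> first | rfl | contradiction | omega
  · simp

theorem coef_zero_mul_y (t : D.Alg) : D.coef ⟨0, D.n_pos⟩ (t * D.y) =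
    D.coef ⟨D.n - 1, Nat.sub_lt D.n_pos one_pos⟩ t * D.c := by
  conv_lhs => rw [← D.sum_coef t, Finset.sum_mul, map_sum]
  simp only [mul_assoc, ← pow_succ, coef_incl_mul_y_pow_succ]
  have := D.n_pos
  rw [Finset.sum_eq_single ⟨D.n - 1, Nat.sub_lt D.n_pos one_pos⟩]
  · simp only
    rw [if_pos (by omega), if_pos trivial]
  · intro m _ hm
    have hm : (m : ℕ) ≠ D.n - 1 := fun h => hm (Fin.ext h)
    split_ifs <;> first | rfl | contradiction | omega
  · simp

theorem coef_mul_incl (l : Fin D.n) (t : D.Alg) (r : D.R) :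
    D.coef l (t * D.incl r) = D.coef l t * (D.σ ^ (l : ℕ)) r := by
  conv_lhs => rw [← D.sum_coef t, Finset.sum_mul]
  simp only [mul_assoc, pow_y_mul_incl]
  simp only [← mul_assoc, ← map_mul]
  exact D.coef_build (fun m => D.coef m t * (D.σ ^ (m : ℕ)) r) l

theorem coef_zero_y_mul (t : D.Alg) : D.coef ⟨0, D.n_pos⟩ (D.y * t) =
    D.σ (D.coef ⟨D.n - 1, Nat.sub_lt D.n_pos one_pos⟩ t) * D.c := by
  have h : D.y * t = (∑ l, D.incl (D.σ (D.coef l t)) * D.y ^ (l : ℕ)) * D.y := by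
    conv_lhs => rw [← D.sum_coef t, Finset.mul_sum]
    rw [Finset.sum_mul]
    refine Finset.sum_congr rfl fun l _ => ?_
    rw [← mul_assoc, y_mul_incl, mul_assoc, mul_assoc, ← pow_succ, ← pow_succ']
  rw [h, coef_zero_mul_y, coef_build]

/-! ### The left ideals generated by y - u and by its cofactor -/

section twist

variable {u : D.R} (hu : D.N u D.n = D.c)

/-- The generator of the left annihilator of `y - u`. -/
noncomputable def cofactor (u : D.R) : D.Alg :=
  ∑ l : Fin D.n, D.incl (∏ j ∈ Finset.Ico ((l : ℕ) + 1) D.n, (D.σ ^ j) u) * D.y ^ (l : ℕ)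

theorem coef_cofactor (u : D.R) :
    D.coef ⟨D.n - 1, Nat.sub_lt D.n_pos one_pos⟩ (D.cofactor u) = 1 := by
  rw [cofactor, coef_build, Finset.Ico_eq_empty (by simp only; omega), Finset.prod_empty]

include hu in
-- This is the skew form of yⁿ - uⁿ = (yⁿ⁻¹ + ⋯ + uⁿ⁻¹)(y - u): the sum telescopes to yⁿ minus the
-- norm of u, which is zero in `B`.
theorem cofactor_mul : D.cofactor u * (D.y - D.incl u) = 0 := by
  let f : ℕ → D.Alg := fun l => D.incl (∏ j ∈ Finset.Ico l D.n, (D.σ ^ j) u) * D.y ^ l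
  have h : D.cofactor u * (D.y - D.incl u) = ∑ l ∈ Finset.range D.n, (f (l + 1) - f l) := by
    rw [cofactor, Finset.sum_mul, ← Fin.sum_univ_eq_sum_range (fun l => f (l + 1) - f l)]
    refine Finset.sum_congr rfl fun l _ => ?_
    simp only [f]
    rw [mul_sub, mul_assoc, ← pow_succ, mul_assoc, pow_y_mul_incl, ← mul_assoc (D.incl _),
      ← map_mul, Finset.prod_eq_prod_Ico_succ_bot l.2, mul_comm ((D.σ ^ _) u)]
  rw [h, Finset.sum_range_sub]
  simp only [f]
  rw [Finset.Ico_self, Finset.prod_empty, map_one, one_mul, y_pow_n', pow_zero, mul_one, ← hu, N,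
    Finset.range_eq_Ico, sub_self]

include hu in
theorem mul_cofactor : (D.y - D.incl u) * D.cofactor u = 0 := by
  let f : ℕ → D.Alg := fun l => D.incl (∏ j ∈ Finset.Ico (l + 1) (D.n + 1), (D.σ ^ j) u) * D.y ^ l
  have hσ : ∀ a b : ℕ, D.σ (∏ j ∈ Finset.Ico a b, (D.σ ^ j) u) =
      ∏ j ∈ Finset.Ico (a + 1) (b + 1), (D.σ ^ j) u := by
    intro a b
    rw [← Finset.prod_Ico_add' (fun j => (D.σ ^ j) u), map_prod]
    refine Finset.prod_congr rfl fun j _ => ?_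
    rw [pow_succ']; rfl
  have h : (D.y - D.incl u) * D.cofactor u = ∑ l ∈ Finset.range D.n, (f (l + 1) - f l) := by
    rw [cofactor, Finset.mul_sum, ← Fin.sum_univ_eq_sum_range (fun l => f (l + 1) - f l)]
    refine Finset.sum_congr rfl fun l _ => ?_
    simp only [f]
    rw [sub_mul, ← mul_assoc, y_mul_incl, mul_assoc, ← pow_succ', hσ, ← mul_assoc, ← map_mul,
      Finset.prod_Ico_succ_top (show (l : ℕ) + 1 ≤ D.n from l.2), σ_pow_n, AlgHom.one_apply,
      mul_comm u]
  rw [h, Finset.sum_range_sub]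
  simp only [f]
  rw [Finset.Ico_self, Finset.prod_empty, map_one, one_mul, y_pow_n', pow_zero, mul_one, ← hσ,
    ← Finset.range_eq_Ico, ← N, hu, σ_c, sub_self]

/-- In degree l + 1 the equation reads t_l = t_{l+1} σˡ⁺¹(u), so all coefficients are determined by
the top one. -/
theorem eq_zero_of_mul_eq_zero {t : D.Alg} (ht : t * (D.y - D.incl u) = 0)
    (h0 : D.coef ⟨D.n - 1, Nat.sub_lt D.n_pos one_pos⟩ t = 0) : t = 0 := by
  have key : ∀ (d l : ℕ) (hl : l + d + 1 = D.n), D.coef ⟨l, by omega⟩ t = 0 := by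
    intro d
    induction d with
    | zero => intro l hl; obtain rfl : l = D.n - 1 := by omega
              exact h0
    | succ d ih =>
      intro l hl
      have h1 := congrArg (D.coef ⟨l + 1, by omega⟩) ht
      rw [mul_sub, map_sub, coef_succ_mul_y, coef_mul_incl, ih (l + 1) (by omega), zero_mul,
        sub_zero, map_zero] at h1
      exact h1
  refine D.coef_ext fun l => ?_
  rw [map_zero]
  exact key (D.n - 1 - l) l (by omega)

include hu in
theorem mul_eq_zero_iff (t : D.Alg) : t * (D.y - D.incl u) = 0 ↔
    t = D.incl (D.coef ⟨D.n - 1, Nat.sub_lt D.n_pos one_pos⟩ t) * D.cofactor u := by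
  constructor
  · intro ht
    rw [← sub_eq_zero]
    refine D.eq_zero_of_mul_eq_zero (u := u) ?_ ?_
    · rw [sub_mul, ht, mul_assoc, D.cofactor_mul hu, mul_zero, sub_zero]
    · rw [map_sub, coef_incl_mul, coef_cofactor, mul_one, sub_self]
  · intro ht
    rw [ht, mul_assoc, D.cofactor_mul hu, mul_zero]

/-- Modulo the left ideal of y - u a rightmost y may be replaced by u, and yˡ u = σˡ(u) yˡ. Every
element is thus congruent to one of R. -/
theorem exists_sub_eq_mul (u : D.R) (t : D.Alg) :
    ∃ a, t - D.incl (∑ l, D.coef l t * D.N u l) = a * (D.y - D.incl u) := by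
  have key : ∀ (l : ℕ) (r : D.R), D.incl r * D.y ^ l - D.incl (r * D.N u l) ∈
      Submodule.span D.Alg {D.y - D.incl u} := by
    intro l
    induction l with
    | zero => intro r; simp [N]
    | succ l ih =>
      intro r
      have h : D.incl r * D.y ^ (l + 1) - D.incl (r * D.N u (l + 1)) =
          (D.incl r * D.y ^ l) • (D.y - D.incl u) +
            (D.incl (r * (D.σ ^ l) u) * D.y ^ l - D.incl (r * (D.σ ^ l) u * D.N u l)) := by
        rw [smul_eq_mul, mul_sub, mul_assoc _ _ (D.incl u), pow_y_mul_incl, N_succ, pow_succ,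
          mul_comm (D.N u l), map_mul _ r ((D.σ ^ l) u), mul_assoc, mul_assoc, mul_assoc r]
        abel
      rw [h]
      exact add_mem (Submodule.smul_mem _ _ (Submodule.mem_span_singleton_self _)) (ih _)
  have h : t - D.incl (∑ l, D.coef l t * D.N u l) ∈ Submodule.span D.Alg {D.y - D.incl u} := by
    have : t - D.incl (∑ l, D.coef l t * D.N u l) =
        ∑ l, (D.incl (D.coef l t) * D.y ^ (l : ℕ) - D.incl (D.coef l t * D.N u l)) := by
      rw [Finset.sum_sub_distrib, sum_coef, map_sum]
    rw [this]
    exact Submodule.sum_mem _ fun l _ => key _ _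
  obtain ⟨a, ha⟩ := Submodule.mem_span_singleton.1 h
  exact ⟨a, ha.symm⟩

include hu in
theorem mul_cofactor_eq (t : D.Alg) :
    t * D.cofactor u = D.incl (∑ l, D.coef l t * D.N u l) * D.cofactor u := by
  obtain ⟨a, ha⟩ := D.exists_sub_eq_mul u t
  rw [← sub_eq_zero, ← sub_mul, ha, mul_assoc, D.mul_cofactor hu, mul_zero]

theorem incl_mul_cofactor_injective (u : D.R) :
    Function.Injective fun r => D.incl r * D.cofactor u := by
  intro r r' h
  have := congrArg (D.coef ⟨D.n - 1, Nat.sub_lt D.n_pos one_pos⟩) h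
  simpa only [coef_incl_mul, coef_cofactor, mul_one] using this

include hu in
-- Let q be the cofactor. A splitting of b ↦ b q sends q to some β with β q = q and (y - u) β = 0.
-- The first condition says ∑ β_l N_l = 1, with N_l the partial norms of u. Under the augmentation
-- the terms with l > 0 vanish, since u divides N_l and augments to 0. The second condition makes
-- β_0 a multiple of σⁿ⁻¹(u), which also augments to 0, so 0 = 1.
theorem not_projective_range (h0 : D.augR u = 0) (h1 : D.augR ((D.σ ^ (D.n - 1)) u) = 0) :
    ¬ Module.Projective D.Alg
      (LinearMap.range (LinearMap.toSpanSingleton D.Alg D.Alg (D.cofactor u))) := by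
  intro hproj
  let q := LinearMap.toSpanSingleton D.Alg D.Alg (D.cofactor u)
  obtain ⟨s, hs⟩ := Module.projective_lifting_property q.rangeRestrict
    (LinearMap.id : LinearMap.range q →ₗ[D.Alg] LinearMap.range q) q.surjective_rangeRestrict
  let Q : LinearMap.range q := ⟨D.cofactor u, 1, by simp [q]⟩
  have hβ : s Q * D.cofactor u = D.cofactor u :=
    congrArg Subtype.val (LinearMap.congr_fun hs Q)
  have hβ' : (D.y - D.incl u) * s Q = 0 := by
    have : (D.y - D.incl u) • Q = 0 := Subtype.ext (D.mul_cofactor hu)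
    rw [← smul_eq_mul, ← map_smul, this, map_zero]
  generalize s Q = β at hβ hβ'
  have hev : ∑ l, D.coef l β * D.N u l = 1 := by
    apply D.incl_mul_cofactor_injective u
    simp only
    rw [← D.mul_cofactor_eq hu, hβ, map_one, one_mul]
  have hn := D.one_lt_n
  have hc : D.c = u * D.σ (D.N u (D.n - 1)) := by
    rw [← N_succ', Nat.sub_add_cancel D.n_pos, hu]
  -- The degree-0 part of (y - u) β = 0 is σ(β_{n-1}) c = u β_0; here c = u σ(N_{n-1}), and u can be
  -- cancelled as a divisor of c.
  have hβ0 : D.coef ⟨0, D.n_pos⟩ β =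
      D.σ (D.coef ⟨D.n - 1, Nat.sub_lt D.n_pos one_pos⟩ β) * D.σ (D.N u (D.n - 1)) := by
    have h2 := congrArg (D.coef ⟨0, D.n_pos⟩) hβ'
    rw [sub_mul, map_sub, coef_zero_y_mul, coef_incl_mul, map_zero, hc] at h2
    rw [← sub_eq_zero]
    apply D.c_mul_cancel
    rw [hc]
    linear_combination -(D.σ (D.N u (D.n - 1))) * h2
  have h3 := congrArg D.augR hev
  rw [map_sum, Finset.sum_eq_single ⟨0, D.n_pos⟩] at h3
  · have h4 : D.augR (D.σ (D.N u (D.n - 1))) = 0 := by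
      obtain ⟨m, hm⟩ : ∃ m, D.n = m + 2 := ⟨D.n - 2, by omega⟩
      have : D.n - 1 = m + 1 := by omega
      rw [this] at h1 ⊢
      rw [N_succ, map_mul, map_mul]
      rw [pow_succ'] at h1
      exact mul_eq_zero_of_right _ h1
    rw [hβ0, map_mul, map_mul, h4, mul_zero, zero_mul, map_one] at h3
    exact zero_ne_one h3
  · intro l _ hl
    obtain ⟨m, hm⟩ : ∃ m, (l : ℕ) = m + 1 :=
      Nat.exists_eq_succ_of_ne_zero fun h => hl (Fin.ext h)
    rw [hm, N_succ', map_mul, map_mul, h0, zero_mul, mul_zero]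
  · simp

end twist

open CategoryTheory in
theorem globalDim_eq_top (hw : (D.w : k) = 0) : globalDim D.Alg = ⊤ := by
  by_contra htop
  obtain ⟨u, hu, h0, h1⟩ := D.exists_twist hw
  refine D.not_projective_range hu h0 h1 ?_
  have hpd : projectiveDimension (ModuleCat.of D.Alg
      (LinearMap.range (LinearMap.toSpanSingleton D.Alg D.Alg (D.cofactor u)))) ≠ ⊤ :=
    fun h => htop (top_le_iff.1 (h ▸ le_iSup (fun M : ModuleCat.{u} D.Alg => projectiveDimension M) _))
  obtain ⟨m, hm⟩ := (projectiveDimension_ne_top_iff _).1 hpd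
  refine projective_of_periodic (a := D.y - D.incl u) ?_ ?_ m hm
  · ext t
    rw [LinearMap.mem_ker, LinearMap.toSpanSingleton_apply, smul_eq_mul]
    constructor
    · intro h
      exact ⟨_, ((D.mul_eq_zero_iff hu t).1 h).symm⟩
    · rintro ⟨r, rfl⟩
      rw [LinearMap.toSpanSingleton_apply, smul_eq_mul, mul_assoc, D.cofactor_mul hu, mul_zero]
  · ext t
    rw [LinearMap.mem_ker, LinearMap.toSpanSingleton_apply, smul_eq_mul]
    constructor
    · intro h
      obtain ⟨a, ha⟩ := D.exists_sub_eq_mul u t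
      rw [D.mul_cofactor_eq hu] at h
      have h2 : ∑ l, D.coef l t * D.N u l = 0 :=
        D.incl_mul_cofactor_injective u (by simpa using h)
      rw [h2, map_zero, sub_zero] at ha
      exact ⟨a, ha.symm⟩
    · rintro ⟨r, rfl⟩
      rw [LinearMap.toSpanSingleton_apply, smul_eq_mul, mul_assoc, D.mul_cofactor hu, mul_zero]

theorem globalDim_lt_top_iff : globalDim D.Alg < ⊤ ↔ IsUnit (D.w : k) := by
  rw [isUnit_iff_ne_zero]
  constructor
  · intro h hw
    exact h.ne (D.globalDim_eq_top hw)
  · intro hw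
    rw [D.globalDim_eq_one_of_ne_zero hw]
    exact lt_of_le_of_ne le_top (by decide)

theorem globalDim_eq_one (h : globalDim D.Alg < ⊤) : globalDim D.Alg = 1 :=
  D.globalDim_eq_one_of_ne_zero (D.globalDim_lt_top_iff.1 h).ne_zero

end LiuDatum

/-! ### Assembly of the theorem -/

theorem theorem3p4 {k : Type u} [Field k] [IsAlgClosed k] (D : LiuDatum k) :
    -- (a) the second presentation
    (∃ e : LiuAlg' D.n D.w D.ξ ≃ₐ[k] D.Alg,
      e (LiuAlg'.gen _ _ _ .x) = D.x ∧ e (LiuAlg'.gen _ _ _ .xInv) = ((D.x⁻¹ : D.Algˣ) : D.Alg) ∧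
      e (LiuAlg'.gen _ _ _ .g) = D.g ∧ e (LiuAlg'.gen _ _ _ .y) = D.y) ∧
    -- (b) affine, noetherian, Gel'fand-Kirillov dimension one, centre `k[x, x⁻¹]`
    Algebra.FiniteType k D.Alg ∧
    IsNoetherianRing D.Alg ∧ IsNoetherianRing D.Algᵐᵒᵖ ∧
    gkDim k D.Alg = 1 ∧
    (∃ e : k[T;T⁻¹] ≃ₐ[k] Subalgebra.center k D.Alg,
      (e (LaurentPolynomial.T 1) : D.Alg) = D.x) ∧
    -- (c)
    IsPrimeRing D.Alg ∧
    -- (d)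
    IsPIDegree D.Alg D.n ∧
    -- (e)
    (globalDim D.Alg < ⊤ ↔ IsUnit (D.w : k)) ∧
    (globalDim D.Alg < ⊤ → globalDim D.Alg = 1) ∧
    -- (f) and (g)
    (∃ π : D.Alg →ₐ[k] k,
      IsIntegralCharacter (Bialgebra.counitAlgHom k D.Alg) π ∧
      characterOrder π = D.n ∧ windingIndex π = D.n ∧
      fixedSubalgebra (windingLeft π) =
        Algebra.adjoin k {D.y, (D.x : D.Alg), ((D.x⁻¹ : D.Algˣ) : D.Alg)} ∧
      fixedSubalgebra (windingRight π) =
        Algebra.adjoin k {D.y * ((D.g⁻¹ : D.Algˣ) : D.Alg), (D.x : D.Alg),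
          ((D.x⁻¹ : D.Algˣ) : D.Alg)} ∧
      fixedSubalgebra (windingLeft π) ⊓ fixedSubalgebra (windingRight π) =
        Algebra.adjoin k {(D.x : D.Alg), ((D.x⁻¹ : D.Algˣ) : D.Alg)} ∧
      fixedSubalgebra (windingLeft π) ⊓ fixedSubalgebra (windingRight π) =
        Subalgebra.center k D.Alg) ∧
    -- (h) the group-like elements
    (∃ e : Multiplicative ℤ × Multiplicative (ZMod D.b) ≃* GroupLike k D.Alg,
      (e (Multiplicative.ofAdd 1, 1) : D.Alg) = D.h ∧
      (e (1, Multiplicative.ofAdd 1) : D.Alg) = D.f) ∧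
    -- (i) the nontrivial skew-primitive elements
    (∀ a z : D.Alg, IsGroupLikeElem k a → a ≠ 1 →
      Coalgebra.comul (R := k) z = z ⊗ₜ[k] a + 1 ⊗ₜ[k] z →
      z ∉ Submodule.span k {1 - a} →
      a = D.g ∧ z ∈ Submodule.span k {D.y, 1 - (D.g : D.Alg)}) ∧
    -- (j) Hopf algebra isomorphisms
    (∀ (D' : LiuDatum k) (φ : D'.Alg ≃ₐc[k] D.Alg),
      D'.n = D.n ∧ D'.w = D.w ∧ D'.ξ = D.ξ ∧
      φ D'.x = D.x ∧ φ D'.g = D.g ∧ ∃ η : k, η ^ D.n = 1 ∧ φ D'.y = η • D.y) := by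
  refine ⟨⟨D.presentationEquiv, ?_, ?_, ?_, ?_⟩, D.finiteType, D.isNoetherianRing,
    D.isNoetherianRing_op, D.gkDim_eq_one, ⟨D.centerEquiv, D.centerEquiv_T⟩, D.isPrimeRing,
    D.isPIDegree, D.globalDim_lt_top_iff, D.globalDim_eq_one,
    ⟨D.π, D.isIntegralCharacter_π, D.characterOrder_π, D.windingIndex_π, D.fixed_windingLeft,
      D.fixed_windingRight, D.fixed_inf, D.fixed_inf.trans D.adjoin_x⟩,
    ⟨D.groupLikeEquiv, ?_, ?_⟩, fun a z => D.skewPrimitive, fun D' φ => D.iso_invariants D' φ⟩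
  · rw [D.presentationEquiv_gen, D.ofAlg'_gen]
  · rw [D.presentationEquiv_gen, D.ofAlg'_gen]
  · rw [D.presentationEquiv_gen, D.ofAlg'_gen]
  · rw [D.presentationEquiv_gen, D.ofAlg'_gen]
  · rw [D.val_groupLikeEquiv, ← D.U_hG]; rfl
  · rw [D.val_groupLikeEquiv, ← D.U_fG]; rfl
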